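/- Consider the equal-mass three-loop banana integrals in $D=2-2\varepsilon$ dimensions, with $x=p^2/m^2$ and $\varepsilon\in\mathbb C$, $\varepsilon\ne0$, $\operatorname{Re}\varepsilon>-\tfrac13$. Put $$I_{1110}=\big[e^{\gamma_E\varepsilon}\Gamma(\varepsilon)\big]^3,\qquad I_{1111}=e^{3\gamma_E\varepsilon}\Gamma(1+3\varepsilon)\int_{a_i\ge0}d^4a\,\delta\Big(1-\sum_i a_i\Big)\frac{\mathcal U^{4\varepsilon}}{\mathcal F^{1+3\varepsilon}},$$ $$\mathcal U=a_1a_2a_3+a_1a_2a_4+a_1a_3a_4+a_2a_3a_4,\qquad \mathcal F=-x\,a_1a_2a_3a_4+(a_1+a_2+a_3+a_4)\,\mathcal U .$$ *Periods.* For $x<0$ let $R=\sqrt{4-x}\sqrt{16-x}$ and $y=\tfrac12(10-x-R)\in(0,1)$. Let $u_1=-4$, $u_2=-(1+\sqrt y)^2$, $u_3=-(1-\sqrt y)^2$, $u_4=0$ and $U_1=(u_3-u_2)(u_4-u_1)$, $U_2=(u_2-u_1)(u_4-u_3)$, $U_3=(u_3-u_1)(u_4-u_2)$, $k^2=U_1/U_3$,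 $\bar k^2=U_2/U_3$. With $K$ the complete elliptic integral of the first kind (as a function of the modulus) let $$\psi_1^{\rm sun}=\frac{4}{\sqrt{U_3}}K(k),\quad \psi_2^{\rm sun}=\frac{4i}{\sqrt{U_3}}K(\bar k),\quad \psi_j=\sqrt y\,\psi_j^{\rm sun},\quad \tau=\frac{\psi_2}{\psi_1},\quad W=\psi_1\frac{d\psi_2}{dx}-\psi_2\frac{d\psi_1}{dx},\quad \frac{d}{d\tau}=\Big(\frac{d\tau}{dx}\Big)^{-1}\frac{d}{dx}.$$ Further let $$b_0=\frac{\psi_1^{\rm sun}}{\pi},\quad b_1=y\,b_0,\quad b_3=\frac{b_0}{y-3},\quad b_{-3}=\frac{b_0}{y+3},\qquad g_6=\frac{x(x-8)(x+8)^3}{864\,R^3}\Big(\frac{\psi_1}{\pi}\Big)^6,$$ $$F_2=I(1,g_6;\tau)=(2\pi i)^2\int_{i\infty}^{\tau}d\tau_1\int_{i\infty}^{\tau_1}d\tau_2\;g_6(\tau_2),$$ where the integration is along the imaginary axis, the image of $x\in(-\infty,0)$ with $x=-\infty$ corresponding to $\tau=i\infty$. *Master integrals.* With $h=\dfrac{\pi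 i\,(x-10)}{(x-4)(x-16)W}\Big(\dfrac{\psi_1}{\pi}\Big)^2$ let $$I_1=\varepsilon^3I_{1110},\qquad I_2=\varepsilon^3\frac{\pi^2}{\psi_1^2}I_{1111},\qquad I_3=\frac1{2\pi i\varepsilon}\frac{dI_2}{d\tau}+(F_2-h)\,I_2,$$ $$I_4=\frac1{2\pi i\varepsilon}\frac{dI_3}{d\tau}+\Big[\tfrac32F_2^2+\frac{\pi^2(x+8)^2(x^2-8x+64)}{8x^2(x-4)^2(x-16)^2W^2}\Big(\frac{\psi_1}{\pi}\Big)^4\Big]I_2+(-2F_2-h)\,I_3 .$$ *Letters.* Let $f_{2,b}=F_2$ and $$f_{2,a}=\tfrac16b_1^2-\tfrac53b_0b_1+\tfrac92b_0^2-6b_0b_3-24b_0b_{-3},\qquad f_{4,a}=\tfrac1{72}b_1^4-\tfrac5{36}b_0b_1^3+\tfrac54b_0^3b_1-\tfrac98b_0^4,$$ $$p_4=\tfrac1{288}b_1^4-\tfrac16b_0b_1^3+\tfrac{149}{48}b_0^2b_1^2-\tfrac{63}2b_0^3b_1+\tfrac{6537}{32}b_0^4+54b_0^2b_3^2+54b_0^3b_3+864b_0^2b_{-3}^2-864b_0^3b_{-3},$$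 $$p_6=\tfrac1{864}b_0b_1^5-\tfrac{11}{144}b_0^2b_1^4+\tfrac{107}{54}b_0^3b_1^3-\tfrac{421}{16}b_0^4b_1^2+\tfrac{6685}{32}b_0^5b_1-1251b_0^6+108b_0^3b_3^3+162b_0^4b_3^2+81b_0^5b_3+6912b_0^3b_{-3}^3-10368b_0^4b_{-3}^2+6480b_0^5b_{-3},$$ $$f_{4,b}=p_4-\tfrac32F_2^2,\qquad f_6=4p_6-2p_4F_2+F_2^3 .$$ *Claim.* (a) For all $x<0$ and all $\varepsilon$ as above, the vector $I=(I_1,I_2,I_3,I_4)^T$ satisfies $dI=\varepsilon A\,I$ with the $\varepsilon$-independent matrix $$A=2\pi i\begin{pmatrix}0&0&0&0\\0&-f_{2,a}-f_{2,b}&1&0\\0&f_{4,b}&-f_{2,a}+2f_{2,b}&1\\f_{4,a}&f_6&f_{4,b}&-f_{2,a}-f_{2,b}\end{pmatrix}d\tau .$$ Moreover, for all $x<0$, $2\pi i\,f_{2,a}\,d\tau=d\ln(x-4)+d\ln(x-16)$, $g_6=p_6$, and the letters have the following expressions in $x$: $$f_{2,a}=\Big(\frac1{x-4}+\frac1{x-16}\Big)\frac{\psi_1^2}{2\pi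 iW},\quad f_{4,a}=\frac{xR}{72}\Big(\frac{\psi_1}\pi\Big)^4,\quad f_{4,b}=\frac{(x+8)^2(x^2-8x+64)}{288(x-4)(x-16)}\Big(\frac{\psi_1}\pi\Big)^4-\frac32F_2^2,$$ $$f_6=\frac{x(x-8)(x+8)^3}{216R^3}\Big(\frac{\psi_1}\pi\Big)^6-\frac{(x+8)^2(x^2-8x+64)}{144(x-4)(x-16)}\Big(\frac{\psi_1}\pi\Big)^4F_2+F_2^3,$$ and in $y$: $$f_{2,a}=\Big[\tfrac16y^2-\tfrac53y+\tfrac92-\tfrac6{y-3}-\tfrac{24}{y+3}\Big]b_0^2,\qquad f_{4,a}=\tfrac1{72}(y-1)(y-9)(y-3)(y+3)\,b_0^4,$$ $$g_6=\frac{y(y-1)(y-9)(y^2-2y+9)(y^2-18y+9)^3}{864(y-3)^3(y+3)^3}b_0^6,\qquad f_{4,b}=q_4-\tfrac32F_2^2,\qquad f_6=4g_6-2q_4F_2+F_2^3,$$ where $q_4=\dfrac{(y^2-18y+9)^2(y^4-12y^3+102y^2-108y+81)}{288(y-3)^2(y+3)^2}\,b_0^4$. (b) The same holds under analytic continuation in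 $x$: if $U\subseteq\mathbb C\setminus\{0,4,16\}$ is open and connected and contains a point $x_0<0$, and if $R,\sqrt y,\psi_1^{\rm sun},\psi_2^{\rm sun},F_2$ and, for given $\varepsilon$, $I_{1111}$ are replaced by holomorphic functions on $U$ that agree with them on the real axis near $x_0$, with $\psi_1^{\rm sun}$ without zeros on $U$, then the identities for $g_6$ and the letters hold at all points of $U$, and so does $dI=\varepsilon AI$. -/

import Mathlib

open Filter Topology MeasureTheory

namespace Banana

noncomputable section

/-! ### Feynman integrals

Dimensionally regularised integrals in `D = 2 - 2ε` dimensions, in units of the mass, as functions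
of `x = p² / m²` on the Euclidean axis `x < 0`. -/

/-- The one-loop tadpole `e^{γε} (m²)^{1-D/2} ∫ d^D k / (i π^{D/2}) · 1 / (-k² + m²)`, which equals
`e^{γε} Γ(1 - D/2) = e^{γε} Γ(ε)`. -/
def tadpole (ε : ℂ) : ℂ :=
  Complex.exp (Real.eulerMascheroniConstant * ε) * Complex.Gamma ε

/-- Schwinger representation of the tadpole in the region of convergence of the `α`-integral. -/
theorem tadpole_eq_schwinger (ε : ℂ) (hε : 0 < ε.re) :
    tadpole ε = Complex.exp (Real.eulerMascheroniConstant * ε) *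
      ∫ α : ℝ in Set.Ioi 0, (Real.exp (-α) : ℂ) * (α : ℂ) ^ (ε - 1) := by
  rw [tadpole, Complex.Gamma_eq_integral hε, Complex.GammaIntegral]

/-- `I_{1110}`: the product of three tadpoles. -/
def bananaI1110 (ε : ℂ) : ℂ := tadpole ε ^ 3

/-- The first Symanzik polynomial of the three-loop banana graph. -/
def symanzikU (a₁ a₂ a₃ a₄ : ℝ) : ℝ :=
  a₁ * a₂ * a₃ + a₁ * a₂ * a₄ + a₁ * a₃ * a₄ + a₂ * a₃ * a₄

/-- The second Symanzik polynomial of the three-loop banana graph with equal masses. -/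
def symanzikF (x a₁ a₂ a₃ a₄ : ℝ) : ℝ :=
  -x * (a₁ * a₂ * a₃ * a₄) + (a₁ + a₂ + a₃ + a₄) * symanzikU a₁ a₂ a₃ a₄

/-- The parameters `(a₁, a₂, a₃)` of the simplex `a_i > 0`, `a₁ + a₂ + a₃ + a₄ = 1`. -/
def feynmanSimplex : Set (ℝ × ℝ × ℝ) :=
  {a | 0 < a.1 ∧ 0 < a.2.1 ∧ 0 < a.2.2 ∧ a.1 + a.2.1 + a.2.2 < 1}

/-- `I_{1111}`, by its Feynman parametrisation
`e^{3γε} Γ(1+3ε) ∫ d⁴a δ(1 - ∑ a_i) U^{4ε} / F^{1+3ε}`. For `x < 0` both `U` and `F` are positive on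
the simplex, and the integral converges for `Re ε > -1/3`. -/
def bananaI1111 (ε : ℂ) (x : ℝ) : ℂ :=
  Complex.exp (3 * Real.eulerMascheroniConstant * ε) * Complex.Gamma (1 + 3 * ε) *
    ∫ a in feynmanSimplex,
      (symanzikU a.1 a.2.1 a.2.2 (1 - a.1 - a.2.1 - a.2.2) : ℂ) ^ (4 * ε) /
        (symanzikF x a.1 a.2.1 a.2.2 (1 - a.1 - a.2.1 - a.2.2) : ℂ) ^ (1 + 3 * ε)

/-! ### Periods, letters and master integrals

Everything is written for functions on a field `𝕜`: either `ℝ` (the Euclidean axis) or `ℂ`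
(analytic continuation in `x`). -/

/-- The complete elliptic integral of the first kind, as a function of the modulus `k ∈ [0, 1)`. -/
def ellipticK (k : ℝ) : ℝ :=
  ∫ t in (0 : ℝ)..1, 1 / √((1 - t ^ 2) * (1 - k ^ 2 * t ^ 2))

/-- A branch of the functions of `x` from which everything else is built: the square root
`√(4-x) √(16-x)`, the square root `√y`, and the two periods of the sunrise elliptic curve. -/
structure Branch (𝕜 : Type) where
  root : 𝕜 → ℂ
  sqrtY : 𝕜 → ℂ
  psiSun₁ : 𝕜 → ℂ
  psiSun₂ : 𝕜 → ℂ

namespace Branch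

variable {𝕜 : Type} [NontriviallyNormedField 𝕜] [NormedAlgebra 𝕜 ℂ]

/-- `y = (10 - x - √(4-x) √(16-x)) / 2`. -/
def y (P : Branch 𝕜) (x : 𝕜) : ℂ := (10 - algebraMap 𝕜 ℂ x - P.root x) / 2

/-- `ψ₁ = √y ψ₁^sunrise`. -/
def psi₁ (P : Branch 𝕜) (x : 𝕜) : ℂ := P.sqrtY x * P.psiSun₁ x

/-- `ψ₂ = √y ψ₂^sunrise`. -/
def psi₂ (P : Branch 𝕜) (x : 𝕜) : ℂ := P.sqrtY x * P.psiSun₂ x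

/-- `τ = ψ₂ / ψ₁`. -/
def tau (P : Branch 𝕜) (x : 𝕜) : ℂ := P.psi₂ x / P.psi₁ x

/-- The Wronskian `W = ψ₁ dψ₂/dx - ψ₂ dψ₁/dx`. -/
def W (P : Branch 𝕜) (x : 𝕜) : ℂ := P.psi₁ x * deriv P.psi₂ x - P.psi₂ x * deriv P.psi₁ x

/-- The derivative `d/dτ = J d/dx` with the Jacobian `J = dx/dτ = (dτ/dx)⁻¹`. -/
def derivTau (P : Branch 𝕜) (f : 𝕜 → ℂ) (x : 𝕜) : ℂ := (deriv P.tau x)⁻¹ * deriv f x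

def b₀ (P : Branch 𝕜) (x : 𝕜) : ℂ := P.psiSun₁ x / Real.pi

def b₁ (P : Branch 𝕜) (x : 𝕜) : ℂ := P.y x * (P.psiSun₁ x / Real.pi)

def b₃ (P : Branch 𝕜) (x : 𝕜) : ℂ := 1 / (P.y x - 3) * (P.psiSun₁ x / Real.pi)

/-- `b_{-3}`. -/
def bm₃ (P : Branch 𝕜) (x : 𝕜) : ℂ := 1 / (P.y x + 3) * (P.psiSun₁ x / Real.pi)

/-- `g₆ = x (x-8) (x+8)³ / (864 (4-x)^{3/2} (16-x)^{3/2}) · (ψ₁/π)⁶`. -/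
def g₆ (P : Branch 𝕜) (x : 𝕜) : ℂ :=
  let X := algebraMap 𝕜 ℂ x
  X * (X - 8) * (X + 8) ^ 3 / (864 * P.root x ^ 3) * (P.psi₁ x / Real.pi) ^ 6

/-- The letter `f_{2,a}`. -/
def f₂a (P : Branch 𝕜) (x : 𝕜) : ℂ :=
  1 / 6 * P.b₁ x ^ 2 - 5 / 3 * P.b₀ x * P.b₁ x + 9 / 2 * P.b₀ x ^ 2 - 6 * P.b₀ x * P.b₃ x
    - 24 * P.b₀ x * P.bm₃ x

/-- The letter `f_{2,b} = F₂`. -/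
def f₂b (F₂ : 𝕜 → ℂ) (x : 𝕜) : ℂ := F₂ x

/-- The letter `f_{4,a}`. -/
def f₄a (P : Branch 𝕜) (x : 𝕜) : ℂ :=
  1 / 72 * P.b₁ x ^ 4 - 5 / 36 * P.b₀ x * P.b₁ x ^ 3 + 5 / 4 * P.b₀ x ^ 3 * P.b₁ x
    - 9 / 8 * P.b₀ x ^ 4

/-- The letter `f_{4,b}`. -/
def f₄b (P : Branch 𝕜) (F₂ : 𝕜 → ℂ) (x : 𝕜) : ℂ :=
  1 / 288 * P.b₁ x ^ 4 - 1 / 6 * P.b₀ x * P.b₁ x ^ 3 + 149 / 48 * P.b₀ x ^ 2 * P.b₁ x ^ 2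
    - 63 / 2 * P.b₀ x ^ 3 * P.b₁ x + 6537 / 32 * P.b₀ x ^ 4
    + 54 * P.b₀ x ^ 2 * P.b₃ x ^ 2 + 54 * P.b₀ x ^ 3 * P.b₃ x
    + 864 * P.b₀ x ^ 2 * P.bm₃ x ^ 2 - 864 * P.b₀ x ^ 3 * P.bm₃ x
    - 3 / 2 * F₂ x ^ 2

/-- The letter `f₆`. -/
def f₆ (P : Branch 𝕜) (F₂ : 𝕜 → ℂ) (x : 𝕜) : ℂ :=
  1 / 216 * P.b₀ x * P.b₁ x ^ 5 - 11 / 36 * P.b₀ x ^ 2 * P.b₁ x ^ 4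
    + 214 / 27 * P.b₀ x ^ 3 * P.b₁ x ^ 3 - 421 / 4 * P.b₀ x ^ 4 * P.b₁ x ^ 2
    + 6685 / 8 * P.b₀ x ^ 5 * P.b₁ x - 5004 * P.b₀ x ^ 6
    + 432 * P.b₀ x ^ 3 * P.b₃ x ^ 3 + 648 * P.b₀ x ^ 4 * P.b₃ x ^ 2 + 324 * P.b₀ x ^ 5 * P.b₃ x
    + 27648 * P.b₀ x ^ 3 * P.bm₃ x ^ 3 - 41472 * P.b₀ x ^ 4 * P.bm₃ x ^ 2
    + 25920 * P.b₀ x ^ 5 * P.bm₃ x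
    - (1 / 144 * P.b₁ x ^ 4 - 1 / 3 * P.b₀ x * P.b₁ x ^ 3 + 149 / 24 * P.b₀ x ^ 2 * P.b₁ x ^ 2
        - 63 * P.b₀ x ^ 3 * P.b₁ x + 6537 / 16 * P.b₀ x ^ 4
        + 108 * P.b₀ x ^ 2 * P.b₃ x ^ 2 + 108 * P.b₀ x ^ 3 * P.b₃ x
        + 1728 * P.b₀ x ^ 2 * P.bm₃ x ^ 2 - 1728 * P.b₀ x ^ 3 * P.bm₃ x) * F₂ x
    + F₂ x ^ 3

/-- The coefficient of `dx` in the connection matrix `A`, which is `2πi (letters) dτ`. -/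
def connection (P : Branch 𝕜) (F₂ : 𝕜 → ℂ) (x : 𝕜) : Matrix (Fin 4) (Fin 4) ℂ :=
  (2 * Real.pi * Complex.I * deriv P.tau x) •
    !![0, 0, 0, 0;
       0, -P.f₂a x - f₂b F₂ x, 1, 0;
       0, P.f₄b F₂ x, -P.f₂a x + 2 * f₂b F₂ x, 1;
       P.f₄a x, P.f₆ F₂ x, P.f₄b F₂ x, -P.f₂a x - f₂b F₂ x]

/-- `I₁ = ε³ I_{1110}`. -/
def I₁ (ε : ℂ) : ℂ := ε ^ 3 * bananaI1110 ε

/-- `I₂ = ε³ π² / ψ₁² · I_{1111}`; here and below `Φ` is (a branch of) `I_{1111}` at the given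
`ε`. -/
def I₂ (P : Branch 𝕜) (ε : ℂ) (Φ : 𝕜 → ℂ) (x : 𝕜) : ℂ :=
  ε ^ 3 * (Real.pi ^ 2 / P.psi₁ x ^ 2) * Φ x

/-- The term `πi (x-10) / ((x-4) (x-16) W) · (ψ₁/π)²`. -/
def correction (P : Branch 𝕜) (x : 𝕜) : ℂ :=
  let X := algebraMap 𝕜 ℂ x
  Real.pi * Complex.I * (X - 10) / ((X - 4) * (X - 16) * P.W x) * (P.psi₁ x / Real.pi) ^ 2

def I₃ (P : Branch 𝕜) (F₂ : 𝕜 → ℂ) (ε : ℂ) (Φ : 𝕜 → ℂ) (x : 𝕜) : ℂ :=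
  1 / (2 * Real.pi * Complex.I * ε) * P.derivTau (P.I₂ ε Φ) x
    + (F₂ x - P.correction x) * P.I₂ ε Φ x

def I₄ (P : Branch 𝕜) (F₂ : 𝕜 → ℂ) (ε : ℂ) (Φ : 𝕜 → ℂ) (x : 𝕜) : ℂ :=
  let X := algebraMap 𝕜 ℂ x
  1 / (2 * Real.pi * Complex.I * ε) * P.derivTau (P.I₃ F₂ ε Φ) x
    + (3 / 2 * F₂ x ^ 2
        + Real.pi ^ 2 * (X + 8) ^ 2 * (X ^ 2 - 8 * X + 64)
            / (8 * X ^ 2 * (X - 4) ^ 2 * (X - 16) ^ 2 * P.W x ^ 2)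
          * (P.psi₁ x / Real.pi) ^ 4) * P.I₂ ε Φ x
    + (-2 * F₂ x - P.correction x) * P.I₃ F₂ ε Φ x

/-- The vector of master integrals. -/
def masterIntegrals (P : Branch 𝕜) (F₂ : 𝕜 → ℂ) (ε : ℂ) (Φ : 𝕜 → ℂ) (x : 𝕜) : Fin 4 → ℂ :=
  ![I₁ ε, P.I₂ ε Φ x, P.I₃ F₂ ε Φ x, P.I₄ F₂ ε Φ x]

/-- The differential equation `dI = ε A I` at `x`. -/
def EpsFactorised (P : Branch 𝕜) (F₂ : 𝕜 → ℂ) (ε : ℂ) (Φ : 𝕜 → ℂ) (x : 𝕜) : Prop :=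
  HasDerivAt (P.masterIntegrals F₂ ε Φ)
    (ε • (P.connection F₂ x).mulVec (P.masterIntegrals F₂ ε Φ x)) x

/-- The expressions of `g₆` and of the letters in terms of `x` and in terms of `y`, and of `g₆` as a
polynomial in `b₀, b₁, b₃, b_{-3}`, at `x`. -/
structure LetterIdentities (P : Branch 𝕜) (F₂ : 𝕜 → ℂ) (x : 𝕜) : Prop where
  g₆_y : P.g₆ x =
    P.y x * (P.y x - 1) * (P.y x - 9) * (P.y x ^ 2 - 2 * P.y x + 9)
        * (P.y x ^ 2 - 18 * P.y x + 9) ^ 3 / (864 * (P.y x - 3) ^ 3 * (P.y x + 3) ^ 3)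
      * (P.psiSun₁ x / Real.pi) ^ 6
  g₆_b : P.g₆ x =
    1 / 864 * P.b₀ x * P.b₁ x ^ 5 - 11 / 144 * P.b₀ x ^ 2 * P.b₁ x ^ 4
      + 107 / 54 * P.b₀ x ^ 3 * P.b₁ x ^ 3 - 421 / 16 * P.b₀ x ^ 4 * P.b₁ x ^ 2
      + 6685 / 32 * P.b₀ x ^ 5 * P.b₁ x - 1251 * P.b₀ x ^ 6
      + 108 * P.b₀ x ^ 3 * P.b₃ x ^ 3 + 162 * P.b₀ x ^ 4 * P.b₃ x ^ 2 + 81 * P.b₀ x ^ 5 * P.b₃ x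
      + 6912 * P.b₀ x ^ 3 * P.bm₃ x ^ 3 - 10368 * P.b₀ x ^ 4 * P.bm₃ x ^ 2
      + 6480 * P.b₀ x ^ 5 * P.bm₃ x
  f₂a_dlog : P.f₂a x * (2 * Real.pi * Complex.I * deriv P.tau x) =
    1 / (algebraMap 𝕜 ℂ x - 4) + 1 / (algebraMap 𝕜 ℂ x - 16)
  f₂a_x : P.f₂a x =
    (1 / (algebraMap 𝕜 ℂ x - 4) + 1 / (algebraMap 𝕜 ℂ x - 16))
      * (P.psi₁ x ^ 2 / (2 * Real.pi * Complex.I * P.W x))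
  f₂a_y : P.f₂a x =
    (1 / 6 * P.y x ^ 2 - 5 / 3 * P.y x + 9 / 2 - 6 / (P.y x - 3) - 24 / (P.y x + 3))
      * (P.psiSun₁ x / Real.pi) ^ 2
  f₄a_x : P.f₄a x =
    1 / 72 * algebraMap 𝕜 ℂ x * P.root x * (P.psi₁ x / Real.pi) ^ 4
  f₄a_y : P.f₄a x =
    1 / 72 * (P.y x - 1) * (P.y x - 9) * (P.y x - 3) * (P.y x + 3)
      * (P.psiSun₁ x / Real.pi) ^ 4
  f₄b_x : P.f₄b F₂ x =
    (algebraMap 𝕜 ℂ x + 8) ^ 2 * (algebraMap 𝕜 ℂ x ^ 2 - 8 * algebraMap 𝕜 ℂ x + 64)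
        / (288 * (algebraMap 𝕜 ℂ x - 4) * (algebraMap 𝕜 ℂ x - 16)) * (P.psi₁ x / Real.pi) ^ 4
      - 3 / 2 * F₂ x ^ 2
  f₄b_y : P.f₄b F₂ x =
    (P.y x ^ 2 - 18 * P.y x + 9) ^ 2
        * (P.y x ^ 4 - 12 * P.y x ^ 3 + 102 * P.y x ^ 2 - 108 * P.y x + 81)
        / (288 * (P.y x - 3) ^ 2 * (P.y x + 3) ^ 2) * (P.psiSun₁ x / Real.pi) ^ 4
      - 3 / 2 * F₂ x ^ 2
  f₆_x : P.f₆ F₂ x =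
    algebraMap 𝕜 ℂ x * (algebraMap 𝕜 ℂ x - 8) * (algebraMap 𝕜 ℂ x + 8) ^ 3
        / (216 * P.root x ^ 3) * (P.psi₁ x / Real.pi) ^ 6
      - (algebraMap 𝕜 ℂ x + 8) ^ 2 * (algebraMap 𝕜 ℂ x ^ 2 - 8 * algebraMap 𝕜 ℂ x + 64)
        / (144 * (algebraMap 𝕜 ℂ x - 4) * (algebraMap 𝕜 ℂ x - 16)) * (P.psi₁ x / Real.pi) ^ 4
        * F₂ x
      + F₂ x ^ 3
  f₆_y : P.f₆ F₂ x =
    P.y x * (P.y x - 1) * (P.y x - 9) * (P.y x ^ 2 - 2 * P.y x + 9)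
        * (P.y x ^ 2 - 18 * P.y x + 9) ^ 3 / (216 * (P.y x - 3) ^ 3 * (P.y x + 3) ^ 3)
        * (P.psiSun₁ x / Real.pi) ^ 6
      - (P.y x ^ 2 - 18 * P.y x + 9) ^ 2
        * (P.y x ^ 4 - 12 * P.y x ^ 3 + 102 * P.y x ^ 2 - 108 * P.y x + 81)
        / (144 * (P.y x - 3) ^ 2 * (P.y x + 3) ^ 2) * (P.psiSun₁ x / Real.pi) ^ 4 * F₂ x
      + F₂ x ^ 3

end Branch

/-! ### The Euclidean axis `x < 0`

All square roots and elliptic integrals are real there: `0 < y < 1` and `0 < k² < 1`. -/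

/-- `y` as a real number. -/
def yE (x : ℝ) : ℝ := (10 - x - √(4 - x) * √(16 - x)) / 2

/-- The roots of the quartic `v² = (u-u₁) (u-u₂) (u-u₃) (u-u₄)`. -/
def rootE (x : ℝ) : Fin 4 → ℝ :=
  ![-4, -(1 + √(yE x)) ^ 2, -(1 - √(yE x)) ^ 2, 0]

def U₁ (x : ℝ) : ℝ := (rootE x 2 - rootE x 1) * (rootE x 3 - rootE x 0)

def U₂ (x : ℝ) : ℝ := (rootE x 1 - rootE x 0) * (rootE x 3 - rootE x 2)

def U₃ (x : ℝ) : ℝ := (rootE x 2 - rootE x 0) * (rootE x 3 - rootE x 1)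

/-- The branch on the Euclidean axis, with `k² = U₁/U₃`, `k̄² = U₂/U₃`,
`ψ₁^sunrise = 4 K(k) / √U₃` and `ψ₂^sunrise = 4 i K(k̄) / √U₃`. -/
def euclid : Branch ℝ where
  root x := ((√(4 - x) * √(16 - x) : ℝ) : ℂ)
  sqrtY x := (√(yE x) : ℂ)
  psiSun₁ x := ((4 / √(U₃ x) * ellipticK (√(U₁ x / U₃ x)) : ℝ) : ℂ)
  psiSun₂ x := Complex.I * ((4 / √(U₃ x) * ellipticK (√(U₂ x / U₃ x)) : ℝ) : ℂ)

/-- The iterated integral `I(f₁, …, f_n; τ(x))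
= (2πi)^n ∫_{i∞}^{τ} dτ₁ f₁(τ₁) ∫_{i∞}^{τ₁} dτ₂ f₂(τ₂) ⋯` along the imaginary `τ`-axis, which is the
image of the Euclidean axis, with `x → -∞` corresponding to `τ → i∞`; the forms `f dτ` are written in
the coordinate `x`. It is used for `(1, g₆)` only; as `g₆` vanishes at `τ = i∞`, the integral
converges and needs no regularisation. -/
def iteratedIntegral : List (ℝ → ℂ) → ℝ → ℂ
  | [], _ => 1
  | f :: fs, x => 2 * Real.pi * Complex.I *
      ∫ t in Set.Iic x, f t * iteratedIntegral fs t * deriv euclid.tau t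

/-- `F₂ = I(1, g₆; τ)`. -/
def euclidF₂ : ℝ → ℂ := iteratedIntegral [fun _ => 1, euclid.g₆]

/-- `g` is holomorphic on `U` and agrees near `x₀` with the function `f` of a real variable. -/
def Continues (U : Set ℂ) (x₀ : ℝ) (f : ℝ → ℂ) (g : ℂ → ℂ) : Prop :=
  DifferentiableOn ℂ g U ∧ ∀ᶠ t : ℝ in 𝓝 x₀, g t = f t

/-- The four functions of the branch `Q` on `U` are analytic continuations of those on the Euclidean
axis. -/
structure ContinuesBranch (U : Set ℂ) (x₀ : ℝ) (Q : Branch ℂ) : Prop where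
  root : Continues U x₀ euclid.root Q.root
  sqrtY : Continues U x₀ euclid.sqrtY Q.sqrtY
  psiSun₁ : Continues U x₀ euclid.psiSun₁ Q.psiSun₁
  psiSun₂ : Continues U x₀ euclid.psiSun₂ Q.psiSun₂

end

end Banana

/-! Since d/dτ = (ψ₁²/W) d/dx, the claim involves only x, R, √y, ψ₁, W, F₂, I₁₁₁₁ and derivatives in
x. It follows by rational algebra from a short list of relations. Those collected in
`Branch.RegularOn` are R² = (4-x)(16-x), (√y)² = y, x R W = 6πi, the second-order Picard–Fuchs
equation of ψ₁, and (2πi)⁻² d²F₂/dτ² = g₆ (as an equation in x). The other one,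
`Branch.SolvesBanana`, is a third-order inhomogeneous equation for I₁₁₁₁ with right-hand side 24 I₁.

Granting these, the letters are rational functions of y times powers of ψ₁^sun, because y
rationalises R. The definitions of I₃ and I₄ are the second and third rows of the system solved for
I₃ and I₄, so only the last row has content. There the third derivative of I₁₁₁₁ is eliminated. At ε
= 0 the homogeneous equation is the symmetric square of the Picard–Fuchs equation, so it is solved
by ψ₁²; this is why I₁₁₁₁ is divided by ψ₁². The equation for d²F₂/dτ² is used to cancel the
remaining terms that have the wrong order in ε. See `hasDerivAt_reducedI₄` and
`Branch.RegularOn.epsFactorised`.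

On the axis x < 0 the relations are proved in `euclid_regularOn`. The variable w = √y makes the
moduli rational. The derivative formulas for K and E give the Picard–Fuchs equation, Legendre's
relation gives the Wronskian, and decay estimates as x → -∞ make the iterated integral F₂ converge
and differentiable.

The equation for I₁₁₁₁ (`solvesBanana_bananaI1111`) comes from the Schwinger form e^{3γε} ∫ U^{ε-1}
e^{-S+xV} over positive parameters, where S is their sum and V their product divided by U. Each
x-derivative brings down a factor V. The differential operator applied to the integrand is an
explicit sum of total derivatives, and each of the four faces a_i = 0 contributes 6 Γ(1+ε)³. This is
proved for real ε ≥ 3, where all powers of U are harmless, and continued analytically to Re ε >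
-1/3.

For part (b), all the relations are identities between functions holomorphic on U that hold on a
real interval around x₀. The identity theorem transports them, and the rational algebra, written
once for both fields, applies again. -/

namespace Banana

/-! ### Rational computations with the master integrals divided by R -/

noncomputable section

/-- The left-hand side of the third order differential equation of `I_{1111}`, in terms of the
values `Φ₀, …, Φ₃` of the function and its derivatives. -/
def bananaOperator (ε X Φ₀ Φ₁ Φ₂ Φ₃ : ℂ) : ℂ :=
  (-(6 * ε ^ 3 + 11 * ε ^ 2 + 6 * ε + 1) * X + (-12 * ε ^ 3 + 14 * ε ^ 2 + 18 * ε + 4)) * Φ₀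
    + (-(11 * ε ^ 2 + 18 * ε + 7) * X ^ 2 + (28 * ε ^ 2 + 120 * ε + 68) * X
        + 64 * (ε ^ 2 - 1)) * Φ₁
    + (-6 * (1 + ε) * X ^ 3 + (60 * ε + 90) * X ^ 2 - 192 * X) * Φ₂
    - X ^ 2 * (X - 4) * (X - 16) * Φ₃

section Rational

variable {𝕜 : Type} [NontriviallyNormedField 𝕜] [NormedAlgebra 𝕜 ℂ]

/-- `I₃ / R`, where `T = R ψ₁² / π²` and `u = ψ₁' / ψ₁`. -/
def reducedI₃ (ε X T u F Φ₀ Φ₁ : ℂ) : ℂ :=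
  -(ε ^ 2 / 12) * (X * (Φ₁ - 2 * (Φ₀ * u)))
    + ε ^ 3 * ((F / T - (X - 10) * X / (6 * ((4 - X) * (16 - X)))) * Φ₀)

/-- The derivative of `I₃ / R`, where `H = (2πi)⁻¹ dF₂/dτ`. -/
def reducedI₃' (ε X T u F H Φ₀ Φ₁ Φ₂ : ℂ) : ℂ :=
  -(ε ^ 2 / 12) * ((Φ₁ - 2 * (Φ₀ * u)) + X * (Φ₂ - 2 * (Φ₁ * u + Φ₀ *
      (-((2 * X ^ 2 - 30 * X + 64) / (X * ((4 - X) * (16 - X))) * u)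
        - (X - 8) / (4 * (X * ((4 - X) * (16 - X)))) - u ^ 2))))
    + ε ^ 3 * ((-(12 * H) / (X * T ^ 2) - F / T * ((X - 10) / ((4 - X) * (16 - X)) + 2 * u)
        - ((2 * X - 10) / (6 * ((4 - X) * (16 - X)))
          - (X - 10) * X * (2 * X - 20) / (6 * ((4 - X) * (16 - X)) ^ 2))) * Φ₀
      + (F / T - (X - 10) * X / (6 * ((4 - X) * (16 - X)))) * Φ₁)

/-- `I₄ / R`. -/
def reducedI₄ (ε X T u F H Φ₀ Φ₁ Φ₂ : ℂ) : ℂ :=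
  -(X * T) / (12 * ε) * (reducedI₃' ε X T u F H Φ₀ Φ₁ Φ₂
      + (X - 10) / ((4 - X) * (16 - X)) * reducedI₃ ε X T u F Φ₀ Φ₁)
    + (3 / 2 * F ^ 2 - (X + 8) ^ 2 * (X ^ 2 - 8 * X + 64) * T ^ 2
        / (288 * ((4 - X) * (16 - X)) ^ 2)) * (ε ^ 3 * (Φ₀ / T))
    + (-2 * F - (X - 10) * X * T / (6 * ((4 - X) * (16 - X)))) * reducedI₃ ε X T u F Φ₀ Φ₁

variable {x : 𝕜} {X T u F H Φ₀ Φ₁ Φ₂ : 𝕜 → ℂ} {Φ₃ ε : ℂ}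

/-- After division by R only R² = (4-X)(16-X) is left, so everything is rational in X, T, u, F, H
and the Φ's. The hypotheses say that this ring is closed under d/dx: T'/T comes from R and ψ₁, u' is
the Riccati form of the Picard–Fuchs equation, and F' uses 2πi dτ/dx = -12/(XT). -/
theorem hasDerivAt_reducedI₃ (hX0 : X x ≠ 0) (hX4 : 4 - X x ≠ 0) (hX16 : 16 - X x ≠ 0)
    (hT0 : T x ≠ 0) (hX : HasDerivAt X 1 x)
    (hT : HasDerivAt T (T x * ((X x - 10) / ((4 - X x) * (16 - X x)) + 2 * u x)) x)
    (hu : HasDerivAt u (-((2 * X x ^ 2 - 30 * X x + 64) / (X x * ((4 - X x) * (16 - X x))) * u x)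
        - (X x - 8) / (4 * (X x * ((4 - X x) * (16 - X x)))) - u x ^ 2) x)
    (hF : HasDerivAt F (-(12 * H x) / (X x * T x)) x)
    (hΦ₀ : HasDerivAt Φ₀ (Φ₁ x) x) (hΦ₁ : HasDerivAt Φ₁ (Φ₂ x) x) :
    HasDerivAt (fun x => reducedI₃ ε (X x) (T x) (u x) (F x) (Φ₀ x) (Φ₁ x))
      (reducedI₃' ε (X x) (T x) (u x) (F x) (H x) (Φ₀ x) (Φ₁ x) (Φ₂ x)) x := by
  have h6 : (6 * ((4 - X x) * (16 - X x))) ≠ 0 := by simp [hX4, hX16]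
  have key := ((hX.mul (hΦ₁.sub ((hΦ₀.mul hu).const_mul 2))).const_mul (-(ε ^ 2 / 12))).add
    ((((hF.div hT hT0).sub (((hX.sub_const 10).mul hX).div
      (((hX.const_sub 4).mul (hX.const_sub 16)).const_mul 6) h6)).mul hΦ₀).const_mul (ε ^ 3))
  refine HasDerivAt.congr_deriv key ?_
  simp only [reducedI₃', Pi.mul_apply, Pi.sub_apply, Pi.div_apply]
  field_simp
  ring

/-- This is the last row of the system, divided by R. The factor -12/(XT) is 2πi dτ/dx, and the
subtracted multiple of I₄/R is the term R'/R. The hypothesis on H is the equation dF₂/dτ = 2πi H,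
dH/dτ = 2πi g₆ in the coordinate x, and I stands for I₁. -/
theorem hasDerivAt_reducedI₄ {I : ℂ} (hε : ε ≠ 0) (hX0 : X x ≠ 0) (hX4 : 4 - X x ≠ 0)
    (hX16 : 16 - X x ≠ 0)
    (hT0 : T x ≠ 0) (hX : HasDerivAt X 1 x)
    (hT : HasDerivAt T (T x * ((X x - 10) / ((4 - X x) * (16 - X x)) + 2 * u x)) x)
    (hu : HasDerivAt u (-((2 * X x ^ 2 - 30 * X x + 64) / (X x * ((4 - X x) * (16 - X x))) * u x)
        - (X x - 8) / (4 * (X x * ((4 - X x) * (16 - X x)))) - u x ^ 2) x)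
    (hF : HasDerivAt F (-(12 * H x) / (X x * T x)) x)
    (hH : HasDerivAt H
      (-(12 * ((X x - 8) * (X x + 8) ^ 3 * T x ^ 2)) / (864 * ((4 - X x) * (16 - X x)) ^ 3)) x)
    (hΦ₀ : HasDerivAt Φ₀ (Φ₁ x) x) (hΦ₁ : HasDerivAt Φ₁ (Φ₂ x) x) (hΦ₂ : HasDerivAt Φ₂ Φ₃ x)
    (hΦ : bananaOperator ε (X x) (Φ₀ x) (Φ₁ x) (Φ₂ x) Φ₃ = 24 * I) :
    HasDerivAt (fun x => reducedI₄ ε (X x) (T x) (u x) (F x) (H x) (Φ₀ x) (Φ₁ x) (Φ₂ x))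
      (ε * (-12 / (X x * T x)) * (X x * T x ^ 2 / (72 * ((4 - X x) * (16 - X x))) * I
          + ((X x) * (X x - 8) * (X x + 8) ^ 3 * T x ^ 3 / (216 * ((4 - X x) * (16 - X x)) ^ 3)
            - (X x + 8) ^ 2 * (X x ^ 2 - 8 * X x + 64) * T x ^ 2
                / (144 * ((4 - X x) * (16 - X x)) ^ 2) * F x + F x ^ 3) * (ε ^ 3 * (Φ₀ x / T x))
          + ((X x + 8) ^ 2 * (X x ^ 2 - 8 * X x + 64) * T x ^ 2
                / (288 * ((4 - X x) * (16 - X x)) ^ 2) - 3 / 2 * F x ^ 2)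
              * reducedI₃ ε (X x) (T x) (u x) (F x) (Φ₀ x) (Φ₁ x)
          + ((X x - 10) * X x * T x / (6 * ((4 - X x) * (16 - X x))) - F x)
              * reducedI₄ ε (X x) (T x) (u x) (F x) (H x) (Φ₀ x) (Φ₁ x) (Φ₂ x))
        - (X x - 10) / ((4 - X x) * (16 - X x))
          * reducedI₄ ε (X x) (T x) (u x) (F x) (H x) (Φ₀ x) (Φ₁ x) (Φ₂ x)) x := by
  have hr := (hX.const_sub 4).mul (hX.const_sub 16)
  have hr0 : (4 - X x) * (16 - X x) ≠ 0 := by simp [hX4, hX16]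
  have hI₃ := hasDerivAt_reducedI₃ (ε := ε) hX0 hX4 hX16 hT0 hX hT hu hF hΦ₀ hΦ₁
  have hu' := (((((hX.pow 2).const_mul 2).sub (hX.const_mul 30)).add_const 64).div
    (hX.mul hr) (mul_ne_zero hX0 hr0)).mul hu |>.neg.sub ((hX.sub_const 8).div
      ((hX.mul hr).const_mul 4) (mul_ne_zero (by norm_num) (mul_ne_zero hX0 hr0))) |>.sub (hu.pow 2)
  have hI₃' : HasDerivAt (fun x => reducedI₃' ε (X x) (T x) (u x) (F x) (H x) (Φ₀ x) (Φ₁ x) (Φ₂ x))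
      _ x := ((((hΦ₁.sub ((hΦ₀.mul hu).const_mul 2)).add (hX.mul (hΦ₂.sub
      (((hΦ₁.mul hu).add (hΦ₀.mul hu')).const_mul 2)))).const_mul (-(ε ^ 2 / 12)))).add
    (((((((hH.const_mul 12).neg.div (hX.mul (hT.pow 2)) (mul_ne_zero hX0 (pow_ne_zero 2 hT0))).sub
      ((hF.div hT hT0).mul (((hX.sub_const 10).div hr hr0).add (hu.const_mul 2)))).sub
      ((((hX.const_mul 2).sub_const 10).div (hr.const_mul 6) (mul_ne_zero (by norm_num) hr0)).sub
      ((((hX.sub_const 10).mul hX).mul ((hX.const_mul 2).sub_const 20)).div ((hr.pow 2).const_mul 6)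
        (mul_ne_zero (by norm_num) (pow_ne_zero 2 hr0))))).mul hΦ₀).add
      (((hF.div hT hT0).sub (((hX.sub_const 10).mul hX).div (hr.const_mul 6)
        (mul_ne_zero (by norm_num) hr0))).mul hΦ₁)).const_mul (ε ^ 3))
  have h12 : (12 : ℂ) * ε ≠ 0 := by simp [hε]
  have key := (((hX.mul hT).neg.div_const (12 * ε)).mul (hI₃'.add
      (((hX.sub_const 10).div hr hr0).mul hI₃))).add
    ((((hF.pow 2).const_mul (3 / 2)).sub (((((hX.add_const 8).pow 2).mul
      (((hX.pow 2).sub (hX.const_mul 8)).add_const 64)).mul (hT.pow 2)).div ((hr.pow 2).const_mul 288)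
        (mul_ne_zero (by norm_num) (pow_ne_zero 2 hr0)))).mul
        ((hΦ₀.div hT hT0).const_mul (ε ^ 3))) |>.add
    (((hF.const_mul (-2)).sub ((((hX.sub_const 10).mul hX).mul hT).div (hr.const_mul 6)
        (mul_ne_zero (by norm_num) hr0))).mul hI₃)
  refine HasDerivAt.congr_deriv key ?_
  -- The third-order equation enters only here: solved for Φ₃, it leaves an identity of rational
  -- functions in independent variables.
  have e : Φ₃ = (bananaOperator ε (X x) (Φ₀ x) (Φ₁ x) (Φ₂ x) 0 - 24 * I) /
      (X x ^ 2 * ((4 - X x) * (16 - X x))) := by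
    rw [eq_div_iff (mul_ne_zero (pow_ne_zero 2 hX0) hr0), ← hΦ]
    simp only [bananaOperator]; ring
  rw [e]
  simp only [reducedI₄, reducedI₃', reducedI₃, bananaOperator, Pi.mul_apply, Pi.sub_apply,
    Pi.div_apply, Pi.add_apply, Pi.neg_apply, Pi.pow_apply]
  generalize X x = X at *
  generalize T x = T at *
  generalize u x = u at *
  generalize F x = F at *
  generalize H x = H at *
  generalize Φ₀ x = Φ₀ at *
  generalize Φ₁ x = Φ₁ at *
  generalize Φ₂ x = Φ₂ at *
  field_simp
  ring

end Rational
end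
end Banana

namespace Banana

/-! ### From the basic relations to the letters and the differential system -/

noncomputable section

namespace Branch

variable {𝕜 : Type} [NontriviallyNormedField 𝕜] [NormedAlgebra 𝕜 ℂ]

/-- The algebraic and differential relations between the functions of a branch and `F₂` from which
everything else follows by rational computations. -/
structure RegularOn (P : Branch 𝕜) (F₂ : 𝕜 → ℂ) (s : Set 𝕜) : Prop where
  isOpen : IsOpen s
  ne_zero : ∀ x ∈ s, algebraMap 𝕜 ℂ x ≠ 0
  ne_four : ∀ x ∈ s, 4 - algebraMap 𝕜 ℂ x ≠ 0
  ne_sixteen : ∀ x ∈ s, 16 - algebraMap 𝕜 ℂ x ≠ 0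
  psiSun_ne : ∀ x ∈ s, P.psiSun₁ x ≠ 0
  root_sq : ∀ x ∈ s, P.root x ^ 2 = (4 - algebraMap 𝕜 ℂ x) * (16 - algebraMap 𝕜 ℂ x)
  sqrtY_sq : ∀ x ∈ s, P.sqrtY x ^ 2 = P.y x
  differentiableOn_root : DifferentiableOn 𝕜 P.root s
  differentiableOn_psi₁ : DifferentiableOn 𝕜 P.psi₁ s
  differentiableOn_psi₂ : DifferentiableOn 𝕜 P.psi₂ s
  differentiableOn_deriv_psi₁ : DifferentiableOn 𝕜 (deriv P.psi₁) s
  differentiableOn_F₂ : DifferentiableOn 𝕜 F₂ s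
  differentiableOn_deriv_F₂ : DifferentiableOn 𝕜 (deriv F₂) s
  wronskian : ∀ x ∈ s, algebraMap 𝕜 ℂ x * P.root x * P.W x = 6 * Real.pi * Complex.I
  picardFuchs : ∀ x ∈ s, let X := algebraMap 𝕜 ℂ x
    4 * X * ((4 - X) * (16 - X)) * deriv (deriv P.psi₁) x
      + 4 * (2 * X ^ 2 - 30 * X + 64) * deriv P.psi₁ x + (X - 8) * P.psi₁ x = 0
  F₂_ode : ∀ x ∈ s, let X := algebraMap 𝕜 ℂ x
    6 * Real.pi ^ 2 * ((4 - X) * (16 - X)) ^ 2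
        * deriv (fun t => algebraMap 𝕜 ℂ t * P.root t * P.psi₁ t ^ 2 * deriv F₂ t) x
      = (X - 8) * (X + 8) ^ 3 * P.psi₁ x ^ 4

/-- The third order inhomogeneous differential equation of `I_{1111}`. -/
structure SolvesBanana (ε : ℂ) (Φ : 𝕜 → ℂ) (s : Set 𝕜) : Prop where
  differentiableOn : DifferentiableOn 𝕜 Φ s
  differentiableOn_deriv : DifferentiableOn 𝕜 (deriv Φ) s
  differentiableOn_deriv₂ : DifferentiableOn 𝕜 (deriv (deriv Φ)) s
  ode : ∀ x ∈ s, bananaOperator ε (algebraMap 𝕜 ℂ x) (Φ x) (deriv Φ x) (deriv (deriv Φ) x)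
    (deriv (deriv (deriv Φ)) x) = 24 * I₁ ε

theorem hasDerivAt_algebraMap (x : 𝕜) : HasDerivAt (fun t => algebraMap 𝕜 ℂ t) 1 x := by
  exact (algebraMapCLM 𝕜 ℂ).hasDerivAt.congr_deriv (map_one (algebraMap 𝕜 ℂ))

namespace RegularOn

variable {P : Branch 𝕜} {F₂ : 𝕜 → ℂ} {s : Set 𝕜} {x : 𝕜}

theorem mem_nhds (h : P.RegularOn F₂ s) (hx : x ∈ s) : s ∈ 𝓝 x := h.isOpen.mem_nhds hx

theorem root_ne_zero (h : P.RegularOn F₂ s) (hx : x ∈ s) : P.root x ≠ 0 := by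
  intro h0
  have := h.root_sq x hx
  rw [h0] at this
  exact mul_ne_zero (h.ne_four x hx) (h.ne_sixteen x hx) (by rw [← this]; simp)

/-- The conjugate of y under R ↦ -R is 10 - x - y, and the product of both is ((10-x)² - R²)/4 = 9.
Hence x and R are rational in y, and y = 3, -3 correspond to x = 4, 16. -/
theorem y_quadratic (h : P.RegularOn F₂ s) (hx : x ∈ s) :
    P.y x * (10 - algebraMap 𝕜 ℂ x - P.y x) = 9 := by
  have := h.root_sq x hx
  simp only [y]
  linear_combination (-1 / 4) * this

theorem y_ne_zero (h : P.RegularOn F₂ s) (hx : x ∈ s) : P.y x ≠ 0 := by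
  intro h0
  have := h.y_quadratic hx
  simp [h0] at this

theorem root_eq (h : P.RegularOn F₂ s) (hx : x ∈ s) :
    P.root x = (3 - P.y x) * (3 + P.y x) / P.y x := by
  rw [eq_div_iff (h.y_ne_zero hx)]
  have h1 : P.root x = 10 - algebraMap 𝕜 ℂ x - 2 * P.y x := by simp only [y]; ring
  rw [h1]
  linear_combination h.y_quadratic hx

theorem sub_four_eq (h : P.RegularOn F₂ s) (hx : x ∈ s) :
    algebraMap 𝕜 ℂ x - 4 = -(P.y x - 3) ^ 2 / P.y x := by
  rw [eq_div_iff (h.y_ne_zero hx)]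
  linear_combination -h.y_quadratic hx

theorem y_sub_three_ne (h : P.RegularOn F₂ s) (hx : x ∈ s) : P.y x - 3 ≠ 0 := by
  intro h0
  have := h.sub_four_eq hx
  apply h.ne_four x hx
  rw [h0] at this
  simp only [ne_eq, OfNat.ofNat_ne_zero, not_false_eq_true, zero_pow, neg_zero, zero_div] at this
  linear_combination -this

theorem y_add_three_ne (h : P.RegularOn F₂ s) (hx : x ∈ s) : P.y x + 3 ≠ 0 := by
  intro h0
  have := h.y_quadratic hx
  apply h.ne_sixteen x hx
  linear_combination (-1 / 3) * this + (13 - algebraMap 𝕜 ℂ x - P.y x) / 3 * h0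

theorem x_eq (h : P.RegularOn F₂ s) (hx : x ∈ s) :
    algebraMap 𝕜 ℂ x = -(P.y x - 1) * (P.y x - 9) / P.y x := by
  rw [eq_div_iff (h.y_ne_zero hx)]
  linear_combination -h.y_quadratic hx

theorem psi_ne_zero (h : P.RegularOn F₂ s) (hx : x ∈ s) : P.psi₁ x ≠ 0 := by
  refine mul_ne_zero ?_ (h.psiSun_ne x hx)
  intro h0
  apply h.y_ne_zero hx
  rw [← h.sqrtY_sq x hx, h0]; simp

theorem W_eq (h : P.RegularOn F₂ s) (hx : x ∈ s) :
    P.W x = 6 * Real.pi * Complex.I / (algebraMap 𝕜 ℂ x * P.root x) := by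
  rw [eq_div_iff (mul_ne_zero (h.ne_zero x hx) (h.root_ne_zero hx)), ← h.wronskian x hx]
  ring

theorem hasDerivAt_psi₁ (h : P.RegularOn F₂ s) (hx : x ∈ s) :
    HasDerivAt P.psi₁ (deriv P.psi₁ x) x :=
  ((h.differentiableOn_psi₁ x hx).differentiableAt (h.mem_nhds hx)).hasDerivAt

theorem deriv_tau (h : P.RegularOn F₂ s) (hx : x ∈ s) :
    deriv P.tau x = P.W x / P.psi₁ x ^ 2 := by
  have h2 := ((h.differentiableOn_psi₂ x hx).differentiableAt (h.mem_nhds hx)).hasDerivAt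
  have := (h2.div (h.hasDerivAt_psi₁ hx) (h.psi_ne_zero hx)).deriv
  have e : P.tau = P.psi₂ / P.psi₁ := rfl
  rw [e, this, W]
  ring

/-- Substituting the expressions of x, x ± 8, x - 4, x - 16 and R in y, together with ψ₁² = y
(ψ₁^sun)², turns every identity into one of rational functions of y. The negative powers of y ± 3 in
b₃ and b₋₃ are partial fractions. -/
theorem letterIdentities (h : P.RegularOn F₂ s) (hx : x ∈ s) : P.LetterIdentities F₂ x := by
  have hY := h.y_ne_zero hx
  have hY3 := h.y_sub_three_ne hx
  have hY3' : 3 - P.y x ≠ 0 := by rw [← neg_sub]; exact neg_ne_zero.mpr hY3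
  have hY3p := h.y_add_three_ne hx
  have hY3p' : 3 + P.y x ≠ 0 := by rwa [add_comm]
  have hX := h.x_eq hx
  have hX4 := h.sub_four_eq hx
  have hX16 : algebraMap 𝕜 ℂ x - 16 = -(P.y x + 3) ^ 2 / P.y x := by
    rw [eq_div_iff hY]; linear_combination -h.y_quadratic hx
  have hX8 : algebraMap 𝕜 ℂ x - 8 = -(P.y x ^ 2 - 2 * P.y x + 9) / P.y x := by
    rw [eq_div_iff hY]; linear_combination -h.y_quadratic hx
  have hX8' : algebraMap 𝕜 ℂ x + 8 = -(P.y x ^ 2 - 18 * P.y x + 9) / P.y x := by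
    rw [eq_div_iff hY]; linear_combination -h.y_quadratic hx
  have hR := h.root_eq hx
  have hw := h.sqrtY_sq x hx
  have hs := h.psiSun_ne x hx
  have hX0 := h.ne_zero x hx
  have hpi : (Real.pi : ℂ) ≠ 0 := by exact_mod_cast Real.pi_ne_zero
  have hψ := h.psi_ne_zero hx
  have hψ2 : P.psi₁ x ^ 2 = P.y x * P.psiSun₁ x ^ 2 := by rw [psi₁, mul_pow, hw]
  have hψ4 : (P.psi₁ x / Real.pi) ^ 4 = P.y x ^ 2 * (P.psiSun₁ x / Real.pi) ^ 4 := by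
    rw [show (P.psi₁ x / Real.pi) ^ 4 = (P.psi₁ x ^ 2) ^ 2 / Real.pi ^ 4 by ring, hψ2]; ring
  have hψ6 : (P.psi₁ x / Real.pi) ^ 6 = P.y x ^ 3 * (P.psiSun₁ x / Real.pi) ^ 6 := by
    rw [show (P.psi₁ x / Real.pi) ^ 6 = (P.psi₁ x ^ 2) ^ 3 / Real.pi ^ 6 by ring, hψ2]; ring
  have hW := h.W_eq hx
  have hY1 : P.y x - 1 ≠ 0 := by
    intro h0; apply hX0; rw [hX, h0]; simp
  have hY9 : P.y x - 9 ≠ 0 := by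
    intro h0; apply hX0; rw [hX, h0]; simp
  have hI := Complex.I_ne_zero
  have f2ay : P.f₂a x =
    (1 / 6 * P.y x ^ 2 - 5 / 3 * P.y x + 9 / 2 - 6 / (P.y x - 3) - 24 / (P.y x + 3))
      * (P.psiSun₁ x / Real.pi) ^ 2 := by
    simp only [f₂a, b₀, b₁, b₃, bm₃]; ring
  have f2ax : P.f₂a x =
    (1 / (algebraMap 𝕜 ℂ x - 4) + 1 / (algebraMap 𝕜 ℂ x - 16))
      * (P.psi₁ x ^ 2 / (2 * Real.pi * Complex.I * P.W x)) := by
    rw [f2ay, hW, hψ2, hX4, hX16, hX, hR]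
    generalize P.y x = Y at *
    generalize P.psiSun₁ x = p at *
    field_simp
    rw [Complex.I_sq]
    ring
  have f4ay : P.f₄a x = 1 / 72 * (P.y x - 1) * (P.y x - 9) * (P.y x - 3) * (P.y x + 3)
      * (P.psiSun₁ x / Real.pi) ^ 4 := by
    simp only [f₄a, b₀, b₁]; ring
  have g6y : P.g₆ x =
    P.y x * (P.y x - 1) * (P.y x - 9) * (P.y x ^ 2 - 2 * P.y x + 9)
        * (P.y x ^ 2 - 18 * P.y x + 9) ^ 3 / (864 * (P.y x - 3) ^ 3 * (P.y x + 3) ^ 3)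
      * (P.psiSun₁ x / Real.pi) ^ 6 := by
    simp only [g₆]
    rw [hψ6, hX8, hX8', hX, hR]
    generalize P.y x = Y at *
    generalize P.psiSun₁ x = p at *
    field_simp
    ring
  have f4by : P.f₄b F₂ x =
    (P.y x ^ 2 - 18 * P.y x + 9) ^ 2
        * (P.y x ^ 4 - 12 * P.y x ^ 3 + 102 * P.y x ^ 2 - 108 * P.y x + 81)
        / (288 * (P.y x - 3) ^ 2 * (P.y x + 3) ^ 2) * (P.psiSun₁ x / Real.pi) ^ 4
      - 3 / 2 * F₂ x ^ 2 := by
    simp only [f₄b, b₀, b₁, b₃, bm₃]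
    generalize P.y x = Y at *
    generalize P.psiSun₁ x = p at *
    congr 1
    field_simp
    ring
  have f6b : P.f₆ F₂ x = 4 * (1 / 864 * P.b₀ x * P.b₁ x ^ 5 - 11 / 144 * P.b₀ x ^ 2 * P.b₁ x ^ 4
      + 107 / 54 * P.b₀ x ^ 3 * P.b₁ x ^ 3 - 421 / 16 * P.b₀ x ^ 4 * P.b₁ x ^ 2
      + 6685 / 32 * P.b₀ x ^ 5 * P.b₁ x - 1251 * P.b₀ x ^ 6
      + 108 * P.b₀ x ^ 3 * P.b₃ x ^ 3 + 162 * P.b₀ x ^ 4 * P.b₃ x ^ 2 + 81 * P.b₀ x ^ 5 * P.b₃ x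
      + 6912 * P.b₀ x ^ 3 * P.bm₃ x ^ 3 - 10368 * P.b₀ x ^ 4 * P.bm₃ x ^ 2
      + 6480 * P.b₀ x ^ 5 * P.bm₃ x) - 2 * (P.f₄b F₂ x + 3 / 2 * F₂ x ^ 2) * F₂ x
      + F₂ x ^ 3 := by
    simp only [f₆, f₄b]; ring
  have g6b : P.g₆ x =
    1 / 864 * P.b₀ x * P.b₁ x ^ 5 - 11 / 144 * P.b₀ x ^ 2 * P.b₁ x ^ 4
      + 107 / 54 * P.b₀ x ^ 3 * P.b₁ x ^ 3 - 421 / 16 * P.b₀ x ^ 4 * P.b₁ x ^ 2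
      + 6685 / 32 * P.b₀ x ^ 5 * P.b₁ x - 1251 * P.b₀ x ^ 6
      + 108 * P.b₀ x ^ 3 * P.b₃ x ^ 3 + 162 * P.b₀ x ^ 4 * P.b₃ x ^ 2 + 81 * P.b₀ x ^ 5 * P.b₃ x
      + 6912 * P.b₀ x ^ 3 * P.bm₃ x ^ 3 - 10368 * P.b₀ x ^ 4 * P.bm₃ x ^ 2
      + 6480 * P.b₀ x ^ 5 * P.bm₃ x := by
    rw [g6y]
    simp only [b₀, b₁, b₃, bm₃]
    generalize P.y x = Y at *
    generalize P.psiSun₁ x = p at *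
    field_simp
    ring
  have f4bx : P.f₄b F₂ x =
    (algebraMap 𝕜 ℂ x + 8) ^ 2 * (algebraMap 𝕜 ℂ x ^ 2 - 8 * algebraMap 𝕜 ℂ x + 64)
        / (288 * (algebraMap 𝕜 ℂ x - 4) * (algebraMap 𝕜 ℂ x - 16)) * (P.psi₁ x / Real.pi) ^ 4
      - 3 / 2 * F₂ x ^ 2 := by
    rw [f4by, hψ4, hX4, hX16, hX8', hX]
    generalize P.y x = Y at *
    generalize P.psiSun₁ x = p at *
    congr 1
    field_simp
    ring
  have g6x : P.g₆ x = algebraMap 𝕜 ℂ x * (algebraMap 𝕜 ℂ x - 8) * (algebraMap 𝕜 ℂ x + 8) ^ 3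
      / (864 * P.root x ^ 3) * (P.psi₁ x / Real.pi) ^ 6 := rfl
  rw [← g6b] at f6b
  refine ⟨g6y, g6b, ?_, f2ax, f2ay, ?_, f4ay, f4bx, f4by, ?_, ?_⟩
  · have hW0 : P.W x ≠ 0 := by
      rw [hW]; exact div_ne_zero (by simp [hpi]) (mul_ne_zero hX0 (h.root_ne_zero hx))
    rw [f2ax, h.deriv_tau hx]
    field_simp
  · rw [f4ay, hψ4, hX, hR]
    field_simp
    ring
  · have h4 : algebraMap 𝕜 ℂ x - 4 ≠ 0 := by rw [← neg_sub]; exact neg_ne_zero.mpr (h.ne_four x hx)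
    have h16 : algebraMap 𝕜 ℂ x - 16 ≠ 0 := by
      rw [← neg_sub]; exact neg_ne_zero.mpr (h.ne_sixteen x hx)
    have hr := h.root_ne_zero hx
    rw [f6b, f4bx, g6x]
    field_simp
    ring
  · rw [f6b, f4by, g6y]
    field_simp
    ring

theorem hasDerivAt_root (h : P.RegularOn F₂ s) (hx : x ∈ s) :
    HasDerivAt P.root ((algebraMap 𝕜 ℂ x - 10) / P.root x) x := by
  have h0 := h.root_ne_zero hx
  have h1 := ((h.differentiableOn_root x hx).differentiableAt (h.mem_nhds hx)).hasDerivAt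
  have hX := hasDerivAt_algebraMap x
  have h2 := (h1.pow 2).congr_of_eventuallyEq (f₁ := fun t => (4 - algebraMap 𝕜 ℂ t) *
    (16 - algebraMap 𝕜 ℂ t)) (by
      filter_upwards [h.mem_nhds hx] with t ht using (h.root_sq t ht).symm)
  have h3 := h2.unique ((hX.const_sub 4).mul (hX.const_sub 16))
  refine h1.congr_deriv ?_
  rw [eq_div_iff h0]
  norm_num at h3
  linear_combination h3 / 2

theorem two_pi_I_deriv_tau (h : P.RegularOn F₂ s) (hx : x ∈ s) :
    2 * Real.pi * Complex.I * deriv P.tau x =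
      -12 / (algebraMap 𝕜 ℂ x * (P.root x * P.psi₁ x ^ 2 / Real.pi ^ 2)) := by
  have hpi : (Real.pi : ℂ) ≠ 0 := by exact_mod_cast Real.pi_ne_zero
  have h0 := h.root_ne_zero hx
  have h1 := h.psi_ne_zero hx
  have h2 := h.ne_zero x hx
  rw [h.deriv_tau hx, h.W_eq hx]
  field_simp
  rw [Complex.I_sq]
  ring

end RegularOn

section

variable {P : Branch 𝕜} {F₂ : 𝕜 → ℂ} {s : Set 𝕜} {x : 𝕜} {ε : ℂ} {Φ : 𝕜 → ℂ}

theorem RegularOn.I₂_eq (h : P.RegularOn F₂ s) (hx : x ∈ s) :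
    P.I₂ ε Φ x = P.root x * (ε ^ 3 * (Φ x / (P.root x * P.psi₁ x ^ 2 / Real.pi ^ 2))) := by
  have hpi : (Real.pi : ℂ) ≠ 0 := by exact_mod_cast Real.pi_ne_zero
  have h0 := h.root_ne_zero hx
  have h1 := h.psi_ne_zero hx
  rw [I₂]
  field_simp

theorem RegularOn.hasDerivAt_T (h : P.RegularOn F₂ s) (hx : x ∈ s) :
    HasDerivAt (fun t => P.root t * P.psi₁ t ^ 2 / Real.pi ^ 2)
      (P.root x * P.psi₁ x ^ 2 / Real.pi ^ 2 * ((algebraMap 𝕜 ℂ x - 10) /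
        ((4 - algebraMap 𝕜 ℂ x) * (16 - algebraMap 𝕜 ℂ x)) + 2 * (deriv P.psi₁ x / P.psi₁ x))) x := by
  have h0 := h.root_ne_zero hx
  have h1 := h.psi_ne_zero hx
  refine HasDerivAt.congr_deriv (((h.hasDerivAt_root hx).mul
    ((h.hasDerivAt_psi₁ hx).pow 2)).div_const _) ?_
  rw [← h.root_sq x hx]
  simp only [Pi.pow_apply]
  field_simp
  ring

theorem RegularOn.hasDerivAt_u (h : P.RegularOn F₂ s) (hx : x ∈ s) :
    HasDerivAt (fun t => deriv P.psi₁ t / P.psi₁ t)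
      (-((2 * algebraMap 𝕜 ℂ x ^ 2 - 30 * algebraMap 𝕜 ℂ x + 64) / (algebraMap 𝕜 ℂ x *
          ((4 - algebraMap 𝕜 ℂ x) * (16 - algebraMap 𝕜 ℂ x))) * (deriv P.psi₁ x / P.psi₁ x))
        - (algebraMap 𝕜 ℂ x - 8) / (4 * (algebraMap 𝕜 ℂ x *
          ((4 - algebraMap 𝕜 ℂ x) * (16 - algebraMap 𝕜 ℂ x)))) -
        (deriv P.psi₁ x / P.psi₁ x) ^ 2) x := by
  have h1 := h.psi_ne_zero hx
  have h2 := ((h.differentiableOn_deriv_psi₁ x hx).differentiableAt (h.mem_nhds hx)).hasDerivAt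
  refine HasDerivAt.congr_deriv (h2.div (h.hasDerivAt_psi₁ hx) h1) ?_
  have h3 := h.picardFuchs x hx
  have hX0 := h.ne_zero x hx
  have hX4 := h.ne_four x hx
  have hX16 := h.ne_sixteen x hx
  simp only at h3
  generalize algebraMap 𝕜 ℂ x = X at *
  generalize deriv (deriv P.psi₁) x = d₂ at *
  generalize deriv P.psi₁ x = d₁ at *
  generalize P.psi₁ x = d₀ at *
  have e : d₂ = -(4 * (2 * X ^ 2 - 30 * X + 64) * d₁ + (X - 8) * d₀) /
      (4 * X * ((4 - X) * (16 - X))) := by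
    rw [eq_div_iff (by simp [hX0, hX4, hX16])]
    linear_combination h3
  rw [e]
  field_simp
  ring

/-- Because the correction term is -f_{2,a}, the definition of I₃ is the second row solved for I₃;
the first assertion needs no more than dτ/dx ≠ 0. The second expresses I₃ through the quantities of
the rational computation, ready to be differentiated again. -/
theorem RegularOn.I₃_eq (h : P.RegularOn F₂ s) (hε : ε ≠ 0) (hΦ : DifferentiableOn 𝕜 Φ s)
    (hx : x ∈ s) :
    HasDerivAt (P.I₂ ε Φ) (ε * (2 * Real.pi * Complex.I * deriv P.tau x) *
        ((-P.f₂a x - F₂ x) * P.I₂ ε Φ x + P.I₃ F₂ ε Φ x)) x ∧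
    P.I₃ F₂ ε Φ x = P.root x * reducedI₃ ε (algebraMap 𝕜 ℂ x)
      (P.root x * P.psi₁ x ^ 2 / Real.pi ^ 2) (deriv P.psi₁ x / P.psi₁ x) (F₂ x) (Φ x)
      (deriv Φ x) := by
  have hpi : (Real.pi : ℂ) ≠ 0 := by exact_mod_cast Real.pi_ne_zero
  have h0 := h.root_ne_zero hx
  have h1 := h.psi_ne_zero hx
  have hX0 := h.ne_zero x hx
  have hX4 := h.ne_four x hx
  have hX16 := h.ne_sixteen x hx
  have hI := Complex.I_ne_zero
  have hT0 : P.root x * P.psi₁ x ^ 2 / Real.pi ^ 2 ≠ 0 := by simp [h0, h1, hpi]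
  have hΦ' := ((hΦ x hx).differentiableAt (h.mem_nhds hx)).hasDerivAt
  have key : HasDerivAt (P.I₂ ε Φ) (P.root x * (ε ^ 3 * ((deriv Φ x
      - 2 * (deriv P.psi₁ x / P.psi₁ x) * Φ x) / (P.root x * P.psi₁ x ^ 2 / Real.pi ^ 2)))) x := by
    refine HasDerivAt.congr_of_eventuallyEq (HasDerivAt.congr_deriv ((h.hasDerivAt_root hx).mul
      ((hΦ'.div (h.hasDerivAt_T hx) hT0).const_mul (ε ^ 3))) ?_) (by
        filter_upwards [h.mem_nhds hx] with t ht using h.I₂_eq ht)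
    rw [← h.root_sq x hx]
    simp only [Pi.div_apply]
    field_simp
    ring
  have hcorr : P.correction x = -P.f₂a x := by
    have h4 : algebraMap 𝕜 ℂ x - 4 ≠ 0 := by rw [← neg_sub]; exact neg_ne_zero.mpr hX4
    have h16 : algebraMap 𝕜 ℂ x - 16 ≠ 0 := by rw [← neg_sub]; exact neg_ne_zero.mpr hX16
    have hW : P.W x ≠ 0 := by
      rw [h.W_eq hx]; simp [hpi, hX0, h0]
    rw [(h.letterIdentities hx).f₂a_x]
    simp only [correction]
    field_simp
    rw [Complex.I_sq]
    ring
  have hτ : deriv P.tau x ≠ 0 := by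
    rw [h.deriv_tau hx, h.W_eq hx]; simp [hpi, hX0, h0, h1]
  constructor
  · refine key.congr_deriv ?_
    rw [I₃, derivTau, hcorr, key.deriv]
    field_simp
    ring
  · have hf2 : P.f₂a x = -((algebraMap 𝕜 ℂ x - 10) * algebraMap 𝕜 ℂ x *
        (P.root x * P.psi₁ x ^ 2 / Real.pi ^ 2) /
          (6 * ((4 - algebraMap 𝕜 ℂ x) * (16 - algebraMap 𝕜 ℂ x)))) := by
      have h3 := (h.letterIdentities hx).f₂a_dlog
      rw [mul_comm, h.two_pi_I_deriv_tau hx] at h3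
      have h4 : algebraMap 𝕜 ℂ x - 4 = -(4 - algebraMap 𝕜 ℂ x) := by ring
      have h16 : algebraMap 𝕜 ℂ x - 16 = -(16 - algebraMap 𝕜 ℂ x) := by ring
      rw [h4, h16] at h3
      generalize P.root x * P.psi₁ x ^ 2 / (Real.pi : ℂ) ^ 2 = T at *
      field_simp at h3 ⊢
      linear_combination (-1 / 2) * h3
    have hj := h.two_pi_I_deriv_tau hx
    have hτ' : deriv P.tau x = -12 / (algebraMap 𝕜 ℂ x * (P.root x * P.psi₁ x ^ 2 / Real.pi ^ 2)) /
        (2 * Real.pi * Complex.I) := by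
      rw [← hj]; field_simp
    rw [I₃, derivTau, hcorr, key.deriv, reducedI₃, h.I₂_eq hx, hf2, hτ']
    generalize P.root x * P.psi₁ x ^ 2 / (Real.pi : ℂ) ^ 2 = T at *
    field_simp

/-- In terms of T = Rψ₁²/π² all odd powers of R disappear, except for one factor R in f_{4,a}. That
factor is the one pulled out of I₂, I₃ and I₄ but not out of the constant I₁. -/
theorem RegularOn.letters_T (h : P.RegularOn F₂ s) (hx : x ∈ s) :
    let X := algebraMap 𝕜 ℂ x
    let T := P.root x * P.psi₁ x ^ 2 / Real.pi ^ 2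
    P.f₂a x = -((X - 10) * X * T / (6 * ((4 - X) * (16 - X)))) ∧
    P.f₄a x = P.root x * (X * T ^ 2 / (72 * ((4 - X) * (16 - X)))) ∧
    P.f₄b F₂ x = (X + 8) ^ 2 * (X ^ 2 - 8 * X + 64) * T ^ 2
      / (288 * ((4 - X) * (16 - X)) ^ 2) - 3 / 2 * F₂ x ^ 2 ∧
    P.f₆ F₂ x = X * (X - 8) * (X + 8) ^ 3 * T ^ 3 / (216 * ((4 - X) * (16 - X)) ^ 3)
      - (X + 8) ^ 2 * (X ^ 2 - 8 * X + 64) * T ^ 2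
        / (144 * ((4 - X) * (16 - X)) ^ 2) * F₂ x + F₂ x ^ 3 := by
  intro X T
  have hpi : (Real.pi : ℂ) ≠ 0 := by exact_mod_cast Real.pi_ne_zero
  have h0 := h.root_ne_zero hx
  have h1 := h.psi_ne_zero hx
  have hX0 : X ≠ 0 := h.ne_zero x hx
  have hX4 : 4 - X ≠ 0 := h.ne_four x hx
  have hX16 : 16 - X ≠ 0 := h.ne_sixteen x hx
  have hT0 : T ≠ 0 := by simp [T, h0, h1, hpi]
  have h4 : X - 4 = -(4 - X) := by ring
  have h16 : X - 16 = -(16 - X) := by ring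
  have hl := h.letterIdentities hx
  have hsq : P.root x ^ 2 = (4 - X) * (16 - X) := h.root_sq x hx
  have e2 : (P.psi₁ x / Real.pi) ^ 2 = T / P.root x := by simp only [T]; field_simp
  have e4 : (P.psi₁ x / Real.pi) ^ 4 = T ^ 2 / ((4 - X) * (16 - X)) := by
    rw [← hsq, ← div_pow, ← e2]; ring
  have e6 : (P.psi₁ x / Real.pi) ^ 6 = T ^ 3 / (P.root x ^ 3) := by
    rw [← div_pow, ← e2]; ring
  refine ⟨?_, ?_, ?_, ?_⟩
  · have h3 := hl.f₂a_dlog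
    rw [mul_comm, h.two_pi_I_deriv_tau hx, show algebraMap 𝕜 ℂ x = X from rfl,
      show P.root x * P.psi₁ x ^ 2 / (Real.pi : ℂ) ^ 2 = T from rfl, h4, h16] at h3
    clear_value X T
    field_simp at h3 ⊢
    linear_combination (-1 / 2) * h3
  · rw [hl.f₄a_x, e4, show algebraMap 𝕜 ℂ x = X from rfl]
    clear_value X T
    field_simp
  · rw [hl.f₄b_x, e4, show algebraMap 𝕜 ℂ x = X from rfl, h4, h16]
    clear_value X T
    field_simp
  · rw [hl.f₆_x, e4, e6, show algebraMap 𝕜 ℂ x = X from rfl, h4, h16]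
    have : P.root x ^ 3 * P.root x ^ 3 = ((4 - X) * (16 - X)) ^ 3 := by rw [← hsq]; ring
    rw [show X * (X - 8) * (X + 8) ^ 3 / (216 * P.root x ^ 3) * (T ^ 3 / P.root x ^ 3) =
      X * (X - 8) * (X + 8) ^ 3 * T ^ 3 / (216 * (P.root x ^ 3 * P.root x ^ 3)) by field_simp, this]
    clear_value X T
    field_simp

/-- The function is (2πi)⁻¹ dF₂/dτ, a constant multiple of x R ψ₁² dF₂/dx, so its derivative is
given by the equation `F₂_ode`. -/
theorem RegularOn.hasDerivAt_H (h : P.RegularOn F₂ s) (hx : x ∈ s) :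
    HasDerivAt (fun t => -(algebraMap 𝕜 ℂ t * (P.root t * P.psi₁ t ^ 2 / Real.pi ^ 2)) / 12 *
        deriv F₂ t)
      (-(12 * ((algebraMap 𝕜 ℂ x - 8) * (algebraMap 𝕜 ℂ x + 8) ^ 3 *
        (P.root x * P.psi₁ x ^ 2 / Real.pi ^ 2) ^ 2)) /
        (864 * ((4 - algebraMap 𝕜 ℂ x) * (16 - algebraMap 𝕜 ℂ x)) ^ 3)) x := by
  have hpi : (Real.pi : ℂ) ≠ 0 := by exact_mod_cast Real.pi_ne_zero
  have hF := ((h.differentiableOn_deriv_F₂ x hx).differentiableAt (h.mem_nhds hx)).hasDerivAt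
  have h1 := ((((hasDerivAt_algebraMap x).mul (h.hasDerivAt_root hx)).mul
    ((h.hasDerivAt_psi₁ hx).pow 2)).mul hF)
  have h2 := h1.differentiableAt.hasDerivAt
  have h3 := h.F₂_ode x hx
  simp only at h3
  have h4 := h.ne_four x hx
  have h16 := h.ne_sixteen x hx
  change HasDerivAt (fun t => algebraMap 𝕜 ℂ t * P.root t * P.psi₁ t ^ 2 * deriv F₂ t)
    (deriv (fun t => algebraMap 𝕜 ℂ t * P.root t * P.psi₁ t ^ 2 * deriv F₂ t) x) x at h2
  have h5 := h2.const_mul (-1 / (12 * (Real.pi : ℂ) ^ 2))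
  refine HasDerivAt.congr_of_eventuallyEq (h5.congr_deriv ?_) (Eventually.of_forall fun t => ?_)
  · rw [div_pow, mul_pow, h.root_sq x hx]
    field_simp
    linear_combination (-144) * h3
  · simp only
    field_simp

theorem RegularOn.correction_eq (h : P.RegularOn F₂ s) (hx : x ∈ s) :
    P.correction x = -P.f₂a x := by
  have hpi : (Real.pi : ℂ) ≠ 0 := by exact_mod_cast Real.pi_ne_zero
  have h4 : algebraMap 𝕜 ℂ x - 4 ≠ 0 := by rw [← neg_sub]; exact neg_ne_zero.mpr (h.ne_four x hx)
  have h16 : algebraMap 𝕜 ℂ x - 16 ≠ 0 := by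
    rw [← neg_sub]; exact neg_ne_zero.mpr (h.ne_sixteen x hx)
  have hr := h.root_ne_zero hx
  have hX := h.ne_zero x hx
  have hW : P.W x ≠ 0 := by rw [h.W_eq hx]; simp [hpi, hX, hr]
  have hI := Complex.I_ne_zero
  rw [(h.letterIdentities hx).f₂a_x]
  simp only [correction]
  field_simp
  rw [Complex.I_sq]
  ring

/-- The sign comes from W² = -36π²/(xR)². It makes the definition of I₄ the third row solved for I₄.
-/
theorem RegularOn.quarticTerm_eq (h : P.RegularOn F₂ s) (hx : x ∈ s) :
    (Real.pi : ℂ) ^ 2 * (algebraMap 𝕜 ℂ x + 8) ^ 2 *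
        (algebraMap 𝕜 ℂ x ^ 2 - 8 * algebraMap 𝕜 ℂ x + 64)
          / (8 * algebraMap 𝕜 ℂ x ^ 2 * (algebraMap 𝕜 ℂ x - 4) ^ 2 * (algebraMap 𝕜 ℂ x - 16) ^ 2
            * P.W x ^ 2) * (P.psi₁ x / Real.pi) ^ 4 = -(P.f₄b F₂ x + 3 / 2 * F₂ x ^ 2) := by
  have hpi : (Real.pi : ℂ) ≠ 0 := by exact_mod_cast Real.pi_ne_zero
  have hX := h.ne_zero x hx
  have h4 : algebraMap 𝕜 ℂ x - 4 ≠ 0 := by rw [← neg_sub]; exact neg_ne_zero.mpr (h.ne_four x hx)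
  have h16 : algebraMap 𝕜 ℂ x - 16 ≠ 0 := by
    rw [← neg_sub]; exact neg_ne_zero.mpr (h.ne_sixteen x hx)
  have hR : P.root x ^ 2 = (algebraMap 𝕜 ℂ x - 4) * (algebraMap 𝕜 ℂ x - 16) := by
    rw [h.root_sq x hx]; ring
  have hW2 : P.W x ^ 2 = -(36 * Real.pi ^ 2) /
      (algebraMap 𝕜 ℂ x ^ 2 * ((algebraMap 𝕜 ℂ x - 4) * (algebraMap 𝕜 ℂ x - 16))) := by
    rw [← hR, h.W_eq hx, div_pow, mul_pow, mul_pow, Complex.I_sq]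
    ring
  rw [hW2, (h.letterIdentities hx).f₄b_x]
  generalize algebraMap 𝕜 ℂ x = X at *
  field_simp
  ring

theorem RegularOn.I₃_hasDerivAt (h : P.RegularOn F₂ s) (hε : ε ≠ 0)
    (hΦ₀ : DifferentiableOn 𝕜 Φ s) (hΦ₁ : DifferentiableOn 𝕜 (deriv Φ) s) (hx : x ∈ s) :
    HasDerivAt (P.I₃ F₂ ε Φ) (P.root x * (reducedI₃' ε (algebraMap 𝕜 ℂ x)
      (P.root x * P.psi₁ x ^ 2 / Real.pi ^ 2) (deriv P.psi₁ x / P.psi₁ x) (F₂ x)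
      (-(algebraMap 𝕜 ℂ x * (P.root x * P.psi₁ x ^ 2 / Real.pi ^ 2)) / 12 * deriv F₂ x) (Φ x)
      (deriv Φ x) (deriv (deriv Φ) x) + (algebraMap 𝕜 ℂ x - 10) / P.root x ^ 2 *
      reducedI₃ ε (algebraMap 𝕜 ℂ x)
      (P.root x * P.psi₁ x ^ 2 / Real.pi ^ 2) (deriv P.psi₁ x / P.psi₁ x) (F₂ x) (Φ x)
      (deriv Φ x))) x := by
  have hpi : (Real.pi : ℂ) ≠ 0 := by exact_mod_cast Real.pi_ne_zero
  have h0 := h.root_ne_zero hx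
  have h1 := h.psi_ne_zero hx
  have hX0 := h.ne_zero x hx
  have hT0 : P.root x * P.psi₁ x ^ 2 / Real.pi ^ 2 ≠ 0 := by simp [h0, h1, hpi]
  have hF : HasDerivAt F₂ (-(12 * (-(algebraMap 𝕜 ℂ x *
      (P.root x * P.psi₁ x ^ 2 / Real.pi ^ 2)) / 12 * deriv F₂ x)) /
      (algebraMap 𝕜 ℂ x * (P.root x * P.psi₁ x ^ 2 / Real.pi ^ 2))) x := by
    refine ((h.differentiableOn_F₂ x hx).differentiableAt (h.mem_nhds hx)).hasDerivAt.congr_deriv ?_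
    generalize P.root x * P.psi₁ x ^ 2 / (Real.pi : ℂ) ^ 2 = T at *
    field_simp
  have d₃ := hasDerivAt_reducedI₃ (ε := ε) (X := fun t => algebraMap 𝕜 ℂ t)
    (T := fun t => P.root t * P.psi₁ t ^ 2 / Real.pi ^ 2)
    (u := fun t => deriv P.psi₁ t / P.psi₁ t) (F := F₂) (H := fun t => -(algebraMap 𝕜 ℂ t *
      (P.root t * P.psi₁ t ^ 2 / Real.pi ^ 2)) / 12 * deriv F₂ t)
    (Φ₀ := Φ) (Φ₁ := deriv Φ) (Φ₂ := deriv (deriv Φ)) hX0 (h.ne_four x hx)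
    (h.ne_sixteen x hx) hT0 (hasDerivAt_algebraMap x) (h.hasDerivAt_T hx)
    (h.hasDerivAt_u hx) hF ((hΦ₀ x hx).differentiableAt (h.mem_nhds hx)).hasDerivAt
    ((hΦ₁ x hx).differentiableAt (h.mem_nhds hx)).hasDerivAt
  refine (((h.hasDerivAt_root hx).mul d₃).congr_deriv ?_).congr_of_eventuallyEq (by
      filter_upwards [h.mem_nhds hx] with t ht using (h.I₃_eq hε hΦ₀ ht).2)
  field_simp
  ring

theorem RegularOn.I₄_eq (h : P.RegularOn F₂ s) (hε : ε ≠ 0)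
    (hΦ₀ : DifferentiableOn 𝕜 Φ s) (hΦ₁ : DifferentiableOn 𝕜 (deriv Φ) s) (hx : x ∈ s) :
    HasDerivAt (P.I₃ F₂ ε Φ) (ε * (2 * Real.pi * Complex.I * deriv P.tau x) *
        (P.f₄b F₂ x * P.I₂ ε Φ x + (-P.f₂a x + 2 * F₂ x) * P.I₃ F₂ ε Φ x + P.I₄ F₂ ε Φ x)) x ∧
    P.I₄ F₂ ε Φ x = P.root x * reducedI₄ ε (algebraMap 𝕜 ℂ x)
      (P.root x * P.psi₁ x ^ 2 / Real.pi ^ 2) (deriv P.psi₁ x / P.psi₁ x) (F₂ x)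
      (-(algebraMap 𝕜 ℂ x * (P.root x * P.psi₁ x ^ 2 / Real.pi ^ 2)) / 12 * deriv F₂ x) (Φ x)
      (deriv Φ x) (deriv (deriv Φ) x) := by
  have hpi : (Real.pi : ℂ) ≠ 0 := by exact_mod_cast Real.pi_ne_zero
  have hI := Complex.I_ne_zero
  have h0 := h.root_ne_zero hx
  have h1 := h.psi_ne_zero hx
  have hX0 := h.ne_zero x hx
  have hT0 : P.root x * P.psi₁ x ^ 2 / Real.pi ^ 2 ≠ 0 := by simp [h0, h1, hpi]
  have key := h.I₃_hasDerivAt hε hΦ₀ hΦ₁ hx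
  have hτ : deriv P.tau x = -12 / (algebraMap 𝕜 ℂ x *
      (P.root x * P.psi₁ x ^ 2 / Real.pi ^ 2)) / (2 * Real.pi * Complex.I) := by
    rw [← h.two_pi_I_deriv_tau hx]; field_simp
  have hτ0 : deriv P.tau x ≠ 0 := by
    rw [hτ]; exact div_ne_zero (div_ne_zero (by norm_num) (mul_ne_zero hX0 hT0)) (by simp [hpi])
  constructor
  · refine key.differentiableAt.hasDerivAt.congr_deriv ?_
    simp only [I₄]
    rw [derivTau, h.quarticTerm_eq hx, h.correction_eq hx]
    field_simp
    ring
  · obtain ⟨ha, -, h4b, -⟩ := h.letters_T hx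
    simp only [I₄]
    rw [derivTau, key.deriv, h.quarticTerm_eq hx, h.correction_eq hx, (h.I₃_eq hε hΦ₀ hx).2,
      h.I₂_eq hx, hτ, h4b, ha, reducedI₄, ← h.root_sq x hx]
    generalize reducedI₃' _ _ _ _ _ _ _ _ _ = r₃' at *
    generalize reducedI₃ _ _ _ _ _ _ _ = r₃ at *
    generalize P.root x * P.psi₁ x ^ 2 / (Real.pi : ℂ) ^ 2 = T at *
    field_simp
    ring

/-- The only row of the system that is not a definition, and the only use of the differential
equation of I₁₁₁₁. -/
theorem RegularOn.I₄_hasDerivAt (h : P.RegularOn F₂ s) (hε : ε ≠ 0) (hΦ : SolvesBanana ε Φ s)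
    (hx : x ∈ s) :
    HasDerivAt (P.I₄ F₂ ε Φ) (ε * (2 * Real.pi * Complex.I * deriv P.tau x) *
      (P.f₄a x * I₁ ε + P.f₆ F₂ x * P.I₂ ε Φ x + P.f₄b F₂ x * P.I₃ F₂ ε Φ x +
        (-P.f₂a x - F₂ x) * P.I₄ F₂ ε Φ x)) x := by
  have hpi : (Real.pi : ℂ) ≠ 0 := by exact_mod_cast Real.pi_ne_zero
  have h0 := h.root_ne_zero hx
  have h1 := h.psi_ne_zero hx
  have hX0 := h.ne_zero x hx
  have hX4 := h.ne_four x hx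
  have hX16 := h.ne_sixteen x hx
  have hT0 : P.root x * P.psi₁ x ^ 2 / Real.pi ^ 2 ≠ 0 := by simp [h0, h1, hpi]
  have hF : HasDerivAt F₂ (-(12 * (-(algebraMap 𝕜 ℂ x *
      (P.root x * P.psi₁ x ^ 2 / Real.pi ^ 2)) / 12 * deriv F₂ x)) /
      (algebraMap 𝕜 ℂ x * (P.root x * P.psi₁ x ^ 2 / Real.pi ^ 2))) x := by
    refine ((h.differentiableOn_F₂ x hx).differentiableAt (h.mem_nhds hx)).hasDerivAt.congr_deriv ?_
    generalize P.root x * P.psi₁ x ^ 2 / (Real.pi : ℂ) ^ 2 = T at *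
    field_simp
  have d₄ := hasDerivAt_reducedI₄ (X := fun t => algebraMap 𝕜 ℂ t)
    (T := fun t => P.root t * P.psi₁ t ^ 2 / Real.pi ^ 2)
    (u := fun t => deriv P.psi₁ t / P.psi₁ t) (F := F₂) (H := fun t => -(algebraMap 𝕜 ℂ t *
      (P.root t * P.psi₁ t ^ 2 / Real.pi ^ 2)) / 12 * deriv F₂ t)
    (Φ₀ := Φ) (Φ₁ := deriv Φ) (Φ₂ := deriv (deriv Φ)) hε hX0 hX4
    hX16 hT0 (hasDerivAt_algebraMap x)
    (h.hasDerivAt_T hx) (h.hasDerivAt_u hx) hF (h.hasDerivAt_H hx)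
    ((hΦ.differentiableOn x hx).differentiableAt (h.mem_nhds hx)).hasDerivAt
    ((hΦ.differentiableOn_deriv x hx).differentiableAt (h.mem_nhds hx)).hasDerivAt
    ((hΦ.differentiableOn_deriv₂ x hx).differentiableAt (h.mem_nhds hx)).hasDerivAt (hΦ.ode x hx)
  refine (((h.hasDerivAt_root hx).mul d₄).congr_deriv ?_).congr_of_eventuallyEq (by
    filter_upwards [h.mem_nhds hx] with t ht using
      (h.I₄_eq hε hΦ.differentiableOn hΦ.differentiableOn_deriv ht).2)
  obtain ⟨ha, h4a, h4b, h6⟩ := h.letters_T hx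
  rw [h.two_pi_I_deriv_tau hx, h4a, h6, h4b, ha, h.I₂_eq hx, (h.I₃_eq hε hΦ.differentiableOn hx).2,
    (h.I₄_eq hε hΦ.differentiableOn hΦ.differentiableOn_deriv hx).2, ← h.root_sq x hx]
  generalize reducedI₄ _ _ _ _ _ _ _ _ _ = r₄ at *
  generalize reducedI₃ _ _ _ _ _ _ _ = r₃ at *
  generalize P.root x * P.psi₁ x ^ 2 / (Real.pi : ℂ) ^ 2 = T at *
  field_simp
  ring

theorem RegularOn.epsFactorised (h : P.RegularOn F₂ s) (hε : ε ≠ 0) (hΦ : SolvesBanana ε Φ s)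
    (hx : x ∈ s) : P.EpsFactorised F₂ ε Φ x := by
  have hf₂b : f₂b F₂ x = F₂ x := rfl
  refine hasDerivAt_pi.mpr fun i => ?_
  fin_cases i
  · simpa [masterIntegrals, connection, Matrix.mulVec, dotProduct, Fin.sum_univ_four] using
      hasDerivAt_const x (I₁ ε)
  · refine (h.I₃_eq hε hΦ.differentiableOn hx).1.congr_deriv ?_
    simp [masterIntegrals, connection, hf₂b]
    ring
  · refine (h.I₄_eq hε hΦ.differentiableOn hΦ.differentiableOn_deriv hx).1.congr_deriv ?_
    simp [masterIntegrals, connection, hf₂b]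
    ring
  · refine (h.I₄_hasDerivAt hε hΦ hx).congr_deriv ?_
    simp [masterIntegrals, connection, hf₂b]
    ring

end

end Branch
end
end Banana

namespace Banana

/-! ### Analytic continuation in x -/

noncomputable section

namespace Continues

variable {U : Set ℂ} {x₀ : ℝ} {f f' : ℝ → ℂ} {g g' : ℂ → ℂ}

/-- The complex derivative of a holomorphic function at a real point is also the derivative along
the real line. So the relation passes to derivatives, and hence to all differential expressions. -/
theorem deriv (hU : IsOpen U) (hx₀ : (x₀ : ℂ) ∈ U) (h : Continues U x₀ f g) :
    Continues U x₀ (deriv f) (deriv g) := by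
  refine ⟨h.1.deriv hU, ?_⟩
  have hU' : ∀ᶠ t : ℝ in 𝓝 x₀, (t : ℂ) ∈ U :=
    Complex.continuous_ofReal.continuousAt.eventually (hU.mem_nhds hx₀)
  filter_upwards [h.2.eventually_nhds, hU'] with t ht htU
  have h1 := ((h.1 t htU).differentiableAt (hU.mem_nhds htU)).hasDerivAt.comp_ofReal
  exact (h1.congr_of_eventuallyEq (by filter_upwards [ht] with s hs using hs.symm)).deriv.symm

theorem add (h : Continues U x₀ f g) (h' : Continues U x₀ f' g') :
    Continues U x₀ (fun t => f t + f' t) (fun t => g t + g' t) :=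
  ⟨h.1.add h'.1, by filter_upwards [h.2, h'.2] with t h1 h2; rw [h1, h2]⟩

theorem sub (h : Continues U x₀ f g) (h' : Continues U x₀ f' g') :
    Continues U x₀ (fun t => f t - f' t) (fun t => g t - g' t) :=
  ⟨h.1.sub h'.1, by filter_upwards [h.2, h'.2] with t h1 h2; rw [h1, h2]⟩

theorem mul (h : Continues U x₀ f g) (h' : Continues U x₀ f' g') :
    Continues U x₀ (fun t => f t * f' t) (fun t => g t * g' t) :=
  ⟨h.1.mul h'.1, by filter_upwards [h.2, h'.2] with t h1 h2; rw [h1, h2]⟩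

theorem pow (h : Continues U x₀ f g) (n : ℕ) :
    Continues U x₀ (fun t => f t ^ n) (fun t => g t ^ n) :=
  ⟨h.1.pow n, by filter_upwards [h.2] with t h1; rw [h1]⟩

theorem const (c : ℂ) : Continues U x₀ (fun _ => c) (fun _ => c) :=
  ⟨differentiableOn_const c, Eventually.of_forall fun _ => rfl⟩

theorem algebraMap : Continues U x₀ (fun t => algebraMap ℝ ℂ t) (fun t => algebraMap ℂ ℂ t) :=
  ⟨differentiableOn_id, Eventually.of_forall fun _ => rfl⟩

/-- The identity theorem. -/
theorem eq_of_eventually_eq (hU : IsOpen U) (hUc : IsPreconnected U) (hx₀ : (x₀ : ℂ) ∈ U)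
    (h : Continues U x₀ f g) (h' : Continues U x₀ f' g') (hf : ∀ᶠ t in 𝓝 x₀, f t = f' t) :
    ∀ z ∈ U, g z = g' z := by
  refine AnalyticOnNhd.eqOn_of_preconnected_of_frequently_eq (h.1.analyticOnNhd hU)
    (h'.1.analyticOnNhd hU) hUc hx₀ ?_
  have h1 : ∀ᶠ t : ℝ in 𝓝[≠] x₀, g t = g' t := by
    apply eventually_nhdsWithin_of_eventually_nhds
    filter_upwards [h.2, h'.2, hf] with t h1 h2 h3
    rw [h1, h2, h3]
  -- Real points different from x₀ accumulate at x₀, which is all that the identity theorem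
  -- requires.
  have h2 : Tendsto (fun t : ℝ => (t : ℂ)) (𝓝[≠] x₀) (𝓝[≠] (x₀ : ℂ)) := by
    refine tendsto_nhdsWithin_iff.mpr ⟨(Complex.continuous_ofReal.tendsto x₀).mono_left
      nhdsWithin_le_nhds, ?_⟩
    filter_upwards [self_mem_nhdsWithin] with t ht
    simpa using ht
  exact h2.frequently h1.frequently

end Continues

/-- Analytic continuation preserves the relations between the functions of a branch. -/
theorem ContinuesBranch.regularOn {U : Set ℂ} {x₀ : ℝ} {Q : Branch ℂ} {F₂ : ℂ → ℂ}
    {P : Branch ℝ} {G₂ : ℝ → ℂ} (hP : P.RegularOn G₂ (Set.Iio 0))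
    (hU : IsOpen U) (hUc : IsPreconnected U) (h0 : (0 : ℂ) ∉ U) (h4 : (4 : ℂ) ∉ U)
    (h16 : (16 : ℂ) ∉ U) (hx₀ : x₀ < 0) (hx₀U : (x₀ : ℂ) ∈ U)
    (hroot : Continues U x₀ P.root Q.root) (hsqrt : Continues U x₀ P.sqrtY Q.sqrtY)
    (hpsi₁ : Continues U x₀ P.psiSun₁ Q.psiSun₁) (hpsi₂ : Continues U x₀ P.psiSun₂ Q.psiSun₂)
    (hne : ∀ z ∈ U, Q.psiSun₁ z ≠ 0) (hF : Continues U x₀ G₂ F₂) :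
    Q.RegularOn F₂ U := by
  have hneg : ∀ᶠ t in 𝓝 x₀, t ∈ Set.Iio (0 : ℝ) := Iio_mem_nhds hx₀
  have c := fun a : ℂ => Continues.const (U := U) (x₀ := x₀) a
  have X := Continues.algebraMap (U := U) (x₀ := x₀)
  have r := (((c 4).sub X).mul ((c 16).sub X))
  have p₁ : Continues U x₀ P.psi₁ Q.psi₁ := hsqrt.mul hpsi₁
  have p₂ : Continues U x₀ P.psi₂ Q.psi₂ := hsqrt.mul hpsi₂
  have dp₁ := p₁.deriv hU hx₀U
  -- The relations in `RegularOn` are polynomial in the functions and their derivatives, without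
  -- quotients such as τ, so both sides are assembled from sums, products and derivatives of
  -- continued functions.
  have key := fun {f f' : ℝ → ℂ} {g g' : ℂ → ℂ} (h : Continues U x₀ f g)
    (h' : Continues U x₀ f' g') (hs : ∀ t ∈ Set.Iio (0 : ℝ), f t = f' t) =>
    h.eq_of_eventually_eq hU hUc hx₀U h' (hneg.mono hs)
  refine ⟨hU, fun z hz h => h0 (by rwa [← h]), fun z hz h => h4 ?_, fun z hz h => h16 ?_, hne,
    key (hroot.pow 2) r hP.root_sq,
    key (hsqrt.pow 2) ((((c 10).sub X).sub hroot).mul (c 2⁻¹)) ?_, hroot.1, p₁.1, p₂.1, dp₁.1,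
    hF.1, (hF.deriv hU hx₀U).1,
    key ((X.mul hroot).mul ((p₁.mul (p₂.deriv hU hx₀U)).sub (p₂.mul dp₁))) (c _) hP.wronskian,
    key (((((c 4).mul X).mul r).mul (dp₁.deriv hU hx₀U)).add (((c 4).mul ((((c 2).mul (X.pow 2)).sub
      ((c 30).mul X)).add (c 64))).mul dp₁) |>.add ((X.sub (c 8)).mul p₁)) (c 0) hP.picardFuchs,
    key (((c (6 * Real.pi ^ 2)).mul (r.pow 2)).mul
      ((((X.mul hroot).mul (p₁.pow 2)).mul (hF.deriv hU hx₀U)).deriv hU hx₀U))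
      (((X.sub (c 8)).mul ((X.add (c 8)).pow 3)).mul (p₁.pow 4)) hP.F₂_ode⟩
  · have : z = 4 := by linear_combination -h
    rwa [← this]
  · have : z = 16 := by linear_combination -h
    rwa [← this]
  · intro t ht
    rw [hP.sqrtY_sq t ht, Branch.y, div_eq_mul_inv]

theorem Continues.solvesBanana {U : Set ℂ} {x₀ : ℝ} {ε : ℂ} {φ : ℝ → ℂ} {Φ : ℂ → ℂ}
    (hφ : Branch.SolvesBanana ε φ (Set.Iio 0))
    (hU : IsOpen U) (hUc : IsPreconnected U) (hx₀ : x₀ < 0) (hx₀U : (x₀ : ℂ) ∈ U)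
    (h : Continues U x₀ φ Φ) : Branch.SolvesBanana ε Φ U := by
  have hneg : ∀ᶠ t in 𝓝 x₀, t ∈ Set.Iio (0 : ℝ) := Iio_mem_nhds hx₀
  have c := fun a : ℂ => Continues.const (U := U) (x₀ := x₀) a
  have X := Continues.algebraMap (U := U) (x₀ := x₀)
  have h1 := h.deriv hU hx₀U
  have h2 := h1.deriv hU hx₀U
  have h3 := h2.deriv hU hx₀U
  refine ⟨h.1, h1.1, h2.1, Continues.eq_of_eventually_eq hU hUc hx₀U
    (((((((c (-(6 * ε ^ 3 + 11 * ε ^ 2 + 6 * ε + 1))).mul X).add (c _)).mul h).add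
    (((((c (-(11 * ε ^ 2 + 18 * ε + 7))).mul (X.pow 2)).add
      ((c _).mul X)).add (c _)).mul h1)).add
    (((((c (-6 * (1 + ε))).mul (X.pow 3)).add ((c (60 * ε + 90)).mul (X.pow 2))).sub
      ((c 192).mul X)).mul h2)).sub
    ((((X.pow 2).mul (X.sub (c 4))).mul (X.sub (c 16))).mul h3)) (c _) (hneg.mono hφ.ode)⟩

theorem main_of_regularOn (hP : euclid.RegularOn euclidF₂ (Set.Iio 0))
    (hΦ : ∀ ε : ℂ, ε ≠ 0 → -(1 / 3 : ℝ) < ε.re →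
      Branch.SolvesBanana ε (bananaI1111 ε) (Set.Iio 0)) :
    (∀ x : ℝ, x < 0 →
      Banana.euclid.LetterIdentities Banana.euclidF₂ x ∧
      ∀ ε : ℂ, ε ≠ 0 → -(1 / 3 : ℝ) < ε.re →
        Banana.euclid.EpsFactorised Banana.euclidF₂ ε (Banana.bananaI1111 ε) x) ∧
    (∀ (U : Set ℂ) (x₀ : ℝ) (Q : Banana.Branch ℂ) (F₂ : ℂ → ℂ),
      IsOpen U → IsPreconnected U → (0 : ℂ) ∉ U → (4 : ℂ) ∉ U → (16 : ℂ) ∉ U →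
      x₀ < 0 → (x₀ : ℂ) ∈ U →
      Banana.ContinuesBranch U x₀ Q → (∀ z ∈ U, Q.psiSun₁ z ≠ 0) →
      Banana.Continues U x₀ Banana.euclidF₂ F₂ →
      ∀ z ∈ U,
        Q.LetterIdentities F₂ z ∧
        ∀ (ε : ℂ) (Φ : ℂ → ℂ), ε ≠ 0 → -(1 / 3 : ℝ) < ε.re →
          Banana.Continues U x₀ (Banana.bananaI1111 ε) Φ →
          Q.EpsFactorised F₂ ε Φ z) := by
  refine ⟨fun x hx => ⟨hP.letterIdentities hx, fun ε hε hre => hP.epsFactorised hε (hΦ ε hε hre) hx⟩,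
    fun U x₀ Q F₂ hU hUc h0 h4 h16 hx₀ hx₀U hQ hne hF z hz => ?_⟩
  have hQ' := ContinuesBranch.regularOn hP hU hUc h0 h4 h16 hx₀ hx₀U hQ.root hQ.sqrtY hQ.psiSun₁
    hQ.psiSun₂ hne hF
  exact ⟨hQ'.letterIdentities hz, fun ε Φ hε hre hΦ' => hQ'.epsFactorised hε
    (hΦ'.solvesBanana (hΦ ε hε hre) hU hUc hx₀ hx₀U) hz⟩

end
end Banana

namespace Banana

/-! ### Complete elliptic integrals and Legendre's relation -/

noncomputable section

open Real in
/-- `K` as a function of the parameter `m = k²`, in trigonometric form. -/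
def ellK (m : ℝ) : ℝ := ∫ θ in (0 : ℝ)..π / 2, (√(1 - m * sin θ ^ 2))⁻¹

open Real in
/-- The complete elliptic integral of the second kind as a function of `m = k²`. -/
def ellE (m : ℝ) : ℝ := ∫ θ in (0 : ℝ)..π / 2, √(1 - m * sin θ ^ 2)

section

open Real

theorem one_sub_mul_sin_sq_ge {m : ℝ} (hm : 0 ≤ m) (θ : ℝ) : 1 - m ≤ 1 - m * sin θ ^ 2 := by
  nlinarith [sin_sq_le_one θ]

theorem one_sub_mul_sin_sq_pos {m : ℝ} (hm : 0 ≤ m) (hm1 : m < 1) (θ : ℝ) :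
    0 < 1 - m * sin θ ^ 2 :=
  (sub_pos.mpr hm1).trans_le (one_sub_mul_sin_sq_ge hm θ)

theorem continuous_sqrt_modular (m : ℝ) : Continuous fun θ => √(1 - m * sin θ ^ 2) := by fun_prop

theorem continuous_inv_sqrt_modular {m : ℝ} (hm : 0 ≤ m) (hm1 : m < 1) :
    Continuous fun θ => (√(1 - m * sin θ ^ 2))⁻¹ :=
  (continuous_sqrt_modular m).inv₀ fun θ => (sqrt_pos.mpr (one_sub_mul_sin_sq_pos hm hm1 θ)).ne'

/-- Substitute t = sin θ on the open interval, where sin is injective and cos θ > 0 cancels √(1-t²).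
-/
theorem ellipticK_eq_ellK (k : ℝ) : ellipticK k = ellK (k ^ 2) := by
  rw [ellipticK, ellK, intervalIntegral.integral_of_le zero_le_one,
    intervalIntegral.integral_of_le (by positivity), ← integral_Ioc_eq_integral_Ioo.symm,
    integral_Ioc_eq_integral_Ioo]
  have himg : sin '' Set.Ioo 0 (π / 2) = Set.Ioo 0 1 := by
    apply Set.Subset.antisymm
    · rintro _ ⟨θ, hθ, rfl⟩
      refine ⟨sin_pos_of_pos_of_lt_pi hθ.1 (by linarith [hθ.2, pi_pos]), ?_⟩
      rw [← sin_pi_div_two]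
      exact sin_lt_sin_of_lt_of_le_pi_div_two (by linarith [hθ.1, pi_pos]) le_rfl hθ.2
    · intro t ht
      refine ⟨arcsin t, ⟨arcsin_pos.mpr ht.1, arcsin_lt_pi_div_two.mpr ht.2⟩,
        sin_arcsin (by linarith [ht.1]) ht.2.le⟩
  have hinj : Set.InjOn sin (Set.Ioo 0 (π / 2)) :=
    injOn_sin.mono fun θ hθ => by constructor <;> linarith [hθ.1, hθ.2, pi_pos]
  rw [← himg, integral_image_eq_integral_abs_deriv_smul measurableSet_Ioo
    (fun θ _ => (hasDerivAt_sin θ).hasDerivWithinAt)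
    hinj]
  refine setIntegral_congr_fun measurableSet_Ioo fun θ hθ => ?_
  have hc : 0 < cos θ := cos_pos_of_mem_Ioo ⟨by linarith [hθ.1, pi_pos], hθ.2⟩
  simp only [smul_eq_mul, abs_of_pos hc]
  rw [← cos_sq', sqrt_mul (sq_nonneg _), sqrt_sq hc.le]
  field_simp

theorem hasDerivAt_ellE {m : ℝ} (hm : 0 < m) (hm1 : m < 1) :
    HasDerivAt ellE ((ellE m - ellK m) / (2 * m)) m := by
  have key := intervalIntegral.hasDerivAt_integral_of_dominated_loc_of_deriv_le
    (μ := volume) (a := 0) (b := π / 2)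
    (F := fun m θ => √(1 - m * sin θ ^ 2))
    (F' := fun m θ => -(sin θ ^ 2) / (2 * √(1 - m * sin θ ^ 2)))
    -- Parameters stay below the midpoint (m+1)/2 of m and 1, which keeps the radicand away from
    -- zero uniformly in θ.
    (bound := fun _ => 1 / (2 * √(1 - (m + 1) / 2)))
    (x₀ := m) (s := Set.Ioo 0 ((m + 1) / 2)) (Ioo_mem_nhds hm (by linarith))
    (Eventually.of_forall fun x => (continuous_sqrt_modular x).aestronglyMeasurable)
    ((continuous_sqrt_modular m).intervalIntegrable _ _)
    (by
      refine Continuous.aestronglyMeasurable ?_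
      refine Continuous.div (by fun_prop) (by fun_prop) fun θ => ?_
      have := sqrt_pos.mpr (one_sub_mul_sin_sq_pos hm.le hm1 θ)
      positivity)
    (by
      refine Eventually.of_forall fun θ _ x hx => ?_
      have h1 : 1 - (m + 1) / 2 ≤ 1 - x * sin θ ^ 2 :=
        (by linarith [hx.2] : _ ≤ 1 - x).trans (one_sub_mul_sin_sq_ge hx.1.le θ)
      have h2 : 0 < 1 - (m + 1) / 2 := by linarith
      have h3 := sqrt_pos.mpr h2
      rw [norm_div, norm_neg, norm_of_nonneg (sq_nonneg _), norm_of_nonneg (by positivity)]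
      exact div_le_div₀ zero_le_one (sin_sq_le_one θ) (by positivity)
        (by have := sqrt_le_sqrt h1; linarith))
    (continuous_const.intervalIntegrable _ _)
    (by
      refine Eventually.of_forall fun θ _ x hx => ?_
      have h1 := one_sub_mul_sin_sq_pos hx.1.le (by linarith [hx.2]) θ
      exact ((((hasDerivAt_id x).mul_const _).const_sub 1).sqrt h1.ne').congr_deriv (by simp))
  refine key.2.congr_deriv ?_
  rw [ellE, ellK, ← intervalIntegral.integral_sub ((continuous_sqrt_modular m).intervalIntegrable _ _)
    ((continuous_inv_sqrt_modular hm.le hm1).intervalIntegrable _ _),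
    ← intervalIntegral.integral_div]
  refine intervalIntegral.integral_congr fun θ _ => ?_
  have h1 := one_sub_mul_sin_sq_pos hm.le hm1 θ
  have h2 := sqrt_pos.mpr h1
  have h3 := sq_sqrt h1.le
  generalize √(1 - m * sin θ ^ 2) = d at *
  field_simp
  linarith

/-- With Δ = √(1 - m sin²θ), the derivative of m sin θ cos θ / Δ is Δ - (1-m) Δ⁻³, and this
primitive vanishes at 0 and π/2. -/
theorem integral_inv_sqrt_cube {m : ℝ} (hm : 0 < m) (hm1 : m < 1) :
    ∫ θ in (0 : ℝ)..π / 2, (√(1 - m * sin θ ^ 2) ^ 3)⁻¹ = ellE m / (1 - m) := by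
  have hc3 : Continuous fun θ => (√(1 - m * sin θ ^ 2) ^ 3)⁻¹ := by
    exact ((continuous_sqrt_modular m).pow 3).inv₀ fun θ =>
      (pow_pos (sqrt_pos.mpr (one_sub_mul_sin_sq_pos hm.le hm1 θ)) 3).ne'
  have hd : ∀ θ : ℝ, HasDerivAt (fun θ => m * (sin θ * cos θ) / √(1 - m * sin θ ^ 2))
      (√(1 - m * sin θ ^ 2) - (1 - m) * (√(1 - m * sin θ ^ 2) ^ 3)⁻¹) θ := fun θ => by
    have h1 := one_sub_mul_sin_sq_pos hm.le hm1 θ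
    have h2 := sqrt_pos.mpr h1
    have h3 := sq_sqrt h1.le
    refine ((((hasDerivAt_sin θ).mul (hasDerivAt_cos θ)).const_mul m).div
      (((((hasDerivAt_sin θ).pow 2).const_mul m).const_sub 1).sqrt h1.ne') h2.ne').congr_deriv ?_
    simp only [Pi.mul_apply, Pi.pow_apply]
    generalize √(1 - m * sin θ ^ 2) = d at *
    have h4 := cos_sq' θ
    field_simp
    have h5 : m * sin θ ^ 2 = 1 - d ^ 2 := by linarith
    rw [h4]
    linear_combination 2 * (m - 1 - m * sin θ ^ 2 - d ^ 2) * h5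
  have h := intervalIntegral.integral_eq_sub_of_hasDerivAt (a := 0) (b := π / 2) (fun θ _ => hd θ)
    (((continuous_sqrt_modular m).sub (continuous_const.mul hc3)).intervalIntegrable _ _)
  rw [intervalIntegral.integral_sub ((continuous_sqrt_modular m).intervalIntegrable _ _)
    ((hc3.intervalIntegrable _ _).const_mul _), intervalIntegral.integral_const_mul] at h
  rw [eq_div_iff (by linarith), ellE]
  simp at h
  linarith

/-- Under the integral the derivative is sin²θ/(2Δ³) = (Δ⁻³ - Δ⁻¹)/(2m), and the integral of Δ⁻³ is
E/(1-m). -/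
theorem hasDerivAt_ellK {m : ℝ} (hm : 0 < m) (hm1 : m < 1) :
    HasDerivAt ellK ((ellE m - (1 - m) * ellK m) / (2 * m * (1 - m))) m := by
  have hc3 : Continuous fun θ => (√(1 - m * sin θ ^ 2) ^ 3)⁻¹ := by
    exact ((continuous_sqrt_modular m).pow 3).inv₀ fun θ =>
      (pow_pos (sqrt_pos.mpr (one_sub_mul_sin_sq_pos hm.le hm1 θ)) 3).ne'
  have key := intervalIntegral.hasDerivAt_integral_of_dominated_loc_of_deriv_le
    (μ := volume) (a := 0) (b := π / 2)
    (F := fun m θ => (√(1 - m * sin θ ^ 2))⁻¹)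
    (F' := fun m θ => sin θ ^ 2 / (2 * √(1 - m * sin θ ^ 2) ^ 3))
    (bound := fun _ => 1 / (2 * √(1 - (m + 1) / 2) ^ 3))
    (x₀ := m) (s := Set.Ioo 0 ((m + 1) / 2)) (Ioo_mem_nhds hm (by linarith))
    (Eventually.of_forall fun x =>
      ((continuous_sqrt_modular x).measurable.inv).aestronglyMeasurable)
    ((continuous_inv_sqrt_modular hm.le hm1).intervalIntegrable _ _)
    (by
      refine Continuous.aestronglyMeasurable ?_
      refine Continuous.div (by fun_prop) (by fun_prop) fun θ => ?_
      have := sqrt_pos.mpr (one_sub_mul_sin_sq_pos hm.le hm1 θ)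
      positivity)
    (by
      refine Eventually.of_forall fun θ _ x hx => ?_
      have h1 : 1 - (m + 1) / 2 ≤ 1 - x * sin θ ^ 2 :=
        (by linarith [hx.2] : _ ≤ 1 - x).trans (one_sub_mul_sin_sq_ge hx.1.le θ)
      have h2 : 0 < 1 - (m + 1) / 2 := by linarith
      have h3 := sqrt_pos.mpr h2
      rw [norm_div, norm_of_nonneg (sq_nonneg _), norm_of_nonneg (by positivity)]
      exact div_le_div₀ zero_le_one (sin_sq_le_one θ) (by positivity)
        (by have := pow_le_pow_left₀ h3.le (sqrt_le_sqrt h1) 3; linarith))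
    (continuous_const.intervalIntegrable _ _)
    (by
      refine Eventually.of_forall fun θ _ x hx => ?_
      have h1 := one_sub_mul_sin_sq_pos hx.1.le (by linarith [hx.2]) θ
      have h2 := sqrt_pos.mpr h1
      refine (((((hasDerivAt_id x).mul_const _).const_sub 1).sqrt h1.ne').inv h2.ne').congr_deriv ?_
      simp only [id]
      field_simp)
  refine key.2.congr_deriv ?_
  have e : (ellE m - (1 - m) * ellK m) / (2 * m * (1 - m)) =
      (ellE m / (1 - m) - ellK m) / (2 * m) := by
    have : 1 - m ≠ 0 := by linarith
    field_simp
  rw [e, ← integral_inv_sqrt_cube hm hm1, ellK,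
    ← intervalIntegral.integral_sub (hc3.intervalIntegrable _ _)
    ((continuous_inv_sqrt_modular hm.le hm1).intervalIntegrable _ _),
    ← intervalIntegral.integral_div]
  refine intervalIntegral.integral_congr fun θ _ => ?_
  have h1 := one_sub_mul_sin_sq_pos hm.le hm1 θ
  have h2 := sqrt_pos.mpr h1
  have h3 := sq_sqrt h1.le
  generalize √(1 - m * sin θ ^ 2) = d at *
  field_simp
  linarith

theorem ellK_ge {m : ℝ} (hm : 0 ≤ m) (hm1 : m < 1) : π / 2 ≤ ellK m := by
  have h : ∫ _ in (0 : ℝ)..π / 2, (1 : ℝ) = π / 2 := by simp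
  rw [← h, ellK]
  refine intervalIntegral.integral_mono_on (by positivity) (by simp)
    ((continuous_inv_sqrt_modular hm hm1).intervalIntegrable _ _) fun θ _ => ?_
  have h1 := one_sub_mul_sin_sq_pos hm hm1 θ
  exact (one_le_inv₀ (sqrt_pos.mpr h1)).mpr (sqrt_le_one.mpr (by nlinarith [sq_nonneg (sin θ)]))

theorem ellK_le {m : ℝ} (hm : 0 ≤ m) (hm1 : m < 1) : ellK m ≤ π / 2 / √(1 - m) := by
  have h : ∫ _ in (0 : ℝ)..π / 2, (√(1 - m))⁻¹ = π / 2 / √(1 - m) := by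
    simp [div_eq_mul_inv]
  rw [← h, ellK]
  refine intervalIntegral.integral_mono_on (by positivity)
    ((continuous_inv_sqrt_modular hm hm1).intervalIntegrable _ _) (by simp) fun θ _ => ?_
  exact inv_anti₀ (sqrt_pos.mpr (by linarith)) (sqrt_le_sqrt (one_sub_mul_sin_sq_ge hm θ))

/-- The integrand of K - E is m sin²θ/Δ. The factor m is what defeats the growth of K(1-m) as m → 0
in Legendre's relation. -/
theorem ellK_sub_ellE {m : ℝ} (hm : 0 ≤ m) (hm1 : m < 1) :
    0 ≤ ellK m - ellE m ∧ ellK m - ellE m ≤ m * ellK m := by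
  have hi := (continuous_inv_sqrt_modular hm hm1).intervalIntegrable (μ := volume) 0 (π / 2)
  have hs := (continuous_sqrt_modular m).intervalIntegrable (μ := volume) 0 (π / 2)
  constructor
  · rw [ellK, ellE, ← intervalIntegral.integral_sub hi hs]
    refine intervalIntegral.integral_nonneg (by positivity) fun θ _ => ?_
    have h1 := one_sub_mul_sin_sq_pos hm hm1 θ
    have h2 := sqrt_pos.mpr h1
    have h3 : √(1 - m * sin θ ^ 2) ≤ 1 := sqrt_le_one.mpr (by nlinarith [sq_nonneg (sin θ)])
    linarith [(one_le_inv₀ h2).mpr h3]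
  · rw [ellK, ellE, ← intervalIntegral.integral_sub hi hs, ← intervalIntegral.integral_const_mul]
    refine intervalIntegral.integral_mono_on (by positivity) (hi.sub hs) (hi.const_mul _)
      fun θ _ => ?_
    have h1 := one_sub_mul_sin_sq_pos hm hm1 θ
    have h2 := sqrt_pos.mpr h1
    have h3 := sq_sqrt h1.le
    have h4 := sin_sq_le_one θ
    have e : (√(1 - m * sin θ ^ 2))⁻¹ - √(1 - m * sin θ ^ 2) =
        m * sin θ ^ 2 * (√(1 - m * sin θ ^ 2))⁻¹ := by
      field_simp
      linarith
    rw [e]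
    gcongr
    nlinarith

theorem continuous_ellE : Continuous ellE :=
  intervalIntegral.continuous_parametric_intervalIntegral_of_continuous' (by fun_prop) _ _

theorem ellE_one : ellE 1 = 1 := by
  have : ellE 1 = ∫ θ in (0 : ℝ)..π / 2, cos θ := by
    refine intervalIntegral.integral_congr fun θ hθ => ?_
    rw [Set.uIcc_of_le (by positivity)] at hθ
    simp only [one_mul]
    rw [← cos_sq', sqrt_sq (cos_nonneg_of_mem_Icc ⟨by linarith [hθ.1, pi_pos], hθ.2⟩)]
  rw [this, integral_cos]; simp

/-- Legendre's relation. -/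
theorem legendre_relation {m : ℝ} (hm : 0 < m) (hm1 : m < 1) :
    ellE m * ellK (1 - m) + ellE (1 - m) * ellK m - ellK m * ellK (1 - m) = π / 2 := by
  set L : ℝ → ℝ := fun m =>
    ellE m * ellK (1 - m) + ellE (1 - m) * ellK m - ellK m * ellK (1 - m) with hL
  have hd : ∀ t ∈ Set.Ioo (0 : ℝ) 1, HasDerivAt L 0 t := fun t ht => by
    have hE := hasDerivAt_ellE ht.1 ht.2
    have hK := hasDerivAt_ellK ht.1 ht.2
    have ht' : 0 < 1 - t := by linarith [ht.2]
    have hE' := (hasDerivAt_ellE ht' (by linarith [ht.1])).comp t ((hasDerivAt_id t).const_sub 1)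
    have hK' := (hasDerivAt_ellK ht' (by linarith [ht.1])).comp t ((hasDerivAt_id t).const_sub 1)
    refine (((hE.mul hK').add (hE'.mul hK)).sub (hK.mul hK')).congr_deriv ?_
    have ht0 := ht.1.ne'
    have ht1 := ht'.ne'
    simp only [Function.comp_apply, sub_sub_cancel]
    field_simp
    ring
  -- The derivative formulas make the left-hand side constant on (0,1); its value is read off in the
  -- limit t → 0+.
  have hconst : ∀ t ∈ Set.Ioo (0 : ℝ) 1, L t = L m := fun t ht =>
    isOpen_Ioo.is_const_of_deriv_eq_zero isPreconnected_Ioo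
      (fun s hs => (hd s hs).differentiableAt.differentiableWithinAt)
      (fun s hs => (hd s hs).deriv) ht ⟨hm, hm1⟩
  have hK0 : Tendsto ellK (𝓝[>] 0) (𝓝 (π / 2)) := by
    have h1 : Tendsto (fun m : ℝ => π / 2 / √(1 - m)) (𝓝[>] 0) (𝓝 (π / 2)) := by
      have : ContinuousAt (fun m : ℝ => π / 2 / √(1 - m)) 0 :=
        ContinuousAt.div (by fun_prop) (by fun_prop) (by simp)
      simpa using this.tendsto.mono_left nhdsWithin_le_nhds
    refine tendsto_of_tendsto_of_tendsto_of_le_of_le' tendsto_const_nhds h1 ?_ ?_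
    · filter_upwards [Ioo_mem_nhdsGT zero_lt_one] with t ht using ellK_ge ht.1.le ht.2
    · filter_upwards [Ioo_mem_nhdsGT zero_lt_one] with t ht using ellK_le ht.1.le ht.2
  have hE1 : Tendsto (fun t => ellE (1 - t)) (𝓝[>] 0) (𝓝 1) := by
    have : ContinuousAt (fun t => ellE (1 - t)) 0 :=
      (continuous_ellE.comp (continuous_const.sub continuous_id)).continuousAt
    simpa [ellE_one] using this.tendsto.mono_left nhdsWithin_le_nhds
  -- The crude bound K(1-t) ≤ (π/2)/√t is enough against K - E ≤ t K(t); the logarithmic asymptotics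
  -- of K are not needed.
  have hprod : Tendsto (fun t => (ellK t - ellE t) * ellK (1 - t)) (𝓝[>] 0) (𝓝 0) := by
    have h1 : Tendsto (fun t : ℝ => √t * (π / 2) * ellK t) (𝓝[>] 0) (𝓝 0) := by
      have h2 : Tendsto (fun t : ℝ => √t * (π / 2)) (𝓝[>] 0) (𝓝 0) := by
        have : ContinuousAt (fun t : ℝ => √t * (π / 2)) 0 := by fun_prop
        simpa using this.tendsto.mono_left nhdsWithin_le_nhds
      simpa using h2.mul hK0
    refine tendsto_of_tendsto_of_tendsto_of_le_of_le' tendsto_const_nhds h1 ?_ ?_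
    · filter_upwards [Ioo_mem_nhdsGT zero_lt_one] with t ht
      have h3 := ellK_ge (m := 1 - t) (by linarith [ht.2]) (by linarith [ht.1])
      exact mul_nonneg (ellK_sub_ellE ht.1.le ht.2).1 (by linarith [pi_pos])
    · filter_upwards [Ioo_mem_nhdsGT zero_lt_one] with t ht
      have h3 := ellK_ge (m := 1 - t) (by linarith [ht.2]) (by linarith [ht.1])
      have h4 := ellK_le (m := 1 - t) (by linarith [ht.2]) (by linarith [ht.1])
      have h5 := ellK_ge ht.1.le ht.2
      have hs : 0 < √t := sqrt_pos.mpr ht.1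
      calc (ellK t - ellE t) * ellK (1 - t)
          ≤ (t * ellK t) * (π / 2 / √(1 - (1 - t))) :=
            mul_le_mul (ellK_sub_ellE ht.1.le ht.2).2 h4 (by linarith [pi_pos])
              (mul_nonneg ht.1.le (by linarith [pi_pos]))
        _ = √t * (π / 2) * ellK t := by
            rw [sub_sub_cancel]
            have := sq_sqrt ht.1.le
            field_simp
            rw [this, mul_comm]
  have hlim : Tendsto L (𝓝[>] 0) (𝓝 (π / 2)) := by
    have h := (hE1.mul hK0).sub hprod
    simp only [one_mul, sub_zero] at h
    refine h.congr fun t => ?_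
    simp only [hL]; ring
  have hlim' : Tendsto L (𝓝[>] 0) (𝓝 (L m)) := by
    refine tendsto_const_nhds.congr' ?_
    filter_upwards [Ioo_mem_nhdsGT zero_lt_one] with t ht using (hconst t ht).symm
  exact tendsto_nhds_unique hlim' hlim

end
end
end Banana

namespace Banana

/-! ### The periods on the Euclidean axis: Picard–Fuchs equation and Wronskian -/

noncomputable section

section Euclid

open Real

variable {x : ℝ}

theorem rootR_sq (hx : x < 0) : (√(4 - x) * √(16 - x)) ^ 2 = (4 - x) * (16 - x) := by
  rw [mul_pow, sq_sqrt (by linarith), sq_sqrt (by linarith)]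

theorem rootR_gt (hx : x < 0) : 8 < √(4 - x) * √(16 - x) := by
  rw [← sqrt_mul (by linarith)]
  exact lt_sqrt_of_sq_lt (by nlinarith)

theorem yE_mul (hx : x < 0) : yE x * (10 - x + √(4 - x) * √(16 - x)) = 18 := by
  have := rootR_sq hx
  simp only [yE]
  linear_combination (-1 / 2) * this

theorem yE_pos (hx : x < 0) : 0 < yE x := by
  have h1 := yE_mul hx
  have h2 := rootR_gt hx
  by_contra h
  nlinarith

theorem yE_lt_one (hx : x < 0) : yE x < 1 := by
  have h1 := yE_mul hx
  have h2 := rootR_gt hx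
  by_contra h
  nlinarith

/-- `√y` as a real function. -/
def wE (x : ℝ) : ℝ := √(yE x)

theorem wE_sq (hx : x < 0) : wE x ^ 2 = yE x := sq_sqrt (yE_pos hx).le

theorem wE_pos (hx : x < 0) : 0 < wE x := sqrt_pos.mpr (yE_pos hx)

theorem wE_lt_one (hx : x < 0) : wE x < 1 := by
  exact (sqrt_lt' one_pos).mpr (by simpa using yE_lt_one hx)

theorem rootR_eq (hx : x < 0) : √(4 - x) * √(16 - x) = (9 - wE x ^ 4) / wE x ^ 2 := by
  have h1 := yE_mul hx
  have h2 := wE_sq hx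
  have h3 := yE_pos hx
  rw [show wE x ^ 4 = (wE x ^ 2) ^ 2 by ring, h2, eq_div_iff h3.ne']
  have : 10 - x = 2 * yE x + √(4 - x) * √(16 - x) := by simp only [yE]; ring
  rw [this] at h1
  linarith

theorem x_eq_wE (hx : x < 0) : x = -((1 - wE x ^ 2) * (9 - wE x ^ 2)) / wE x ^ 2 := by
  have h1 := rootR_eq hx
  have h2 := wE_sq hx
  have h3 := wE_pos hx
  have : x = 10 - 2 * wE x ^ 2 - √(4 - x) * √(16 - x) := by rw [h2]; simp only [yE]; ring
  rw [h1] at this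
  field_simp at this ⊢
  linarith

theorem hasDerivAt_yE (hx : x < 0) :
    HasDerivAt yE (yE x / (√(4 - x) * √(16 - x))) x := by
  have h4 : 0 < 4 - x := by linarith
  have h16 : 0 < 16 - x := by linarith
  have s4 := sqrt_pos.mpr h4
  have s16 := sqrt_pos.mpr h16
  have key := (((hasDerivAt_id x).const_sub 10).sub ((((hasDerivAt_id x).const_sub 4).sqrt h4.ne').mul
    (((hasDerivAt_id x).const_sub 16).sqrt h16.ne'))).div_const 2
  refine key.congr_deriv ?_
  have e4 := sq_sqrt h4.le
  have e16 := sq_sqrt h16.le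
  simp only [id, yE]
  have hx4 : x = 4 - √(4 - x) ^ 2 := by linarith
  generalize √(4 - x) = a at *
  generalize √(16 - x) = b at *
  field_simp
  linear_combination e4 + e16

theorem hasDerivAt_wE (hx : x < 0) :
    HasDerivAt wE (wE x ^ 3 / (2 * (9 - wE x ^ 4))) x := by
  refine ((hasDerivAt_yE hx).sqrt (yE_pos hx).ne').congr_deriv ?_
  have h := wE_pos hx
  have h1 := wE_lt_one hx
  have h4 : 0 < 9 - wE x ^ 4 := by
    have := pow_le_one₀ (n := 4) h.le h1.le
    linarith
  rw [rootR_eq hx, ← wE_sq hx, sqrt_sq h.le]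
  field_simp

/-- `U₃` as a function of `√y`. -/
def quarticU₃ (w : ℝ) : ℝ := (1 + w) ^ 3 * (3 - w)

theorem U₃_eq (x : ℝ) : U₃ x = quarticU₃ (wE x) := by
  simp [U₃, rootE, quarticU₃, wE]; ring

theorem U₁_eq (x : ℝ) : U₁ x = 16 * wE x := by
  simp [U₁, rootE, wE]; ring

theorem U₂_eq (x : ℝ) : U₂ x = (1 - wE x) ^ 3 * (3 + wE x) := by
  simp [U₂, rootE, wE]; ring

/-- The parameter `k²`. -/
def mE (x : ℝ) : ℝ := 16 * wE x / quarticU₃ (wE x)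

theorem quarticU₃_pos {w : ℝ} (h0 : 0 < w) (h1 : w < 1) : 0 < quarticU₃ w := by
  have : 0 < 3 - w := by linarith
  simp only [quarticU₃]; positivity

theorem one_sub_mE (hx : x < 0) :
    1 - mE x = (1 - wE x) ^ 3 * (3 + wE x) / quarticU₃ (wE x) := by
  have h := quarticU₃_pos (wE_pos hx) (wE_lt_one hx)
  rw [mE, eq_div_iff h.ne', sub_mul, div_mul_cancel₀ _ h.ne', quarticU₃]
  ring

theorem mE_pos (hx : x < 0) : 0 < mE x :=
  div_pos (by linarith [wE_pos hx]) (quarticU₃_pos (wE_pos hx) (wE_lt_one hx))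

theorem mE_lt_one (hx : x < 0) : mE x < 1 := by
  have h := quarticU₃_pos (wE_pos hx) (wE_lt_one hx)
  have h1 : 0 < 1 - wE x := by linarith [wE_lt_one hx]
  have h2 := wE_pos hx
  have : 0 < 1 - mE x := by rw [one_sub_mE hx]; positivity
  linarith

theorem hasDerivAt_quarticU₃ (w : ℝ) : HasDerivAt quarticU₃ (4 * (1 + w) ^ 2 * (2 - w)) w := by
  refine ((((hasDerivAt_id w).const_add 1).pow 3).mul ((hasDerivAt_id w).const_sub 3)).congr_deriv ?_
  simp
  ring

/-- The factor m(1-m) is kept apart because it cancels the denominators in dK/dm and dE/dm. The last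
factor is dw/dx = w/(2R) in terms of w = √y. -/
theorem hasDerivAt_mE (hx : x < 0) :
    HasDerivAt mE (mE x * (1 - mE x) * (3 * (1 + wE x) ^ 2 /
      (wE x * (1 - wE x) * (3 + wE x))) * (wE x ^ 3 / (2 * (9 - wE x ^ 4)))) x := by
  have h := quarticU₃_pos (wE_pos hx) (wE_lt_one hx)
  have hw := hasDerivAt_wE hx
  have key := (hw.const_mul 16).div ((hasDerivAt_quarticU₃ (wE x)).comp x hw) h.ne'
  refine key.congr_deriv ?_
  have h0 := wE_pos hx
  have h1 : 0 < 1 - wE x := by linarith [wE_lt_one hx]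
  have h3 : 0 < 3 - wE x := by linarith
  rw [one_sub_mE hx, mE]
  simp only [Function.comp_apply]
  generalize wE x ^ 3 / (2 * (9 - wE x ^ 4)) = d at *
  have hU : quarticU₃ (wE x) = (1 + wE x) ^ 3 * (3 - wE x) := rfl
  rw [hU]
  field_simp
  ring

/-- `1 / √U₃`. -/
def rhoE (x : ℝ) : ℝ := (√(quarticU₃ (wE x)))⁻¹

theorem rhoE_sq (hx : x < 0) : rhoE x ^ 2 = 1 / quarticU₃ (wE x) := by
  rw [rhoE, inv_pow, sq_sqrt (quarticU₃_pos (wE_pos hx) (wE_lt_one hx)).le, one_div]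

theorem rhoE_pos (hx : x < 0) : 0 < rhoE x :=
  inv_pos.mpr (sqrt_pos.mpr (quarticU₃_pos (wE_pos hx) (wE_lt_one hx)))

theorem hasDerivAt_rhoE (hx : x < 0) :
    HasDerivAt rhoE (rhoE x * (-(2 * (2 - wE x)) / ((1 + wE x) * (3 - wE x))) *
      (wE x ^ 3 / (2 * (9 - wE x ^ 4)))) x := by
  have h := quarticU₃_pos (wE_pos hx) (wE_lt_one hx)
  have hs := sqrt_pos.mpr h
  have key := (((hasDerivAt_quarticU₃ (wE x)).comp x (hasDerivAt_wE hx)).sqrt h.ne').inv hs.ne'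
  refine key.congr_deriv ?_
  have h0 := wE_pos hx
  have h3 : 0 < 3 - wE x := by linarith [wE_lt_one hx]
  simp only [rhoE, Function.comp_apply]
  have hU : √(quarticU₃ (wE x)) ^ 2 = (1 + wE x) ^ 3 * (3 - wE x) := sq_sqrt h.le
  generalize √(quarticU₃ (wE x)) = q at *
  generalize wE x ^ 3 / (2 * (9 - wE x ^ 4)) = d at *
  rw [hU]
  field_simp
  ring

/-- `ψ₁` as a real function. -/
def psiR₁ (x : ℝ) : ℝ := 4 * wE x * rhoE x * ellK (mE x)

/-- `-i ψ₂` as a real function. -/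
def psiR₂ (x : ℝ) : ℝ := 4 * wE x * rhoE x * ellK (1 - mE x)

theorem hasDerivAt_ellK_mE (hx : x < 0) : HasDerivAt (fun x => ellK (mE x))
    ((3 * (1 + wE x) ^ 2 / ((1 - wE x) * (3 + wE x)) * ellE (mE x) - 3 * (1 - wE x) ^ 2 /
      ((1 + wE x) * (3 - wE x)) * ellK (mE x)) / (2 * wE x) *
      (wE x ^ 3 / (2 * (9 - wE x ^ 4)))) x := by
  have h0 := wE_pos hx
  have h1 : 0 < 1 - wE x := by linarith [wE_lt_one hx]
  have h3 : 0 < 3 - wE x := by linarith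
  have hm := mE_pos hx
  have hm1 : 0 < 1 - mE x := by linarith [mE_lt_one hx]
  refine ((hasDerivAt_ellK hm (mE_lt_one hx)).comp x (hasDerivAt_mE hx)).congr_deriv ?_
  have e : (ellE (mE x) - (1 - mE x) * ellK (mE x)) / (2 * mE x * (1 - mE x)) *
      (mE x * (1 - mE x) * (3 * (1 + wE x) ^ 2 / (wE x * (1 - wE x) * (3 + wE x))) *
        (wE x ^ 3 / (2 * (9 - wE x ^ 4)))) = (ellE (mE x) - (1 - mE x) * ellK (mE x)) / 2 *
      (3 * (1 + wE x) ^ 2 / (wE x * (1 - wE x) * (3 + wE x))) *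
        (wE x ^ 3 / (2 * (9 - wE x ^ 4))) := by
    field_simp
  rw [e, one_sub_mE hx, quarticU₃]
  generalize wE x ^ 3 / (2 * (9 - wE x ^ 4)) = d at *
  field_simp

theorem hasDerivAt_ellE_mE (hx : x < 0) : HasDerivAt (fun x => ellE (mE x))
    ((ellE (mE x) - ellK (mE x)) * (3 * (1 - wE x) ^ 2 /
      ((1 + wE x) * (3 - wE x))) / (2 * wE x) * (wE x ^ 3 / (2 * (9 - wE x ^ 4)))) x := by
  have h0 := wE_pos hx
  have h1 : 0 < 1 - wE x := by linarith [wE_lt_one hx]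
  have h3 : 0 < 3 - wE x := by linarith
  have hm := mE_pos hx
  refine ((hasDerivAt_ellE hm (mE_lt_one hx)).comp x (hasDerivAt_mE hx)).congr_deriv ?_
  rw [one_sub_mE hx]
  generalize wE x ^ 3 / (2 * (9 - wE x ^ 4)) = d at *
  generalize mE x = m at *
  rw [quarticU₃]
  field_simp

/-- The derivative of `ψ₁`. -/
def psiR₁' (x : ℝ) : ℝ := rhoE x * (wE x ^ 3 / (9 - wE x ^ 4)) *
  (ellK (mE x) + 3 * (1 + wE x) ^ 2 / ((1 - wE x) * (3 + wE x)) * ellE (mE x))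

theorem nine_sub_pos (hx : x < 0) : 0 < 9 - wE x ^ 4 := by
  have := pow_le_one₀ (n := 4) (wE_pos hx).le (wE_lt_one hx).le
  linarith

theorem hasDerivAt_psiR₁ (hx : x < 0) : HasDerivAt psiR₁ (psiR₁' x) x := by
  have h0 := wE_pos hx
  have h1 : 0 < 1 - wE x := by linarith [wE_lt_one hx]
  have h3 : 0 < 3 - wE x := by linarith
  have h4 := nine_sub_pos hx
  refine ((((hasDerivAt_wE hx).const_mul 4).mul (hasDerivAt_rhoE hx)).mul
    (hasDerivAt_ellK_mE hx)).congr_deriv ?_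
  simp only [psiR₁', Pi.mul_apply]
  field_simp
  ring

/-- The Picard–Fuchs equation solved for ψ₁''. The derivatives of ρ, K and E are combinations of ρ,
K, E over the rational functions of w, so after eliminating x in favour of w it is an identity
linear in K and E. -/
theorem hasDerivAt_psiR₁' (hx : x < 0) : HasDerivAt psiR₁' (-(4 * (2 * x ^ 2 - 30 * x + 64) *
    psiR₁' x + (x - 8) * psiR₁ x) / (4 * x * ((4 - x) * (16 - x)))) x := by
  have h0 := wE_pos hx
  have h1 : 0 < 1 - wE x := by linarith [wE_lt_one hx]
  have h3 : 0 < 3 - wE x := by linarith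
  have h3' : 0 < 3 + wE x := by linarith
  have h4 := nine_sub_pos hx
  have hw := hasDerivAt_wE hx
  have key := ((hasDerivAt_rhoE hx).mul ((hw.pow 3).div ((hw.pow 4).const_sub 9) h4.ne')).mul
    ((hasDerivAt_ellK_mE hx).add (((((hw.const_add 1).pow 2).const_mul 3).div
      ((hw.const_sub 1).mul (hw.const_add 3)) (mul_pos h1 h3').ne').mul (hasDerivAt_ellE_mE hx)))
  refine key.congr_deriv ?_
  have hr : (4 - x) * (16 - x) = ((9 - wE x ^ 4) / wE x ^ 2) ^ 2 := by
    rw [← rootR_eq hx, rootR_sq hx]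
  have hxe := x_eq_wE hx
  have h8 : x - 8 = -(wE x ^ 4 - 2 * wE x ^ 2 + 9) / wE x ^ 2 := by
    field_simp at hxe ⊢
    linarith
  have hq : 2 * x ^ 2 - 30 * x + 64 = 2 * (((1 - wE x ^ 2) * (9 - wE x ^ 2)) / wE x ^ 2) ^ 2 +
      30 * (((1 - wE x ^ 2) * (9 - wE x ^ 2)) / wE x ^ 2) + 64 := by
    have : ∀ v, x = -v → 2 * x ^ 2 - 30 * x + 64 = 2 * v ^ 2 + 30 * v + 64 := by
      intro v hv; rw [hv]; ring
    exact this _ (hxe.trans (neg_div _ _))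
  have hx' : 4 * x * (((9 - wE x ^ 4) / wE x ^ 2) ^ 2) = -(4 * ((1 - wE x ^ 2) * (9 - wE x ^ 2)) *
      (9 - wE x ^ 4) ^ 2) / wE x ^ 6 := by
    nth_rewrite 1 [hxe]
    field_simp
  rw [hr, hx', h8, hq]
  simp only [psiR₁', psiR₁, Pi.mul_apply, Pi.add_apply, Pi.div_apply, Pi.pow_apply]
  have h5 : 0 < 1 - wE x ^ 2 := by nlinarith
  have h6 : 0 < 9 - wE x ^ 2 := by nlinarith
  have e5 : 1 - wE x ^ 2 = (1 - wE x) * (1 + wE x) := by ring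
  have e6 : 9 - wE x ^ 2 = (3 - wE x) * (3 + wE x) := by ring
  rw [e5, e6]
  generalize ellK (mE x) = K at *
  generalize ellE (mE x) = E at *
  generalize rhoE x = ρ at *
  generalize wE x = w at *
  field_simp
  ring

/-- Both periods have the prefactor 4wρ, so its derivative drops out of the Wronskian. What remains
is the Wronskian of K(m) and K(1-m) times dm/dx, and Legendre's relation evaluates it. -/
theorem hasDerivAt_psiR₂ (hx : x < 0) : ∃ d, HasDerivAt psiR₂ d x ∧
    psiR₁ x * d - psiR₂ x * psiR₁' x = 6 * π / (x * (√(4 - x) * √(16 - x))) := by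
  have h0 := wE_pos hx
  have h1 : 0 < 1 - wE x := by linarith [wE_lt_one hx]
  have h3 : 0 < 3 - wE x := by linarith
  have h3' : 0 < 3 + wE x := by linarith
  have h4 := nine_sub_pos hx
  have hm := mE_pos hx
  have hm1 : 0 < 1 - mE x := by linarith [mE_lt_one hx]
  have hK := ((hasDerivAt_ellK hm1 (by linarith)).comp x ((hasDerivAt_mE hx).const_sub 1))
  have hA := ((hasDerivAt_wE hx).const_mul 4).mul (hasDerivAt_rhoE hx)
  refine ⟨_, hA.mul hK, ?_⟩
  have hK₁ := ((hasDerivAt_ellK hm (by linarith)).comp x (hasDerivAt_mE hx))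
  -- The unsimplified product-rule form of ψ₁' is used instead of `psiR₁'`, so that it matches the
  -- derivative of ψ₂ term by term.
  rw [(hasDerivAt_psiR₁ hx).unique (hA.mul hK₁)]
  have hL := legendre_relation hm (mE_lt_one hx)
  have hρ := rhoE_sq hx
  have hxr : x * (√(4 - x) * √(16 - x)) = -((1 - wE x ^ 2) * (9 - wE x ^ 2) * (9 - wE x ^ 4)) /
      wE x ^ 4 := by
    rw [rootR_eq hx]
    nth_rewrite 1 [x_eq_wE hx]
    field_simp
  rw [hxr]
  simp only [psiR₁, psiR₂, Pi.mul_apply, sub_sub_cancel]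
  have e5 : 1 - wE x ^ 2 = (1 - wE x) * (1 + wE x) := by ring
  have e6 : 9 - wE x ^ 2 = (3 - wE x) * (3 + wE x) := by ring
  -- Writing π/2 as the left-hand side of Legendre's relation leaves a polynomial identity in K, E,
  -- K', E' modulo ρ² U₃ = 1.
  rw [e5, e6, show (6 : ℝ) * π = 12 * (π / 2) by ring, ← hL]
  rw [quarticU₃] at hρ
  generalize ellK (1 - mE x) = K' at *
  generalize ellE (1 - mE x) = E' at *
  generalize ellK (mE x) = K at *
  generalize ellE (mE x) = E at *
  generalize mE x = m at *
  generalize rhoE x = ρ at *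
  generalize wE x = w at *
  have e : ρ ^ 2 * ((1 + w) ^ 3 * (3 - w)) = 1 := by
    rw [hρ]; field_simp
  field_simp
  linear_combination (-48 * (E * K' + E' * K - K * K')) * e

end Euclid
end
end Banana

namespace Banana

/-! ### Convergence and derivatives of the iterated integral F₂ -/

noncomputable section

theorem hasDerivAt_integral_Iic {f : ℝ → ℂ} {c x : ℝ} (hx : x < c) (hf : ContinuousOn f (Set.Iio c))
    (hi : ∀ b < c, IntegrableOn f (Set.Iic b)) :
    HasDerivAt (fun u => ∫ t in Set.Iic u, f t) (f x) x := by
  have h1 : HasDerivAt (fun u => ∫ t in x..u, f t) (f x) x :=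
    intervalIntegral.integral_hasDerivAt_right (by simp)
      (hf.stronglyMeasurableAtFilter isOpen_Iio x hx) (hf.continuousAt (Iio_mem_nhds hx))
  refine (h1.const_add (∫ t in Set.Iic x, f t)).congr_of_eventuallyEq ?_
  filter_upwards [Iio_mem_nhds hx] with u hu
  rw [← intervalIntegral.integral_Iic_sub_Iic (hi x hx) (hi u hu)]
  ring

section Decay

variable {b : ℝ}

theorem integrableOn_inv_sq (hb : b < 0) :
    IntegrableOn (fun t : ℝ => ((10 - t) ^ 2)⁻¹) (Set.Iic b) := by
  refine Integrable.mono' (integrable_inv_one_add_sq.integrableOn (s := Set.Iic b))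
    (by fun_prop) ?_
  filter_upwards [ae_restrict_mem measurableSet_Iic] with t ht
  have ht' : t ≤ b := ht
  rw [Real.norm_of_nonneg (by positivity)]
  exact inv_anti₀ (by positivity) (by nlinarith)

theorem integral_inv_sq (hb : b < 0) :
    ∫ t in Set.Iic b, ((10 - t) ^ 2)⁻¹ = (10 - b)⁻¹ := by
  have h := integral_Iic_of_hasDerivAt_of_tendsto' (a := b) (m := 0) (f := fun t : ℝ => (10 - t)⁻¹)
    (f' := fun t : ℝ => ((10 - t) ^ 2)⁻¹) (fun t ht => ?_) (integrableOn_inv_sq hb) ?_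
  · simpa using h
  · have : 10 - t ≠ 0 := by have : t ≤ b := ht; linarith
    refine (((hasDerivAt_id t).const_sub 10).inv this).congr_deriv ?_
    simp
  · exact tendsto_inv_atTop_zero.comp (tendsto_atTop_add_const_left _ 10 tendsto_neg_atBot_atTop)

/-- (10-t)⁻² is the comparison function throughout. Its integral up to b is exactly (10-b)⁻¹, so a
bound on an integrand gives a bound on its integral that can be used in the next integration. -/
theorem integrableOn_of_le_inv_sq {f : ℝ → ℂ} {C : ℝ} (hb : b < 0) (hf : ContinuousOn f (Set.Iio 0))
    (hC : ∀ t ≤ b, ‖f t‖ ≤ C * ((10 - t) ^ 2)⁻¹) : IntegrableOn f (Set.Iic b) := by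
  refine Integrable.mono' ((integrableOn_inv_sq hb).const_mul C)
    ((hf.mono fun t ht => lt_of_le_of_lt ht hb).aestronglyMeasurable measurableSet_Iic) ?_
  filter_upwards [ae_restrict_mem measurableSet_Iic] with t ht using hC t ht

theorem norm_integral_le_inv {f : ℝ → ℂ} {C : ℝ} (hb : b < 0)
    (hC : ∀ t ≤ b, ‖f t‖ ≤ C * ((10 - t) ^ 2)⁻¹) :
    ‖∫ t in Set.Iic b, f t‖ ≤ C * (10 - b)⁻¹ := by
  rw [← integral_inv_sq hb, ← integral_const_mul]
  refine norm_integral_le_of_norm_le ((integrableOn_inv_sq hb).const_mul C) ?_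
  filter_upwards [ae_restrict_mem measurableSet_Iic] with t ht using hC t ht

end Decay

section Euclid

open Real

variable {x : ℝ}

theorem euclid_psi₁_eq (hx : x < 0) : euclid.psi₁ x = psiR₁ x := by
  have h := div_nonneg (mul_nonneg (by norm_num : (0 : ℝ) ≤ 16) (wE_pos hx).le)
    (quarticU₃_pos (wE_pos hx) (wE_lt_one hx)).le
  simp only [Branch.psi₁, euclid]
  rw [ellipticK_eq_ellK, U₁_eq, U₃_eq, sq_sqrt h, ← Complex.ofReal_mul, psiR₁, mE, rhoE, wE]
  congr 1
  ring

theorem euclid_psi₂_eq (hx : x < 0) : euclid.psi₂ x = Complex.I * psiR₂ x := by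
  have h3 := one_sub_mE hx
  have h : 0 ≤ 1 - mE x := by linarith [mE_lt_one hx]
  simp only [Branch.psi₂, euclid]
  rw [ellipticK_eq_ellK, U₂_eq, U₃_eq, ← h3, sq_sqrt h, psiR₂, rhoE, wE]
  push_cast
  ring

theorem psiSun₁_ne_zero (hx : x < 0) : euclid.psiSun₁ x ≠ 0 := by
  have h1 : euclid.psi₁ x ≠ 0 := by
    rw [euclid_psi₁_eq hx]
    have := ellK_ge (mE_pos hx).le (mE_lt_one hx)
    have := wE_pos hx
    have := rhoE_pos hx
    have : 0 < ellK (mE x) := by linarith [pi_pos]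
    have : 0 < psiR₁ x := by rw [psiR₁]; positivity
    exact_mod_cast this.ne'
  intro h
  exact h1 (by rw [Branch.psi₁, h, mul_zero])

theorem hasDerivAt_euclid_psi₁ (hx : x < 0) : HasDerivAt euclid.psi₁ (psiR₁' x) x :=
  (hasDerivAt_psiR₁ hx).ofReal_comp.congr_of_eventuallyEq (by
    filter_upwards [Iio_mem_nhds hx] with t ht using euclid_psi₁_eq ht)

theorem hasDerivAt_deriv_euclid_psi₁ (hx : x < 0) : HasDerivAt (deriv euclid.psi₁)
    (-(4 * (2 * x ^ 2 - 30 * x + 64) *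
    psiR₁' x + (x - 8) * psiR₁ x) / (4 * x * ((4 - x) * (16 - x))) : ℝ) x :=
  (hasDerivAt_psiR₁' hx).ofReal_comp.congr_of_eventuallyEq (by
    filter_upwards [Iio_mem_nhds hx] with t ht using (hasDerivAt_euclid_psi₁ ht).deriv)

theorem differentiableAt_euclid_psi₂ (hx : x < 0) : DifferentiableAt ℝ euclid.psi₂ x := by
  obtain ⟨d, hd, -⟩ := hasDerivAt_psiR₂ hx
  exact ((hd.ofReal_comp.const_mul Complex.I).congr_of_eventuallyEq (by
    filter_upwards [Iio_mem_nhds hx] with t ht using euclid_psi₂_eq ht)).differentiableAt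

theorem euclid_W (hx : x < 0) :
    euclid.W x = Complex.I * (6 * π / (x * (√(4 - x) * √(16 - x))) : ℝ) := by
  obtain ⟨d, hd, hW⟩ := hasDerivAt_psiR₂ hx
  have h2 := ((hd.ofReal_comp.const_mul Complex.I).congr_of_eventuallyEq (f₁ := euclid.psi₂) (by
    filter_upwards [Iio_mem_nhds hx] with t ht using euclid_psi₂_eq ht))
  rw [Branch.W, h2.deriv, (hasDerivAt_euclid_psi₁ hx).deriv, euclid_psi₁_eq hx, euclid_psi₂_eq hx,
    ← hW]
  push_cast
  ring

theorem psiR₁_pos (hx : x < 0) : 0 < psiR₁ x := by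
  have := ellK_ge (mE_pos hx).le (mE_lt_one hx)
  have := wE_pos hx
  have := rhoE_pos hx
  have : 0 < ellK (mE x) := by linarith [pi_pos]
  rw [psiR₁]; positivity

theorem deriv_euclid_tau (hx : x < 0) : deriv euclid.tau x =
    Complex.I * (6 * π / (x * (√(4 - x) * √(16 - x)) * psiR₁ x ^ 2) : ℝ) := by
  have h0 : (psiR₁ x : ℂ) ≠ 0 := by exact_mod_cast (psiR₁_pos hx).ne'
  have e : euclid.tau = euclid.psi₂ / euclid.psi₁ := rfl
  have hW := euclid_W hx
  have key := ((differentiableAt_euclid_psi₂ hx).hasDerivAt.div (hasDerivAt_euclid_psi₁ hx)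
    (by rwa [euclid_psi₁_eq hx])).deriv
  rw [Branch.W, (hasDerivAt_euclid_psi₁ hx).deriv] at hW
  rw [e, key, mul_comm (deriv euclid.psi₂ x), hW, euclid_psi₁_eq hx]
  push_cast
  ring

/-- The integrand `g₆ dτ/dx` is `i` times this real function. -/
def innerDensity (t : ℝ) : ℝ :=
  (t - 8) * (t + 8) ^ 3 * psiR₁ t ^ 4 / (144 * π ^ 5 * ((4 - t) * (16 - t)) ^ 2)

theorem g₆_mul_deriv_tau (hx : x < 0) :
    euclid.g₆ x * deriv euclid.tau x = Complex.I * innerDensity x := by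
  have hr : (0 : ℝ) < √(4 - x) * √(16 - x) := by linarith [rootR_gt hx]
  have hp := psiR₁_pos hx
  have hroot : euclid.root x = ((√(4 - x) * √(16 - x) : ℝ) : ℂ) := rfl
  have e : euclid.g₆ x = ((x * (x - 8) * (x + 8) ^ 3 / (864 * (√(4 - x) * √(16 - x)) ^ 3) *
      (psiR₁ x / π) ^ 6 : ℝ) : ℂ) := by
    simp only [Branch.g₆]
    rw [hroot, euclid_psi₁_eq hx]
    push_cast
    rfl
  have key : x * (x - 8) * (x + 8) ^ 3 / (864 * (√(4 - x) * √(16 - x)) ^ 3) *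
      (psiR₁ x / π) ^ 6 * (6 * π / (x * (√(4 - x) * √(16 - x)) * psiR₁ x ^ 2)) =
      innerDensity x := by
    rw [innerDensity, ← rootR_sq hx]
    generalize √(4 - x) * √(16 - x) = r at *
    have hx0 := hx.ne
    field_simp
    ring
  rw [e, deriv_euclid_tau hx, ← key]
  push_cast
  ring

theorem continuousOn_psiR₁ : ContinuousOn psiR₁ (Set.Iio 0) := fun _ hx =>
  (hasDerivAt_psiR₁ hx).continuousAt.continuousWithinAt

theorem rootR_le (hx : x < 0) : √(4 - x) * √(16 - x) ≤ 10 - x := by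
  rw [← sqrt_mul (by linarith)]
  exact sqrt_le_iff.mpr ⟨by linarith, by nlinarith⟩

theorem yE_bounds (hx : x < 0) : 9 / (10 - x) ≤ yE x ∧ yE x ≤ 18 / (10 - x) := by
  have h1 := yE_mul hx
  have h2 := rootR_le hx
  have h3 := rootR_gt hx
  have h4 := yE_pos hx
  constructor
  · rw [div_le_iff₀ (by linarith)]; nlinarith
  · rw [le_div_iff₀ (by linarith)]; nlinarith

/-- y = 18/(10 - x + R), and the denominator grows as x decreases. -/
theorem wE_mono {b t : ℝ} (hb : b < 0) (ht : t ≤ b) : wE t ≤ wE b := by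
  refine sqrt_le_sqrt ?_
  have h1 := yE_mul hb
  have h2 := yE_mul (lt_of_le_of_lt ht hb)
  have h4 : √(4 - b) ≤ √(4 - t) := sqrt_le_sqrt (by linarith)
  have h16 : √(16 - b) ≤ √(16 - t) := sqrt_le_sqrt (by linarith)
  have h5 := mul_le_mul h4 h16 (sqrt_nonneg _) (sqrt_nonneg _)
  have h6 := rootR_gt hb
  have h7 := yE_pos hb
  by_contra hlt
  push Not at hlt
  have h8 : yE b * (10 - b + √(4 - b) * √(16 - b)) <
      yE t * (10 - t + √(4 - t) * √(16 - t)) :=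
    mul_lt_mul hlt (by linarith) (by linarith) (by linarith)
  linarith

theorem psiR₁_sq (hx : x < 0) :
    psiR₁ x ^ 2 = 16 * yE x * ellK (mE x) ^ 2 / quarticU₃ (wE x) := by
  rw [psiR₁, mul_pow, mul_pow, mul_pow, rhoE_sq hx, wE_sq hx]
  ring

/-- Combines y ≥ 9/(10-x), K ≥ π/2 and U₃ ≤ 2³·3 = 24. A lower bound on ψ₁² is what bounds dτ/dx
from above. -/
theorem psiR₁_sq_ge (hx : x < 0) : π ^ 2 / (10 - x) ≤ psiR₁ x ^ 2 := by
  have h0 := wE_pos hx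
  have h1 := wE_lt_one hx
  have hU := quarticU₃_pos h0 h1
  have hU' : quarticU₃ (wE x) ≤ 24 := by
    have : (1 + wE x) ^ 3 ≤ 2 ^ 3 := pow_le_pow_left₀ (by linarith) (by linarith) 3
    rw [quarticU₃]
    nlinarith
  have hK : (π / 2) ^ 2 ≤ ellK (mE x) ^ 2 :=
    pow_le_pow_left₀ (by positivity) (ellK_ge (mE_pos hx).le (mE_lt_one hx)) 2
  have hy := (yE_bounds hx).1
  have hy0 := yE_pos hx
  have h10 : 0 < 10 - x := by linarith
  rw [psiR₁_sq hx, le_div_iff₀ hU]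
  calc π ^ 2 / (10 - x) * quarticU₃ (wE x) ≤ π ^ 2 / (10 - x) * 24 := by gcongr
    _ ≤ 16 * (9 / (10 - x)) * (π / 2) ^ 2 := by
        have h1 : 0 ≤ π ^ 2 / (10 - x) := by positivity
        have h2 : 16 * (9 / (10 - x)) * (π / 2) ^ 2 = 36 * (π ^ 2 / (10 - x)) := by ring
        linarith
    _ ≤ 16 * yE x * ellK (mE x) ^ 2 := by gcongr

theorem exists_psiR₁_sq_le {b : ℝ} (hb : b < 0) :
    ∃ C, 0 ≤ C ∧ ∀ t ≤ b, psiR₁ t ^ 2 ≤ C / (10 - t) := by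
  have hw1 := wE_lt_one hb
  refine ⟨16 * 18 * (π / 2 / √((1 - wE b) ^ 3 / 8)) ^ 2, by positivity, fun t ht => ?_⟩
  have ht0 : t < 0 := lt_of_le_of_lt ht hb
  have h0 := wE_pos ht0
  have h1 := wE_lt_one ht0
  have hU := quarticU₃_pos h0 h1
  have hU1 : 1 ≤ quarticU₃ (wE t) := by
    have : 1 ≤ (1 + wE t) ^ 3 := one_le_pow₀ (by linarith)
    rw [quarticU₃]
    nlinarith
  have hU' : quarticU₃ (wE t) ≤ 24 := by
    have : (1 + wE t) ^ 3 ≤ 2 ^ 3 := pow_le_pow_left₀ (by linarith) (by linarith) 3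
    rw [quarticU₃]
    nlinarith
  -- 1 - m = (1-w)³(3+w)/U₃ with 3 + w ≥ 3 and U₃ ≤ 24, and w ≤ w(b). So m stays away from 1 on (-∞,
  -- b], and K is bounded there.
  have hm : (1 - wE b) ^ 3 / 8 ≤ 1 - mE t := by
    rw [one_sub_mE ht0, le_div_iff₀ hU]
    have h2 : (1 - wE b) ^ 3 ≤ (1 - wE t) ^ 3 :=
      pow_le_pow_left₀ (by linarith) (by linarith [wE_mono hb ht]) 3
    have h3 : 0 ≤ (1 - wE b) ^ 3 := pow_nonneg (by linarith) 3
    nlinarith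
  have hpos : 0 < (1 - wE b) ^ 3 / 8 := by
    have : 0 < 1 - wE b := by linarith
    positivity
  have hK : ellK (mE t) ≤ π / 2 / √((1 - wE b) ^ 3 / 8) :=
    (ellK_le (mE_pos ht0).le (mE_lt_one ht0)).trans
      (div_le_div_of_nonneg_left (by positivity) (sqrt_pos.mpr hpos) (sqrt_le_sqrt hm))
  have hK0 : 0 ≤ ellK (mE t) := by
    linarith [ellK_ge (mE_pos ht0).le (mE_lt_one ht0), pi_pos]
  have hy := (yE_bounds ht0).2
  have hy0 := yE_pos ht0
  have h10 : 0 < 10 - t := by linarith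
  rw [psiR₁_sq ht0]
  calc 16 * yE t * ellK (mE t) ^ 2 / quarticU₃ (wE t) ≤ 16 * yE t * ellK (mE t) ^ 2 :=
        div_le_self (by positivity) hU1
    _ ≤ 16 * (18 / (10 - t)) * (π / 2 / √((1 - wE b) ^ 3 / 8)) ^ 2 := by gcongr
    _ = _ := by ring

theorem exists_innerDensity_le {b : ℝ} (hb : b < 0) :
    ∃ C, 0 ≤ C ∧ ∀ t ≤ b, |innerDensity t| ≤ C * ((10 - t) ^ 2)⁻¹ := by
  obtain ⟨C, hC0, hC⟩ := exists_psiR₁_sq_le hb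
  refine ⟨C ^ 2 * 7 / (144 * π ^ 5), by positivity, fun t ht => ?_⟩
  have ht0 : t < 0 := lt_of_le_of_lt ht hb
  have h10 : 0 < 10 - t := by linarith
  have h1 : |(t - 8) * (t + 8) ^ 3| ≤ (10 - t) ^ 4 := by
    rw [abs_mul, abs_pow, show (10 - t) ^ 4 = (10 - t) * (10 - t) ^ 3 by ring]
    gcongr
    · exact abs_le.mpr ⟨by linarith, by linarith⟩
    · exact abs_le.mpr ⟨by linarith, by linarith⟩
  -- Here (10-t)² = R² + 36 with R² ≥ 64, so (10-t)² ≤ (5/2) R², and (5/2)² ≤ 7.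
  have h2 : (10 - t) ^ 4 ≤ 7 * ((4 - t) * (16 - t)) ^ 2 := by
    have h : (10 - t) ^ 2 * 2 ≤ 5 * ((4 - t) * (16 - t)) := by nlinarith
    nlinarith [sq_nonneg (10 - t)]
  have h3 : psiR₁ t ^ 4 ≤ C ^ 2 * ((10 - t) ^ 2)⁻¹ := by
    have := pow_le_pow_left₀ (sq_nonneg _) (hC t ht) 2
    rw [div_pow] at this
    rw [← div_eq_mul_inv]
    calc psiR₁ t ^ 4 = (psiR₁ t ^ 2) ^ 2 := by ring
      _ ≤ _ := this
  have h4 : 0 < ((4 - t) * (16 - t)) ^ 2 := by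
    have : 0 < 4 - t := by linarith
    have : 0 < 16 - t := by linarith
    positivity
  rw [innerDensity, abs_div, abs_mul, abs_of_nonneg (by positivity : 0 ≤ psiR₁ t ^ 4),
    abs_of_pos (by positivity : 0 < 144 * π ^ 5 * ((4 - t) * (16 - t)) ^ 2),
    div_le_iff₀ (by positivity)]
  calc |(t - 8) * (t + 8) ^ 3| * psiR₁ t ^ 4
      ≤ (7 * ((4 - t) * (16 - t)) ^ 2) * (C ^ 2 * ((10 - t) ^ 2)⁻¹) :=
        mul_le_mul (h1.trans h2) h3 (by positivity) (by positivity)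
    _ = _ := by field_simp

/-- |dτ/dx| = 6π/(|x| R ψ₁²), where |x| and R are at least of order 10 - x and ψ₁² at least of order
1/(10-x). The constant degenerates as b → 0 because of the factor 1/|x|. -/
theorem exists_deriv_tau_le {b : ℝ} (hb : b < 0) :
    ∃ C, 0 ≤ C ∧ ∀ t ≤ b, ‖deriv euclid.tau t‖ ≤ C * (10 - t)⁻¹ := by
  refine ⟨12 / π * ((10 - b) / (-b)), ?_, fun t ht => ?_⟩
  · have : 0 < -b := by linarith
    have : 0 < 10 - b := by linarith
    positivity
  · have ht0 : t < 0 := lt_of_le_of_lt ht hb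
    have h10 : 0 < 10 - t := by linarith
    have hp := psiR₁_sq_ge ht0
    have hr : (10 - t) / 2 ≤ √(4 - t) * √(16 - t) := by
      rw [← sqrt_mul (by linarith)]
      exact le_sqrt_of_sq_le (by nlinarith)
    have hb0 : 0 < -b := by linarith
    have htb : (-b) / (10 - b) * (10 - t) ≤ -t := by
      rw [div_mul_eq_mul_div, div_le_iff₀ (by linarith)]
      nlinarith
    rw [deriv_euclid_tau ht0, norm_mul, Complex.norm_I, one_mul, Complex.norm_real,
      norm_eq_abs, abs_div, abs_of_pos (by positivity : 0 < 6 * π), abs_mul, abs_mul,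
      abs_of_nonneg (by positivity : 0 ≤ √(4 - t) * √(16 - t)), abs_of_nonneg (sq_nonneg (psiR₁ t)),
      abs_of_neg ht0]
    have h10b : 0 < 10 - b := by linarith
    have hnt : 0 < -t := by linarith
    have hden : (-b) / (10 - b) * (10 - t) * ((10 - t) / 2) * (π ^ 2 / (10 - t)) ≤
        -t * (√(4 - t) * √(16 - t)) * psiR₁ t ^ 2 := by
      gcongr
    refine (div_le_div_of_nonneg_left (by positivity) (by positivity) hden).trans (le_of_eq ?_)
    field_simp
    norm_num

theorem continuousOn_deriv_tau : ContinuousOn (deriv euclid.tau) (Set.Iio 0) := by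
  have h : ContinuousOn (fun x : ℝ => Complex.I * ((6 * π / (x * (√(4 - x) * √(16 - x)) *
      psiR₁ x ^ 2) : ℝ) : ℂ)) (Set.Iio 0) := by
    refine continuousOn_const.mul (Complex.continuous_ofReal.comp_continuousOn ?_)
    refine continuousOn_const.div ((Continuous.continuousOn (by fun_prop)).mul
      (continuousOn_psiR₁.pow 2)) fun x hx => ?_
    have := rootR_gt hx
    exact mul_ne_zero (mul_ne_zero (ne_of_lt hx) (by linarith)) (pow_ne_zero 2 (psiR₁_pos hx).ne')
  exact h.congr fun x hx => deriv_euclid_tau hx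

/-- The decay of the inner integral is recorded with its derivative, because the outer integral
converges only through it: dτ/dx alone is merely bounded by a multiple of 1/(10-x). -/
theorem hasDerivAt_inner (hx : x < 0) : HasDerivAt (iteratedIntegral [euclid.g₆])
    (2 * π * Complex.I * (Complex.I * innerDensity x)) x ∧
    ∀ b < 0, ∃ C, 0 ≤ C ∧ ∀ t ≤ b, ‖iteratedIntegral [euclid.g₆] t‖ ≤ C * (10 - t)⁻¹ := by
  have hf : ∀ t < 0, euclid.g₆ t * iteratedIntegral [] t * deriv euclid.tau t =
      Complex.I * innerDensity t := fun t ht => by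
    rw [iteratedIntegral, mul_one, g₆_mul_deriv_tau ht]
  have hc : ContinuousOn (fun t => euclid.g₆ t * iteratedIntegral [] t * deriv euclid.tau t)
      (Set.Iio 0) := by
    have h : ContinuousOn (fun t => Complex.I * (innerDensity t : ℂ)) (Set.Iio 0) := by
      refine continuousOn_const.mul (Complex.continuous_ofReal.comp_continuousOn ?_)
      refine (((Continuous.continuousOn (by fun_prop)).mul (continuousOn_psiR₁.pow 4))).div
        (Continuous.continuousOn (by fun_prop)) fun t ht => ?_
      have ht' : t < 0 := ht
      have h4 : 4 - t ≠ 0 := by linarith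
      have h16 : 16 - t ≠ 0 := by linarith
      have := pi_ne_zero
      positivity
    exact h.congr fun t ht => hf t ht
  have hbd : ∀ b < 0, ∃ C, 0 ≤ C ∧ ∀ t ≤ b,
      ‖euclid.g₆ t * iteratedIntegral [] t * deriv euclid.tau t‖ ≤ C * ((10 - t) ^ 2)⁻¹ := by
    intro b hb
    obtain ⟨C, hC0, hC⟩ := exists_innerDensity_le hb
    refine ⟨C, hC0, fun t ht => ?_⟩
    rw [hf t (lt_of_le_of_lt ht hb), norm_mul, Complex.norm_I, one_mul, Complex.norm_real]
    exact hC t ht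
  constructor
  · have h := (hasDerivAt_integral_Iic hx hc fun b hb => by
      obtain ⟨C, -, hC⟩ := hbd b hb
      exact integrableOn_of_le_inv_sq hb hc hC).const_mul (2 * π * Complex.I)
    rw [hf x hx] at h
    exact h
  · intro b hb
    obtain ⟨C, hC0, hC⟩ := hbd b hb
    refine ⟨2 * π * C, by positivity, fun t ht => ?_⟩
    have ht0 : t < 0 := lt_of_le_of_lt ht hb
    have h := norm_integral_le_inv ht0 fun s hs => hC s (hs.trans ht)
    have e : ‖(2 * π * Complex.I : ℂ)‖ = 2 * π := by simp [abs_of_pos pi_pos]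
    rw [iteratedIntegral, norm_mul, e, mul_assoc (2 * π)]
    gcongr

theorem hasDerivAt_euclidF₂ (hx : x < 0) : HasDerivAt euclidF₂
    (2 * π * Complex.I * (iteratedIntegral [euclid.g₆] x * deriv euclid.tau x)) x := by
  have hc : ContinuousOn (fun t => (fun _ => (1 : ℂ)) t * iteratedIntegral [euclid.g₆] t *
      deriv euclid.tau t) (Set.Iio 0) :=
    (continuousOn_const.mul fun t ht =>
      (hasDerivAt_inner ht).1.continuousAt.continuousWithinAt).mul continuousOn_deriv_tau
  have h := (hasDerivAt_integral_Iic hx hc fun b hb => by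
    obtain ⟨C, hC0, hC⟩ := (hasDerivAt_inner hb).2 b hb
    obtain ⟨C', hC0', hC'⟩ := exists_deriv_tau_le hb
    refine integrableOn_of_le_inv_sq (C := C * C') hb hc fun t ht => ?_
    have ht0 : t < 0 := lt_of_le_of_lt ht hb
    have h10 : 0 < 10 - t := by linarith
    rw [norm_mul, one_mul]
    calc _ ≤ (C * (10 - t)⁻¹) * (C' * (10 - t)⁻¹) :=
          mul_le_mul (hC t ht) (hC' t ht) (norm_nonneg _) (by positivity)
      _ = _ := by rw [← inv_pow]; ring).const_mul (2 * π * Complex.I)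
  rw [one_mul] at h
  exact h

theorem euclid_regularOn : euclid.RegularOn euclidF₂ (Set.Iio 0) := by
  have hroot : ∀ x : ℝ, euclid.root x = ((√(4 - x) * √(16 - x) : ℝ) : ℂ) := fun _ => rfl
  have hF : ∀ x < 0, deriv euclidF₂ x =
      2 * π * Complex.I * (iteratedIntegral [euclid.g₆] x * deriv euclid.tau x) :=
    fun x hx => (hasDerivAt_euclidF₂ hx).deriv
  -- dF₂/dx contains the factor dτ/dx, so the second derivative of F₂ needs τ to be twice
  -- differentiable.
  have hτ : ∀ x < 0, HasDerivAt (deriv euclid.tau) (deriv (deriv euclid.tau) x) x := fun x hx => by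
    refine DifferentiableAt.hasDerivAt ?_
    have h4 : 4 - x ≠ 0 := by linarith
    have h16 : 16 - x ≠ 0 := by linarith
    have hd : DifferentiableAt ℝ (fun x => 6 * π / (x * (√(4 - x) * √(16 - x)) * psiR₁ x ^ 2)) x := by
      have := rootR_gt hx
      have h1 : DifferentiableAt ℝ (fun x => √(4 - x)) x :=
        ((differentiableAt_id.const_sub 4).sqrt h4)
      have h2 : DifferentiableAt ℝ (fun x => √(16 - x)) x :=
        ((differentiableAt_id.const_sub 16).sqrt h16)
      exact (differentiableAt_const _).div ((differentiableAt_id.mul (h1.mul h2)).mul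
        ((hasDerivAt_psiR₁ hx).differentiableAt.pow 2))
        (mul_ne_zero (mul_ne_zero (ne_of_lt hx) (by linarith)) (pow_ne_zero 2 (psiR₁_pos hx).ne'))
    exact ((hd.hasDerivAt.ofReal_comp.const_mul Complex.I).congr_of_eventuallyEq (by
      filter_upwards [Iio_mem_nhds hx] with t ht using deriv_euclid_tau ht)).differentiableAt
  refine ⟨isOpen_Iio, fun x hx => ?_, fun x hx => ?_, fun x hx => ?_, fun x hx => psiSun₁_ne_zero hx,
    fun x hx => ?_, fun x hx => ?_, fun x hx => ?_,
    fun x hx => (hasDerivAt_euclid_psi₁ hx).differentiableAt.differentiableWithinAt,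
    fun x hx => (differentiableAt_euclid_psi₂ hx).differentiableWithinAt,
    fun x hx => (hasDerivAt_deriv_euclid_psi₁ hx).differentiableAt.differentiableWithinAt,
    fun x hx => (hasDerivAt_euclidF₂ hx).differentiableAt.differentiableWithinAt,
    fun x hx => ?_, fun x hx => ?_, fun x hx => ?_, fun x hx => ?_⟩
  all_goals have hx' : x < 0 := hx
  · simpa using hx'.ne
  · have : (4 - x : ℝ) ≠ 0 := by linarith
    simpa using (by exact_mod_cast this : (4 - x : ℂ) ≠ 0)
  · have : (16 - x : ℝ) ≠ 0 := by linarith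
    simpa using (by exact_mod_cast this : (16 - x : ℂ) ≠ 0)
  · rw [hroot, ← Complex.ofReal_pow, rootR_sq hx']
    push_cast
    rfl
  · rw [Branch.y, hroot]
    have h := wE_sq hx'
    have e : euclid.sqrtY x = (wE x : ℂ) := rfl
    rw [e, ← Complex.ofReal_pow, h, yE]
    push_cast
    rfl
  · have h4 : 4 - x ≠ 0 := by linarith
    have h16 : 16 - x ≠ 0 := by linarith
    have h1 : DifferentiableAt ℝ (fun x => √(4 - x)) x :=
      ((differentiableAt_id.const_sub 4).sqrt h4)
    have h2 : DifferentiableAt ℝ (fun x => √(16 - x)) x :=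
      ((differentiableAt_id.const_sub 16).sqrt h16)
    exact (h1.mul h2).hasDerivAt.ofReal_comp.differentiableAt.differentiableWithinAt
  · have h : DifferentiableAt ℝ (fun x => 2 * π * Complex.I *
        (iteratedIntegral [euclid.g₆] x * deriv euclid.tau x)) x :=
      (((hasDerivAt_inner hx').1.mul (hτ x hx')).const_mul _).differentiableAt
    exact (h.congr_of_eventuallyEq (by
      filter_upwards [Iio_mem_nhds hx'] with t ht using hF t ht)).differentiableWithinAt
  · have h4 : (√(4 - x) : ℂ) ≠ 0 := by exact_mod_cast (sqrt_pos.mpr (by linarith)).ne'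
    have h16 : (√(16 - x) : ℂ) ≠ 0 := by exact_mod_cast (sqrt_pos.mpr (by linarith)).ne'
    have hx0 : (x : ℂ) ≠ 0 := by exact_mod_cast hx'.ne
    rw [euclid_W hx', hroot, Complex.coe_algebraMap]
    push_cast
    field_simp
  · have h4 : (4 : ℂ) - x ≠ 0 := by
      have : (4 - x : ℝ) ≠ 0 := by linarith
      exact_mod_cast this
    have h16 : (16 : ℂ) - x ≠ 0 := by
      have : (16 - x : ℝ) ≠ 0 := by linarith
      exact_mod_cast this
    have hx0 : (x : ℂ) ≠ 0 := by exact_mod_cast hx'.ne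
    simp only
    rw [(hasDerivAt_deriv_euclid_psi₁ hx').deriv, (hasDerivAt_euclid_psi₁ hx').deriv,
      euclid_psi₁_eq hx', Complex.coe_algebraMap]
    push_cast
    field_simp
    ring
  · have h4 : (4 : ℂ) - x ≠ 0 := by
      have : (4 - x : ℝ) ≠ 0 := by linarith
      exact_mod_cast this
    have h16 : (16 : ℂ) - x ≠ 0 := by
      have : (16 - x : ℝ) ≠ 0 := by linarith
      exact_mod_cast this
    have hpi : (π : ℂ) ≠ 0 := by exact_mod_cast pi_ne_zero
    -- x R ψ₁² dτ/dx = 6πi is constant, so this function is -12π² times the inner integral I(g₆; τ).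
    have hd : HasDerivAt (fun t => algebraMap ℝ ℂ t * euclid.root t * euclid.psi₁ t ^ 2 *
        deriv euclidF₂ t) (-12 * π ^ 2 * (2 * π * Complex.I * (Complex.I * innerDensity x))) x := by
      refine ((hasDerivAt_inner hx').1.const_mul (-12 * π ^ 2 : ℂ)).congr_of_eventuallyEq ?_
      filter_upwards [Iio_mem_nhds hx'] with t ht
      have ht' : t < 0 := ht
      have h4 : (√(4 - t) : ℂ) ≠ 0 := by exact_mod_cast (sqrt_pos.mpr (by linarith)).ne'
      have h16 : (√(16 - t) : ℂ) ≠ 0 := by exact_mod_cast (sqrt_pos.mpr (by linarith)).ne'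
      have ht0 : (t : ℂ) ≠ 0 := by exact_mod_cast ht'.ne
      have hψ : (psiR₁ t : ℂ) ≠ 0 := by exact_mod_cast (psiR₁_pos ht').ne'
      rw [hF t ht', deriv_euclid_tau ht', hroot, euclid_psi₁_eq ht', Complex.coe_algebraMap]
      push_cast
      field_simp
      rw [Complex.I_sq]
      ring
    simp only
    rw [hd.deriv, euclid_psi₁_eq hx', Complex.coe_algebraMap, innerDensity]
    push_cast
    field_simp
    rw [Complex.I_sq]
    ring

end Euclid
end
end Banana

namespace Banana

noncomputable section

/-! ### Schwinger parameters -/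

/-- The region of integration of the Schwinger parameters. -/
def orthant (n : ℕ) : Set (Fin n → ℝ) := Set.univ.pi fun _ => Set.Ioi 0

theorem mem_orthant {n : ℕ} {a : Fin n → ℝ} : a ∈ orthant n ↔ ∀ i, 0 < a i := by
  simp [orthant]

theorem measurableSet_orthant (n : ℕ) : MeasurableSet (orthant n) :=
  MeasurableSet.univ_pi fun _ => measurableSet_Ioi

/-- The first Symanzik polynomial. -/
def symU (a : Fin 4 → ℝ) : ℝ := symanzikU (a 0) (a 1) (a 2) (a 3)

/-- The coefficient of `x` in the exponent of the Schwinger representation. -/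
def symV (a : Fin 4 → ℝ) : ℝ := a 0 * a 1 * a 2 * a 3 / symU a

/-- The sum of the Schwinger parameters. -/
def symS (a : Fin 4 → ℝ) : ℝ := a 0 + a 1 + a 2 + a 3

@[fun_prop]
theorem continuous_symU : Continuous symU := by unfold symU symanzikU; fun_prop

@[fun_prop]
theorem continuous_symS : Continuous symS := by unfold symS; fun_prop

@[fun_prop]
theorem measurable_symU : Measurable symU := continuous_symU.measurable

@[fun_prop]
theorem measurable_symS : Measurable symS := continuous_symS.measurable

@[fun_prop]
theorem measurable_symV : Measurable symV := by unfold symV; fun_prop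

section Bounds

variable {a : Fin 4 → ℝ}

theorem symU_pos (ha : a ∈ orthant 4) : 0 < symU a := by
  rw [mem_orthant] at ha
  have := ha 0; have := ha 1; have := ha 2; have := ha 3
  unfold symU symanzikU; positivity

theorem symV_pos (ha : a ∈ orthant 4) : 0 < symV a := by
  have := symU_pos ha
  rw [mem_orthant] at ha
  have := ha 0; have := ha 1; have := ha 2; have := ha 3
  unfold symV; positivity

theorem symS_pos (ha : a ∈ orthant 4) : 0 < symS a := by
  rw [mem_orthant] at ha
  have := ha 0; have := ha 1; have := ha 2; have := ha 3
  unfold symS; positivity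

/-- 1/V is the sum of the 1/a_i, so V is smaller than every a_i. Factors of V therefore cost only
polynomial growth. -/
theorem symV_le_symS (ha : a ∈ orthant 4) : symV a ≤ symS a := by
  have hU := symU_pos ha
  rw [mem_orthant] at ha
  have := ha 0; have := ha 1; have := ha 2; have := ha 3
  rw [symV, div_le_iff₀ hU, symU, symanzikU, symS]
  have h1 : 0 < a 0 * a 1 * a 2 := by positivity
  have h2 : 0 < a 0 * a 1 * a 3 := by positivity
  have h3 : 0 < a 0 * a 2 * a 3 := by positivity
  have h4 : 0 < a 1 * a 2 * a 3 := by positivity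
  nlinarith [mul_pos (ha 0) h1, mul_pos (ha 0) h2, mul_pos (ha 0) h3, mul_pos (ha 0) h4,
    mul_pos (ha 1) h1, mul_pos (ha 1) h2, mul_pos (ha 1) h3, mul_pos (ha 1) h4,
    mul_pos (ha 2) h1, mul_pos (ha 2) h2, mul_pos (ha 2) h3, mul_pos (ha 2) h4,
    mul_pos (ha 3) h1, mul_pos (ha 3) h2, mul_pos (ha 3) h3, mul_pos (ha 3) h4]

/-- The left-hand side is the product of the four monomials of U, each of which is at most U. -/
theorem prod_pow_le_symU_pow (ha : a ∈ orthant 4) :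
    (a 0 * a 1 * a 2 * a 3) ^ 3 ≤ symU a ^ 4 := by
  rw [mem_orthant] at ha
  have := ha 0; have := ha 1; have := ha 2; have := ha 3
  have h1 : 0 < a 0 * a 1 * a 2 := by positivity
  have h2 : 0 < a 0 * a 1 * a 3 := by positivity
  have h3 : 0 < a 0 * a 2 * a 3 := by positivity
  have h4 : 0 < a 1 * a 2 * a 3 := by positivity
  have e : (a 0 * a 1 * a 2 * a 3) ^ 3 =
      (a 0 * a 1 * a 2) * (a 0 * a 1 * a 3) * (a 0 * a 2 * a 3) * (a 1 * a 2 * a 3) := by ring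
  have e' : symU a ^ 4 = symU a * symU a * symU a * symU a := by ring
  have hU : symU a = a 0 * a 1 * a 2 + a 0 * a 1 * a 3 + a 0 * a 2 * a 3 + a 1 * a 2 * a 3 := rfl
  have hU0 : 0 < symU a := by rw [hU]; positivity
  rw [e, e']
  gcongr <;> linarith

theorem symU_le (ha : a ∈ orthant 4) : symU a ≤ (1 + symS a) ^ 3 := by
  rw [mem_orthant] at ha
  have h0 := ha 0; have h1 := ha 1; have h2 := ha 2; have h3 := ha 3
  have : (a 0 + a 1 + a 2 + a 3) ^ 3 ≤ (1 + symS a) ^ 3 := by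
    exact pow_le_pow_left₀ (by positivity) (by unfold symS; linarith) 3
  refine le_trans ?_ this
  rw [symU, symanzikU, ← sub_nonneg]
  ring_nf
  positivity

/-- One bound for both signs of p: for p ≥ 0 the `min` vanishes and U ≤ (1+S)³ is used; for p ≤ 0
the natural ceiling vanishes and U is bounded below by the power 3/4 of the product. -/
theorem symU_rpow_le (ha : a ∈ orthant 4) (p : ℝ) :
    symU a ^ p ≤ (1 + symS a) ^ (3 * ⌈p⌉₊) * (a 0 * a 1 * a 2 * a 3) ^ (min (3 / 4 * p) 0) := by
  have hU := symU_pos ha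
  have hS := symS_pos ha
  have hP : 0 < a 0 * a 1 * a 2 * a 3 := by
    rw [mem_orthant] at ha
    have := ha 0; have := ha 1; have := ha 2; have := ha 3
    positivity
  rcases le_total 0 p with hp | hp
  · rw [min_eq_right (by linarith), Real.rpow_zero, mul_one]
    calc symU a ^ p ≤ ((1 + symS a) ^ 3) ^ p := Real.rpow_le_rpow hU.le (symU_le ha) hp
      _ ≤ ((1 + symS a) ^ 3) ^ (⌈p⌉₊ : ℝ) :=
        Real.rpow_le_rpow_of_exponent_le (one_le_pow₀ (by linarith)) (Nat.le_ceil p)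
      _ = _ := by rw [Real.rpow_natCast, ← pow_mul]
  · rw [min_eq_left (by linarith), Nat.ceil_eq_zero.2 hp, mul_zero, pow_zero, one_mul]
    have h := Real.rpow_le_rpow_of_nonpos (pow_pos hP 3) (prod_pow_le_symU_pow ha)
      (show p / 4 ≤ 0 by linarith)
    rw [← Real.rpow_natCast, ← Real.rpow_natCast, ← Real.rpow_mul hU.le, ← Real.rpow_mul hP.le] at h
    convert h using 2 <;> push_cast <;> ring

end Bounds

theorem one_add_pow_mul_exp_neg_le (k : ℕ) {s : ℝ} (hs : 0 ≤ s) :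
    (1 + s) ^ k * Real.exp (-s) ≤
      2 ^ k * k.factorial * Real.exp (1 / 2) * Real.exp (-(1 / 2 * s)) := by
  have h := Real.pow_div_factorial_le_exp ((1 + s) / 2) (by positivity) k
  rw [div_le_iff₀ (by positivity), div_pow, div_le_iff₀ (by positivity)] at h
  calc (1 + s) ^ k * Real.exp (-s)
      ≤ Real.exp ((1 + s) / 2) * k.factorial * 2 ^ k * Real.exp (-s) := by gcongr
    _ = 2 ^ k * k.factorial * (Real.exp ((1 + s) / 2) * Real.exp (-s)) := by ring
    _ = _ := by rw [mul_assoc _ (Real.exp (1 / 2)), ← Real.exp_add, ← Real.exp_add]; ring_nf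

/-- Half of the exponential absorbs the polynomial, and the rest is a product of Gamma integrals
with exponent min(3p/4, 0). Convergence at zero needs 3p/4 > -1; with p = Re ε - 1 this is the
condition Re ε > -1/3. -/
theorem integrableOn_symU_rpow {p : ℝ} (hp : -(4 / 3) < p) (k : ℕ) :
    IntegrableOn (fun a => symU a ^ p * ((1 + symS a) ^ k * Real.exp (-symS a))) (orthant 4) := by
  set s := min (3 / 4 * p) 0 with hs
  have hs1 : -1 < s := by rw [hs, lt_min_iff]; constructor <;> linarith
  have h1 : IntegrableOn (fun t : ℝ => t ^ s * Real.exp (-(1 / 2) * t)) (Set.Ioi 0) := by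
    simpa using integrableOn_rpow_mul_exp_neg_mul_rpow (p := 1) (b := 1 / 2) hs1 one_pos
      (by norm_num)
  have h2 : IntegrableOn (fun a : Fin 4 → ℝ => ∏ i, (a i ^ s * Real.exp (-(1 / 2) * a i)))
      (orthant 4) := by
    rw [IntegrableOn, orthant, volume_pi, Measure.restrict_pi_pi]
    exact Integrable.fintype_prod (f := fun _ t => t ^ s * Real.exp (-(1 / 2) * t)) fun _ => h1
  set K := 3 * ⌈p⌉₊ + k
  refine (h2.const_mul (2 ^ K * K.factorial * Real.exp (1 / 2))).mono' ?_ ?_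
  · exact (Measurable.aestronglyMeasurable (by fun_prop))
  · refine (ae_restrict_mem (measurableSet_orthant 4)).mono fun a ha => ?_
    have hU := symU_pos ha
    have hS := symS_pos ha
    rw [Real.norm_of_nonneg (by positivity)]
    have ha' := mem_orthant.1 ha
    have hprod : (∏ i, (a i ^ s * Real.exp (-(1 / 2) * a i))) =
        (a 0 * a 1 * a 2 * a 3) ^ s * Real.exp (-(1 / 2 * symS a)) := by
      rw [Fin.prod_univ_four, Real.mul_rpow, Real.mul_rpow, Real.mul_rpow, symS,
        show -(1 / 2 * (a 0 + a 1 + a 2 + a 3)) = -(1 / 2) * a 0 + -(1 / 2) * a 1 + -(1 / 2) * a 2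
          + -(1 / 2) * a 3 by ring, Real.exp_add, Real.exp_add, Real.exp_add]
      · ring
      all_goals
        have := ha' 0; have := ha' 1; have := ha' 2; have := ha' 3
        positivity
    have hP : 0 < a 0 * a 1 * a 2 * a 3 := by
      have := ha' 0; have := ha' 1; have := ha' 2; have := ha' 3
      positivity
    rw [hprod]
    calc symU a ^ p * ((1 + symS a) ^ k * Real.exp (-symS a))
        ≤ (1 + symS a) ^ (3 * ⌈p⌉₊) * (a 0 * a 1 * a 2 * a 3) ^ s *
          ((1 + symS a) ^ k * Real.exp (-symS a)) := by gcongr; exact symU_rpow_le ha p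
      _ = (a 0 * a 1 * a 2 * a 3) ^ s * ((1 + symS a) ^ K * Real.exp (-symS a)) := by
        rw [pow_add]; ring
      _ ≤ (a 0 * a 1 * a 2 * a 3) ^ s * (2 ^ K * K.factorial * Real.exp (1 / 2) *
          Real.exp (-(1 / 2 * symS a))) := by
        exact mul_le_mul_of_nonneg_left (one_add_pow_mul_exp_neg_le K hS.le) (by positivity)
      _ = _ := by ring

/-- The weight of the Schwinger representation without the power of the first Symanzik
polynomial. -/
def weight (n : ℕ) (x : ℝ) (a : Fin 4 → ℝ) : ℝ := symV a ^ n * Real.exp (-symS a + x * symV a)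

@[fun_prop]
theorem measurable_weight (n : ℕ) (x : ℝ) : Measurable (weight n x) := by
  unfold weight; fun_prop

theorem weight_nonneg {n : ℕ} {x : ℝ} {a : Fin 4 → ℝ} (ha : a ∈ orthant 4) : 0 ≤ weight n x a := by
  have := symV_pos ha
  unfold weight; positivity

theorem weight_le {n : ℕ} {x : ℝ} (hx : x ≤ 0) {a : Fin 4 → ℝ} (ha : a ∈ orthant 4) :
    weight n x a ≤ (1 + symS a) ^ n * Real.exp (-symS a) := by
  have hV := symV_pos ha
  have hS := symS_pos ha
  have := symV_le_symS ha
  unfold weight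
  gcongr
  · linarith
  · nlinarith

theorem integrableOn_symU_rpow_weight {p : ℝ} (hp : -(4 / 3) < p) (n : ℕ) {x : ℝ} (hx : x ≤ 0) :
    IntegrableOn (fun a => symU a ^ p * weight n x a) (orthant 4) := by
  refine (integrableOn_symU_rpow hp n).mono' (Measurable.aestronglyMeasurable (by fun_prop)) ?_
  refine (ae_restrict_mem (measurableSet_orthant 4)).mono fun a ha => ?_
  have hU := symU_pos ha
  rw [Real.norm_of_nonneg (mul_nonneg (by positivity) (weight_nonneg ha))]
  gcongr
  exact weight_le hx ha

/-- The integrals `∫ U^{ε-1} V^n e^{-S + x V}`. -/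
def schwinger (n : ℕ) (ε : ℂ) (x : ℝ) : ℂ :=
  ∫ a in orthant 4, (symU a : ℂ) ^ (ε - 1) * (weight n x a : ℂ)

theorem norm_symU_cpow {a : Fin 4 → ℝ} (ha : a ∈ orthant 4) (z : ℂ) :
    ‖(symU a : ℂ) ^ z‖ = symU a ^ z.re :=
  Complex.norm_cpow_eq_rpow_re_of_pos (symU_pos ha) z

theorem integrableOn_schwinger {ε : ℂ} (hε : -(1 / 3 : ℝ) < ε.re) (n : ℕ) {x : ℝ} (hx : x ≤ 0) :
    IntegrableOn (fun a => (symU a : ℂ) ^ (ε - 1) * (weight n x a : ℂ)) (orthant 4) := by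
  refine (integrableOn_symU_rpow_weight (p := ε.re - 1) (by linarith) n hx).mono'
    (Measurable.aestronglyMeasurable (by fun_prop)) ?_
  refine (ae_restrict_mem (measurableSet_orthant 4)).mono fun a ha => ?_
  rw [norm_mul, norm_symU_cpow ha, Complex.norm_real, Real.norm_of_nonneg (weight_nonneg ha)]
  simp

theorem hasDerivAt_schwinger {ε : ℂ} (hε : -(1 / 3 : ℝ) < ε.re) (n : ℕ) {x : ℝ} (hx : x < 0) :
    HasDerivAt (schwinger n ε) (schwinger (n + 1) ε x) x := by
  refine (hasDerivAt_integral_of_dominated_loc_of_deriv_le (μ := volume.restrict (orthant 4))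
    (F := fun x a => (symU a : ℂ) ^ (ε - 1) * (weight n x a : ℂ))
    (F' := fun x a => (symU a : ℂ) ^ (ε - 1) * (weight (n + 1) x a : ℂ))
    (bound := fun a => symU a ^ (ε.re - 1) * ((1 + symS a) ^ (n + 1) * Real.exp (-symS a)))
    (Iio_mem_nhds hx) (Eventually.of_forall fun y => Measurable.aestronglyMeasurable (by fun_prop))
    (integrableOn_schwinger hε n hx.le) (Measurable.aestronglyMeasurable (by fun_prop)) ?_
    (integrableOn_symU_rpow (by linarith) _) ?_).2
  · refine (ae_restrict_mem (measurableSet_orthant 4)).mono fun a ha y hy => ?_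
    have hU := symU_pos ha
    rw [norm_mul, norm_symU_cpow ha, Complex.norm_real, Real.norm_of_nonneg (weight_nonneg ha)]
    simp only [Complex.sub_re, Complex.one_re]
    gcongr
    exact weight_le (le_of_lt hy) ha
  · refine Eventually.of_forall fun a y _ => ?_
    refine HasDerivAt.const_mul _ (HasDerivAt.ofReal_comp ?_)
    have h := ((((hasDerivAt_id y).mul_const (symV a)).const_add (-symS a)).exp).const_mul
      (symV a ^ n)
    refine h.congr_deriv ?_
    simp only [weight, id]; ring

theorem analyticOnNhd_schwinger (n : ℕ) {x : ℝ} (hx : x ≤ 0) :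
    AnalyticOnNhd ℂ (fun ε => schwinger n ε x) {ε | -(1 / 3 : ℝ) < ε.re} := by
  -- U^{ε-1} = exp((ε-1) log U), so the integral is the complex moment generating function of log U
  -- at ε - 1 for the weighted measure, which is analytic over the interior of its set of
  -- convergence.
  set μ : Measure (Fin 4 → ℝ) :=
    (volume.restrict (orthant 4)).withDensity fun a => ENNReal.ofReal (weight n x a) with hμ
  have hmeas : Measurable fun a => ENNReal.ofReal (weight n x a) := by fun_prop
  have hsub : Set.Ioi (-(4 / 3) : ℝ) ⊆
      ProbabilityTheory.integrableExpSet (fun a => Real.log (symU a)) μ := by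
    intro p hp
    rw [ProbabilityTheory.integrableExpSet, Set.mem_ofPred_eq, hμ,
      integrable_withDensity_iff_integrable_smul' hmeas (by simp)]
    refine (integrableOn_symU_rpow_weight hp n hx).congr ?_
    refine (ae_restrict_mem (measurableSet_orthant 4)).mono fun a ha => ?_
    simp only [ENNReal.toReal_ofReal (weight_nonneg ha), smul_eq_mul]
    rw [Real.rpow_def_of_pos (symU_pos ha), mul_comm, mul_comm p]
  have key : ∀ ε : ℂ, schwinger n ε x =
      ProbabilityTheory.complexMGF (fun a => Real.log (symU a)) μ (ε - 1) := by
    intro ε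
    rw [schwinger, ProbabilityTheory.complexMGF, hμ,
      integral_withDensity_eq_integral_toReal_smul hmeas (by simp)]
    refine setIntegral_congr_fun (measurableSet_orthant 4) fun a ha => ?_
    simp only [ENNReal.toReal_ofReal (weight_nonneg ha)]
    rw [Complex.cpow_def_of_ne_zero (by exact_mod_cast (symU_pos ha).ne'),
      ← Complex.ofReal_log (symU_pos ha).le, Complex.real_smul, mul_comm, mul_comm (ε - 1)]
  simp_rw [key]
  have : Set.Ioi (-(4 / 3) : ℝ) ⊆ interior
      (ProbabilityTheory.integrableExpSet (fun a => Real.log (symU a)) μ) :=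
    interior_maximal hsub isOpen_Ioi
  intro z hz
  have h1 : AnalyticAt ℂ (fun ε : ℂ => ε - 1) z := by fun_prop
  refine AnalyticAt.fun_comp (f := fun ε : ℂ => ε - 1)
    (ProbabilityTheory.analyticOnNhd_complexMGF (z - 1) (this ?_)) h1
  simp only [Set.mem_ofPred_eq] at hz
  simp only [Set.mem_Ioi, Complex.sub_re, Complex.one_re]
  linarith

end
end Banana

namespace Banana

noncomputable section

/-! ### Integration by parts for the Schwinger parameters -/

/-- A cubic polynomial. -/
def cubic (c : Fin 4 → ℝ) (v : ℝ) : ℝ := c 0 + c 1 * v + c 2 * v ^ 2 + c 3 * v ^ 3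

/-- The derivative of `cubic`. -/
def cubic' (c : Fin 4 → ℝ) (v : ℝ) : ℝ := c 1 + 2 * c 2 * v + 3 * c 3 * v ^ 2

theorem hasDerivAt_cubic (c : Fin 4 → ℝ) (v : ℝ) : HasDerivAt (cubic c) (cubic' c v) v := by
  have h := ((((hasDerivAt_id v).const_mul (c 1)).const_add (c 0)).add
    (((hasDerivAt_id v).pow 2).const_mul (c 2))).add (((hasDerivAt_id v).pow 3).const_mul (c 3))
  refine HasDerivAt.congr_deriv h ?_
  simp only [cubic', id]; push_cast; ring

@[fun_prop]
theorem continuous_cubic (c : Fin 4 → ℝ) : Continuous (cubic c) := by unfold cubic; fun_prop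

@[fun_prop]
theorem continuous_cubic' (c : Fin 4 → ℝ) : Continuous (cubic' c) := by unfold cubic'; fun_prop

/-- The coefficients of the four cubic polynomials in the total derivatives. -/
def ibpCoeff (e x : ℝ) : Fin 4 → Fin 4 → ℝ :=
  ![![-6 * e ^ 3, 4 - x + 18 * e - 6 * e * x - 22 * e ^ 2 - 11 * e ^ 2 * x,
      24 * x - 3 * x ^ 2 + 12 * e * x - 6 * e * x ^ 2, 10 * x ^ 2 - x ^ 3],
    ![-12 * e ^ 2 + 12 * e ^ 3,
      16 - 4 * x - 24 * e - 18 * e * x + 8 * e ^ 2 - 2 * e ^ 2 * x,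
      32 * x - 8 * x ^ 2 - 16 * e * x - 8 * e * x ^ 2, 8 * x ^ 2 - 2 * x ^ 3],
    ![-36 * e + 54 * e ^ 2 - 18 * e ^ 3, -36 * x - 42 * e * x + 30 * e ^ 2 * x,
      -36 * x ^ 2 - 6 * e * x ^ 2, -6 * x ^ 3],
    ![-144 + 264 * e - 144 * e ^ 2 + 24 * e ^ 3, -432 * x + 360 * e * x - 72 * e ^ 2 * x,
      -216 * x ^ 2 + 72 * e * x ^ 2, -24 * x ^ 3]]

section Algebra

/-- The contribution of one total derivative, in terms of the inverse `l` of the parameter and the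
elementary symmetric polynomials `w₂, w₃, w₄` of the inverses of the other parameters. -/
def ibpTerm (e x V q₁ q₂ q₃ q₄ d₁ d₂ d₃ d₄ l w₂ w₃ w₄ : ℝ) : ℝ :=
  ((e - 1) * l * (1 - l * V) - 1 + x * l ^ 2 * V ^ 2) * (q₁ + w₂ * q₂ + w₃ * q₃ + w₄ * q₄)
    + l ^ 2 * V ^ 2 * (d₁ + w₂ * d₂ + w₃ * d₃ + w₄ * d₄)

/-- With e_k the elementary symmetric polynomials of the other three inverses, Σ e_k = (4-k) E_k, Σ
l_i e_k = (k+1) E_{k+1} and Σ l_i² e_k = E₁ E_{k+1} - (k+2) E_{k+2}. -/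
theorem ibpTerm_sum (e x V q₁ q₂ q₃ q₄ d₁ d₂ d₃ d₄ l₀ l₁ l₂ l₃ E₁ E₂ E₃ E₄ : ℝ)
    (h₁ : E₁ = l₀ + l₁ + l₂ + l₃)
    (h₂ : E₂ = l₀ * l₁ + l₀ * l₂ + l₀ * l₃ + l₁ * l₂ + l₁ * l₃ + l₂ * l₃)
    (h₃ : E₃ = l₀ * l₁ * l₂ + l₀ * l₁ * l₃ + l₀ * l₂ * l₃ + l₁ * l₂ * l₃)
    (h₄ : E₄ = l₀ * l₁ * l₂ * l₃) :
    ibpTerm e x V q₁ q₂ q₃ q₄ d₁ d₂ d₃ d₄ l₀ (l₁ + l₂ + l₃) (l₁ * l₂ + l₁ * l₃ + l₂ * l₃)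
        (l₁ * l₂ * l₃)
      + ibpTerm e x V q₁ q₂ q₃ q₄ d₁ d₂ d₃ d₄ l₁ (l₀ + l₂ + l₃) (l₀ * l₂ + l₀ * l₃ + l₂ * l₃)
        (l₀ * l₂ * l₃)
      + ibpTerm e x V q₁ q₂ q₃ q₄ d₁ d₂ d₃ d₄ l₂ (l₀ + l₁ + l₃) (l₀ * l₁ + l₀ * l₃ + l₁ * l₃)
        (l₀ * l₁ * l₃)
      + ibpTerm e x V q₁ q₂ q₃ q₄ d₁ d₂ d₃ d₄ l₃ (l₀ + l₁ + l₂) (l₀ * l₁ + l₀ * l₂ + l₁ * l₂)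
        (l₀ * l₁ * l₂) =
    (e - 1) * (E₁ * q₁ + 2 * E₂ * q₂ + 3 * E₃ * q₃ + 4 * E₄ * q₄)
      - (4 * q₁ + 3 * E₁ * q₂ + 2 * E₂ * q₃ + E₃ * q₄)
      + (x * V ^ 2 - (e - 1) * V) * ((E₁ ^ 2 - 2 * E₂) * q₁ + (E₁ * E₂ - 3 * E₃) * q₂
        + (E₁ * E₃ - 4 * E₄) * q₃ + E₁ * E₄ * q₄)
      + V ^ 2 * ((E₁ ^ 2 - 2 * E₂) * d₁ + (E₁ * E₂ - 3 * E₃) * d₂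
        + (E₁ * E₃ - 4 * E₄) * d₃ + E₁ * E₄ * d₄) := by
  subst h₁ h₂ h₃ h₄
  unfold ibpTerm
  ring

/-- E₁ is tied to V, while E₂, E₃, E₄ are free. The cubics in `ibpCoeff` are such that the
coefficients of these three cancel, and what is left is the symbol of `bananaOperator`, with V in
place of d/dx. -/
theorem ibp_sum_eq {V E₁ : ℝ} (hV : V ≠ 0) (h : E₁ = 1 / V) (e x E₂ E₃ E₄ : ℝ)
    {q₁ q₂ q₃ q₄ d₁ d₂ d₃ d₄ : ℝ}
    (hq₁ : q₁ = cubic (ibpCoeff e x 0) V) (hq₂ : q₂ = V * cubic (ibpCoeff e x 1) V)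
    (hq₃ : q₃ = V ^ 2 * cubic (ibpCoeff e x 2) V) (hq₄ : q₄ = V ^ 3 * cubic (ibpCoeff e x 3) V)
    (hd₁ : d₁ = cubic' (ibpCoeff e x 0) V)
    (hd₂ : d₂ = cubic (ibpCoeff e x 1) V + V * cubic' (ibpCoeff e x 1) V)
    (hd₃ : d₃ = 2 * V * cubic (ibpCoeff e x 2) V + V ^ 2 * cubic' (ibpCoeff e x 2) V)
    (hd₄ : d₄ = 3 * V ^ 2 * cubic (ibpCoeff e x 3) V + V ^ 3 * cubic' (ibpCoeff e x 3) V) :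
    (e - 1) * (E₁ * q₁ + 2 * E₂ * q₂ + 3 * E₃ * q₃ + 4 * E₄ * q₄)
      - (4 * q₁ + 3 * E₁ * q₂ + 2 * E₂ * q₃ + E₃ * q₄)
      + (x * V ^ 2 - (e - 1) * V) * ((E₁ ^ 2 - 2 * E₂) * q₁ + (E₁ * E₂ - 3 * E₃) * q₂
        + (E₁ * E₃ - 4 * E₄) * q₃ + E₁ * E₄ * q₄)
      + V ^ 2 * ((E₁ ^ 2 - 2 * E₂) * d₁ + (E₁ * E₂ - 3 * E₃) * d₂
        + (E₁ * E₃ - 4 * E₄) * d₃ + E₁ * E₄ * d₄) =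
    (-(6 * e ^ 3 + 11 * e ^ 2 + 6 * e + 1) * x + (-12 * e ^ 3 + 14 * e ^ 2 + 18 * e + 4))
      + (-(11 * e ^ 2 + 18 * e + 7) * x ^ 2 + (28 * e ^ 2 + 120 * e + 68) * x
          + 64 * (e ^ 2 - 1)) * V
      + (-6 * (1 + e) * x ^ 3 + (60 * e + 90) * x ^ 2 - 192 * x) * V ^ 2
      - x ^ 2 * (x - 4) * (x - 16) * V ^ 3 := by
  subst h hq₁ hq₂ hq₃ hq₄ hd₁ hd₂ hd₃ hd₄
  simp only [cubic, cubic', ibpCoeff, Matrix.cons_val]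
  field_simp
  ring

end Algebra

/-- The first elementary symmetric polynomial of three variables. -/
def esym₁ (b : Fin 3 → ℝ) : ℝ := b 0 + b 1 + b 2

/-- The second elementary symmetric polynomial. -/
def esym₂ (b : Fin 3 → ℝ) : ℝ := b 0 * b 1 + b 0 * b 2 + b 1 * b 2

/-- The third elementary symmetric polynomial. -/
def esym₃ (b : Fin 3 → ℝ) : ℝ := b 0 * b 1 * b 2

@[fun_prop]
theorem continuous_esym₁ : Continuous esym₁ := by unfold esym₁; fun_prop

@[fun_prop]
theorem continuous_esym₂ : Continuous esym₂ := by unfold esym₂; fun_prop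

@[fun_prop]
theorem continuous_esym₃ : Continuous esym₃ := by unfold esym₃; fun_prop

@[fun_prop]
theorem measurable_esym₁ : Measurable esym₁ := continuous_esym₁.measurable

@[fun_prop]
theorem measurable_esym₂ : Measurable esym₂ := continuous_esym₂.measurable

@[fun_prop]
theorem measurable_esym₃ : Measurable esym₃ := continuous_esym₃.measurable

/-- The first Symanzik polynomial, with one parameter singled out. -/
def splitU (p : ℝ × (Fin 3 → ℝ)) : ℝ := p.1 * esym₂ p.2 + esym₃ p.2

/-- `symV`, with one parameter singled out. -/
def splitV (p : ℝ × (Fin 3 → ℝ)) : ℝ := p.1 * esym₃ p.2 / splitU p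

/-- `symS`, with one parameter singled out. -/
def splitS (p : ℝ × (Fin 3 → ℝ)) : ℝ := p.1 + esym₁ p.2

@[fun_prop]
theorem measurable_splitU : Measurable splitU := by unfold splitU; fun_prop

@[fun_prop]
theorem measurable_splitV : Measurable splitV := by unfold splitV; fun_prop

@[fun_prop]
theorem measurable_splitS : Measurable splitS := by unfold splitS; fun_prop

/-- The polynomial prefactor of the function whose total derivatives are used. -/
def ibpPoly (e x : ℝ) (p : ℝ × (Fin 3 → ℝ)) : ℝ :=
  splitU p * cubic (ibpCoeff e x 0) (splitV p)
    + p.1 * (esym₂ p.2 * cubic (ibpCoeff e x 1) (splitV p)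
      + esym₁ p.2 * (splitV p * cubic (ibpCoeff e x 2) (splitV p))
      + splitV p ^ 2 * cubic (ibpCoeff e x 3) (splitV p))

/-- The derivative of `ibpPoly`. -/
def ibpPoly' (e x : ℝ) (p : ℝ × (Fin 3 → ℝ)) : ℝ :=
  esym₂ p.2 * cubic (ibpCoeff e x 0) (splitV p)
    + splitU p * (cubic' (ibpCoeff e x 0) (splitV p) * (esym₃ p.2 / splitU p) ^ 2)
    + (esym₂ p.2 * cubic (ibpCoeff e x 1) (splitV p)
      + esym₁ p.2 * (splitV p * cubic (ibpCoeff e x 2) (splitV p))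
      + splitV p ^ 2 * cubic (ibpCoeff e x 3) (splitV p))
    + p.1 * ((esym₃ p.2 / splitU p) ^ 2 * (esym₂ p.2 * cubic' (ibpCoeff e x 1) (splitV p)
      + esym₁ p.2 * (cubic (ibpCoeff e x 2) (splitV p)
        + splitV p * cubic' (ibpCoeff e x 2) (splitV p))
      + (2 * splitV p * cubic (ibpCoeff e x 3) (splitV p)
        + splitV p ^ 2 * cubic' (ibpCoeff e x 3) (splitV p))))

/-- The exponential weight, with one parameter singled out. -/
def ibpExp (x : ℝ) (p : ℝ × (Fin 3 → ℝ)) : ℝ := Real.exp (-splitS p + x * splitV p)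

/-- The function whose total derivatives are used. -/
def ibpFun (e x : ℝ) (p : ℝ × (Fin 3 → ℝ)) : ℝ :=
  splitU p ^ (e - 2) * (ibpExp x p * ibpPoly e x p)

/-- The derivative of `ibpFun`, divided by `splitU ^ (e - 3) * ibpExp`. -/
def ibpBracket (e x : ℝ) (p : ℝ × (Fin 3 → ℝ)) : ℝ :=
  (e - 2) * esym₂ p.2 * ibpPoly e x p
    + splitU p * ((-1 + x * (esym₃ p.2 / splitU p) ^ 2) * ibpPoly e x p + ibpPoly' e x p)

/-- The derivative of `ibpFun`. -/
def ibpFun' (e x : ℝ) (p : ℝ × (Fin 3 → ℝ)) : ℝ :=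
  splitU p ^ (e - 3) * (ibpExp x p * ibpBracket e x p)

theorem esym_pos {b : Fin 3 → ℝ} (hb : b ∈ orthant 3) :
    0 < esym₁ b ∧ 0 < esym₂ b ∧ 0 < esym₃ b := by
  rw [mem_orthant] at hb
  have := hb 0; have := hb 1; have := hb 2
  refine ⟨?_, ?_, ?_⟩
  · unfold esym₁; positivity
  · unfold esym₂; positivity
  · unfold esym₃; positivity

theorem splitU_pos {t : ℝ} (ht : 0 ≤ t) {b : Fin 3 → ℝ} (hb : b ∈ orthant 3) :
    0 < splitU (t, b) := by
  obtain ⟨-, h2, h3⟩ := esym_pos hb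
  simp only [splitU]; positivity

/-- The endpoint t = 0 is included, since U reduces there to the positive `esym₃ b`; this is where
the boundary term is read off. Note that ∂V/∂t = (`esym₃ b`/U)². -/
theorem hasDerivAt_ibpFun (e x : ℝ) {t : ℝ} (ht : 0 ≤ t) {b : Fin 3 → ℝ} (hb : b ∈ orthant 3) :
    HasDerivAt (fun t => ibpFun e x (t, b)) (ibpFun' e x (t, b)) t := by
  have hU0 := splitU_pos ht hb
  have hU : HasDerivAt (fun t => splitU (t, b)) (esym₂ b) t := by
    simpa [splitU] using ((hasDerivAt_id t).mul_const (esym₂ b)).add_const (esym₃ b)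
  have hV : HasDerivAt (fun t => splitV (t, b)) ((esym₃ b / splitU (t, b)) ^ 2) t := by
    refine HasDerivAt.congr_deriv (((hasDerivAt_id t).mul_const (esym₃ b)).div hU hU0.ne') ?_
    simp only [id]
    field_simp
    simp only [splitU]; ring
  have hE : HasDerivAt (fun t => ibpExp x (t, b))
      (ibpExp x (t, b) * (-1 + x * (esym₃ b / splitU (t, b)) ^ 2)) t := by
    refine (((((hasDerivAt_id t).add_const (esym₁ b)).neg).add (hV.const_mul x)).exp).congr_deriv ?_
    simp [ibpExp, splitS]
  have hc : ∀ i, HasDerivAt (fun t => cubic (ibpCoeff e x i) (splitV (t, b)))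
      (cubic' (ibpCoeff e x i) (splitV (t, b)) * (esym₃ b / splitU (t, b)) ^ 2) t :=
    fun i => (hasDerivAt_cubic (ibpCoeff e x i) _).comp t hV
  have hP : HasDerivAt (fun t => ibpPoly e x (t, b)) (ibpPoly' e x (t, b)) t := by
    refine HasDerivAt.congr_deriv ((hU.mul (hc 0)).add ((hasDerivAt_id t).mul
      ((((hc 1).const_mul (esym₂ b)).add ((hV.mul (hc 2)).const_mul (esym₁ b))).add
        ((hV.pow 2).mul (hc 3))))) ?_
    simp only [ibpPoly', id, Pi.pow_apply]
    push_cast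
    ring
  refine HasDerivAt.congr_deriv ((hU.rpow_const (p := e - 2) (Or.inl hU0.ne')).mul (hE.mul hP)) ?_
  have : splitU (t, b) ^ (e - 2) = splitU (t, b) ^ (e - 3) * splitU (t, b) := by
    rw [← Real.rpow_add_one hU0.ne']; ring_nf
  rw [show e - 2 - 1 = e - 3 by ring, this]
  simp only [ibpFun', ibpBracket]
  ring

/-! #### The sum of the total derivatives -/

/-- In terms of the inverses of the parameters, `ibpPoly` is U (q₁ + w₂ q₂ + w₃ q₃ + w₄ q₄), and
∂U/∂t = U t⁻¹ (1 - V/t). The extra factor U turns the exponent e - 2 into e - 1. -/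
theorem ibpBracket_eq (e x : ℝ) {t : ℝ} (ht : 0 < t) {b : Fin 3 → ℝ} (hb : b ∈ orthant 3)
    {U V : ℝ} (hU : splitU (t, b) = U) (hV : splitV (t, b) = V) :
    ibpBracket e x (t, b) = U ^ 2 * ibpTerm e x V (cubic (ibpCoeff e x 0) V)
      (V * cubic (ibpCoeff e x 1) V) (V ^ 2 * cubic (ibpCoeff e x 2) V)
      (V ^ 3 * cubic (ibpCoeff e x 3) V) (cubic' (ibpCoeff e x 0) V)
      (cubic (ibpCoeff e x 1) V + V * cubic' (ibpCoeff e x 1) V)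
      (2 * V * cubic (ibpCoeff e x 2) V + V ^ 2 * cubic' (ibpCoeff e x 2) V)
      (3 * V ^ 2 * cubic (ibpCoeff e x 3) V + V ^ 3 * cubic' (ibpCoeff e x 3) V)
      t⁻¹ ((b 0)⁻¹ + (b 1)⁻¹ + (b 2)⁻¹)
      ((b 0)⁻¹ * (b 1)⁻¹ + (b 0)⁻¹ * (b 2)⁻¹ + (b 1)⁻¹ * (b 2)⁻¹)
      ((b 0)⁻¹ * (b 1)⁻¹ * (b 2)⁻¹) := by
  obtain ⟨h1, h2, h3⟩ := esym_pos hb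
  have hb' := mem_orthant.1 hb
  have b0 := (hb' 0).ne'
  have b1 := (hb' 1).ne'
  have b2 := (hb' 2).ne'
  have w2 : (b 0)⁻¹ + (b 1)⁻¹ + (b 2)⁻¹ = esym₂ b / esym₃ b := by
    unfold esym₂ esym₃; field_simp; ring
  have w3 : (b 0)⁻¹ * (b 1)⁻¹ + (b 0)⁻¹ * (b 2)⁻¹ + (b 1)⁻¹ * (b 2)⁻¹ = esym₁ b / esym₃ b := by
    unfold esym₁ esym₃; field_simp; ring
  have w4 : (b 0)⁻¹ * (b 1)⁻¹ * (b 2)⁻¹ = 1 / esym₃ b := by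
    unfold esym₃; field_simp
  rw [w2, w3, w4]
  have hU0 : 0 < U := hU ▸ splitU_pos ht.le hb
  have hV0 : 0 < V := by
    rw [← hV]; simp only [splitV]; rw [hU]; positivity
  -- U and V, common to all four choices of the singled-out parameter, replace `esym₂` and `esym₃`,
  -- which depend on that choice.
  have hC : esym₃ b = U * V / t := by
    rw [← hV]; simp only [splitV]; rw [hU]; field_simp
  have hB : esym₂ b = (U - U * V / t) / t := by
    rw [← hC, ← hU]; simp only [splitU]; field_simp; ring
  simp only [ibpBracket, ibpPoly, ibpPoly', ibpTerm, hU, hV]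
  rw [hB, hC]
  generalize cubic (ibpCoeff e x 0) V = q0
  generalize cubic (ibpCoeff e x 1) V = q1
  generalize cubic (ibpCoeff e x 2) V = q2
  generalize cubic (ibpCoeff e x 3) V = q3
  generalize cubic' (ibpCoeff e x 0) V = d0
  generalize cubic' (ibpCoeff e x 1) V = d1
  generalize cubic' (ibpCoeff e x 2) V = d2
  generalize cubic' (ibpCoeff e x 3) V = d3
  generalize esym₁ b = B1
  field_simp
  ring

/-- The parameters with the `i`-th one singled out. -/
def split (i : Fin 4) (a : Fin 4 → ℝ) : ℝ × (Fin 3 → ℝ) := (a i, fun j => a (i.succAbove j))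

theorem split_mem_iff {i : Fin 4} {a : Fin 4 → ℝ} :
    split i a ∈ Set.Ioi (0 : ℝ) ×ˢ orthant 3 ↔ a ∈ orthant 4 := by
  simp only [split, Set.mem_prod, Set.mem_Ioi, mem_orthant]
  exact (Fin.forall_iff_succAbove (P := fun j => 0 < a j) i).symm

theorem splitS_split (i : Fin 4) (a : Fin 4 → ℝ) : splitS (split i a) = symS a := by
  fin_cases i <;> simp [splitS, split, symS, esym₁, Fin.succAbove] <;> ring

theorem splitU_split (i : Fin 4) (a : Fin 4 → ℝ) : splitU (split i a) = symU a := by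
  fin_cases i <;> simp [splitU, split, symU, symanzikU, esym₂, esym₃, Fin.succAbove] <;> ring

theorem splitV_split (i : Fin 4) (a : Fin 4 → ℝ) : splitV (split i a) = symV a := by
  rw [splitV, splitU_split, symV]
  congr 1
  fin_cases i <;> simp [split, esym₃, Fin.succAbove] <;> ring

theorem sum_ibpFun' (e x : ℝ) {a : Fin 4 → ℝ} (ha : a ∈ orthant 4) :
    ∑ i, ibpFun' e x (split i a) =
      symU a ^ (e - 1) * (Real.exp (-symS a + x * symV a) *
        ((-(6 * e ^ 3 + 11 * e ^ 2 + 6 * e + 1) * x + (-12 * e ^ 3 + 14 * e ^ 2 + 18 * e + 4))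
      + (-(11 * e ^ 2 + 18 * e + 7) * x ^ 2 + (28 * e ^ 2 + 120 * e + 68) * x
          + 64 * (e ^ 2 - 1)) * symV a
      + (-6 * (1 + e) * x ^ 3 + (60 * e + 90) * x ^ 2 - 192 * x) * symV a ^ 2
      - x ^ 2 * (x - 4) * (x - 16) * symV a ^ 3)) := by
  have hU := symU_pos ha
  have hV := symV_pos ha
  have ha' := mem_orthant.1 ha
  have hE : ∀ i, ibpExp x (split i a) = Real.exp (-symS a + x * symV a) := fun i => by
    rw [ibpExp, splitS_split, splitV_split]
  have hp : symU a ^ (e - 1) = symU a ^ (e - 3) * symU a ^ 2 := by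
    rw [← Real.rpow_natCast, ← Real.rpow_add hU]; congr 1; push_cast; ring
  have hinv : (a 0)⁻¹ + (a 1)⁻¹ + (a 2)⁻¹ + (a 3)⁻¹ = 1 / symV a := by
    have := (ha' 0).ne'; have := (ha' 1).ne'; have := (ha' 2).ne'; have := (ha' 3).ne'
    rw [symV, one_div_div, symU, symanzikU]
    field_simp
    ring
  rw [← ibp_sum_eq hV.ne' hinv e x _ _ _ rfl rfl rfl rfl rfl rfl rfl rfl,
    ← ibpTerm_sum e x (symV a) _ _ _ _ _ _ _ _ (a 0)⁻¹ (a 1)⁻¹ (a 2)⁻¹ (a 3)⁻¹ _ _ _ _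
      rfl rfl rfl rfl, hp]
  have hb : ∀ i, _ := fun i => ibpBracket_eq e x (ha' i) (b := fun j => a (i.succAbove j))
    (mem_orthant.2 fun j => ha' _) (splitU_split i a) (splitV_split i a)
  simp only [ibpFun', hE, splitU_split, Fin.sum_univ_four]
  have h0 := hb 0
  have h1 := hb 1
  have h2 := hb 2
  have h3 := hb 3
  simp only [Fin.isValue, Fin.succAbove, Fin.reduceCastSucc, Fin.reduceSucc, Fin.reduceLT,
    if_true, if_false] at h0 h1 h2 h3
  simp only [split, Fin.succAbove] at *
  rw [h0, h1, h2, h3]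
  ring

end
end Banana

namespace Banana

noncomputable section

/-! #### Bounds -/

/-- The region of integration with one parameter singled out. -/
def splitRegion : Set (ℝ × (Fin 3 → ℝ)) := Set.Ioi 0 ×ˢ orthant 3

/-- Functions on `splitRegion` that are bounded by a polynomial. -/
def PolyBdd (f : ℝ × (Fin 3 → ℝ) → ℝ) : Prop :=
  ∃ (K : ℝ) (k : ℕ), 0 ≤ K ∧ ∀ p ∈ splitRegion, |f p| ≤ K * (1 + splitS p) ^ k

theorem splitS_pos {p : ℝ × (Fin 3 → ℝ)} (hp : p ∈ splitRegion) : 0 < splitS p :=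
  add_pos hp.1 (esym_pos hp.2).1

namespace PolyBdd

variable {f g : ℝ × (Fin 3 → ℝ) → ℝ}

theorem of_le (k : ℕ) (h : ∀ p ∈ splitRegion, |f p| ≤ (1 + splitS p) ^ k) : PolyBdd f :=
  ⟨1, k, zero_le_one, fun p hp => by rw [one_mul]; exact h p hp⟩

theorem const (c : ℝ) : PolyBdd fun _ => c := ⟨|c|, 0, abs_nonneg c, fun p _ => by simp⟩

theorem add (hf : PolyBdd f) (hg : PolyBdd g) : PolyBdd fun p => f p + g p := by
  obtain ⟨K, k, hK, h⟩ := hf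
  obtain ⟨L, l, hL, h'⟩ := hg
  refine ⟨K + L, k + l, add_nonneg hK hL, fun p hp => ?_⟩
  have hS := splitS_pos hp
  calc |f p + g p| ≤ |f p| + |g p| := abs_add_le _ _
    _ ≤ K * (1 + splitS p) ^ k + L * (1 + splitS p) ^ l := add_le_add (h p hp) (h' p hp)
    _ ≤ K * (1 + splitS p) ^ (k + l) + L * (1 + splitS p) ^ (k + l) := by
      gcongr <;> linarith
    _ = _ := by ring

theorem mul (hf : PolyBdd f) (hg : PolyBdd g) : PolyBdd fun p => f p * g p := by
  obtain ⟨K, k, hK, h⟩ := hf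
  obtain ⟨L, l, hL, h'⟩ := hg
  refine ⟨K * L, k + l, mul_nonneg hK hL, fun p hp => ?_⟩
  have hS := splitS_pos hp
  rw [abs_mul, pow_add]
  calc |f p| * |g p| ≤ (K * (1 + splitS p) ^ k) * (L * (1 + splitS p) ^ l) :=
        mul_le_mul (h p hp) (h' p hp) (abs_nonneg _) (by positivity)
    _ = _ := by ring

theorem pow (hf : PolyBdd f) (n : ℕ) : PolyBdd fun p => f p ^ n := by
  induction n with
  | zero => simpa using const 1
  | succ n ih => simpa only [pow_succ] using ih.mul hf

theorem fst : PolyBdd fun p => p.1 := of_le 1 fun p hp => by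
  have h1 := (esym_pos hp.2).1
  have h2 : 0 < p.1 := hp.1
  rw [abs_of_pos h2, splitS]; linarith

theorem esym₁ : PolyBdd fun p => esym₁ p.2 := of_le 1 fun p hp => by
  have h1 := (esym_pos hp.2).1
  have h2 : 0 < p.1 := hp.1
  rw [abs_of_pos h1, splitS]; linarith

theorem coord (i : Fin 3) : PolyBdd fun p => p.2 i := of_le 1 fun p hp => by
  have h := mem_orthant.1 hp.2
  have h1 := h 0
  have h2 := h 1
  have h3 := h 2
  have h4 : 0 < p.1 := hp.1
  rw [abs_of_pos (h i), splitS, Banana.esym₁]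
  fin_cases i <;> simp <;> linarith

theorem esym₂ : PolyBdd fun p => esym₂ p.2 :=
  (((coord 0).mul (coord 1)).add ((coord 0).mul (coord 2))).add ((coord 1).mul (coord 2))

theorem esym₃ : PolyBdd fun p => esym₃ p.2 := ((coord 0).mul (coord 1)).mul (coord 2)

theorem splitU : PolyBdd splitU := (fst.mul esym₂).add esym₃

/-- The quotient is V/a_i, which is at most 1. It appears squared in ∂V/∂a_i. -/
theorem ratio : PolyBdd fun p => Banana.esym₃ p.2 / Banana.splitU p := of_le 0 fun p hp => by
  obtain ⟨-, h2, h3⟩ := esym_pos hp.2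
  have h4 : 0 < p.1 := hp.1
  have hU : 0 < Banana.splitU p := splitU_pos h4.le hp.2
  rw [pow_zero, abs_of_pos (div_pos h3 hU), div_le_one hU, Banana.splitU]
  nlinarith

theorem splitV : PolyBdd splitV := by
  change PolyBdd fun p => p.1 * Banana.esym₃ p.2 / Banana.splitU p
  simpa only [← mul_div_assoc] using fst.mul ratio

theorem cubic (c : Fin 4 → ℝ) : PolyBdd fun p => cubic c (Banana.splitV p) :=
  (((const _).add ((const _).mul splitV)).add ((const _).mul (splitV.pow 2))).add
    ((const _).mul (splitV.pow 3))

theorem cubic' (c : Fin 4 → ℝ) : PolyBdd fun p => cubic' c (Banana.splitV p) :=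
  ((const _).add ((const _).mul splitV)).add ((const _).mul (splitV.pow 2))

theorem ibpPoly (e x : ℝ) : PolyBdd (ibpPoly e x) :=
  (splitU.mul (cubic _)).add (fst.mul (((esym₂.mul (cubic _)).add
    (esym₁.mul (splitV.mul (cubic _)))).add ((splitV.pow 2).mul (cubic _))))

theorem ibpPoly' (e x : ℝ) : PolyBdd (ibpPoly' e x) :=
  (((esym₂.mul (cubic _)).add (splitU.mul ((cubic' _).mul (ratio.pow 2)))).add
    (((esym₂.mul (cubic _)).add (esym₁.mul (splitV.mul (cubic _)))).add
      ((splitV.pow 2).mul (cubic _)))).add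
    (fst.mul ((ratio.pow 2).mul (((esym₂.mul (cubic' _)).add
      (esym₁.mul ((cubic _).add (splitV.mul (cubic' _))))).add
      ((((const 2).mul splitV).mul (cubic _)).add ((splitV.pow 2).mul (cubic' _))))))

theorem ibpBracket (e x : ℝ) : PolyBdd (ibpBracket e x) :=
  (((const (e - 2)).mul esym₂).mul (ibpPoly e x)).add (splitU.mul
    ((((const (-1)).add ((const x).mul (ratio.pow 2))).mul (ibpPoly e x)).add (ibpPoly' e x)))

theorem splitU_rpow {q : ℝ} (hq : 0 ≤ q) : PolyBdd fun p => Banana.splitU p ^ q := by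
  obtain ⟨K, k, hK, h⟩ := splitU
  refine ⟨(K + 1) ^ q, k * ⌈q⌉₊, by positivity, fun p hp => ?_⟩
  have hU : 0 < Banana.splitU p := splitU_pos (le_of_lt hp.1) hp.2
  have hS := splitS_pos hp
  have h' := h p hp
  rw [abs_of_pos hU] at h'
  rw [abs_of_pos (by positivity)]
  calc Banana.splitU p ^ q ≤ ((K + 1) * (1 + splitS p) ^ k) ^ q := by
        gcongr
        refine h'.trans ?_
        gcongr
        linarith
    _ = (K + 1) ^ q * ((1 + splitS p) ^ k) ^ q := Real.mul_rpow (by positivity) (by positivity)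
    _ ≤ (K + 1) ^ q * ((1 + splitS p) ^ k) ^ (⌈q⌉₊ : ℝ) := by
        gcongr
        · exact one_le_pow₀ (by linarith)
        · exact Nat.le_ceil q
    _ = _ := by rw [Real.rpow_natCast, ← pow_mul]

theorem exp_mul {x : ℝ} (hx : x ≤ 0) (hf : PolyBdd f) :
    ∃ (K : ℝ) (k : ℕ), 0 ≤ K ∧ ∀ p ∈ splitRegion, |ibpExp x p * f p| ≤
      K * ((1 + splitS p) ^ k * Real.exp (-splitS p)) := by
  obtain ⟨K, k, hK, h⟩ := hf
  refine ⟨K, k, hK, fun p hp => ?_⟩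
  have hS := splitS_pos hp
  have hV : 0 ≤ Banana.splitV p := by
    have := splitU_pos (le_of_lt hp.1) hp.2
    have := (esym_pos hp.2).2.2
    have : 0 < p.1 := hp.1
    have hU : 0 < Banana.splitU p := splitU_pos this.le hp.2
    unfold Banana.splitV; positivity
  rw [abs_mul, ibpExp, Real.abs_exp]
  calc _ ≤ Real.exp (-splitS p) * (K * (1 + splitS p) ^ k) := by
        gcongr
        · nlinarith
        · exact h p hp
    _ = _ := by ring

end PolyBdd

theorem ibpFun_bound {e x : ℝ} (he : 3 ≤ e) (hx : x ≤ 0) :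
    ∃ (K : ℝ) (k : ℕ), 0 ≤ K ∧ ∀ p ∈ splitRegion, |ibpFun e x p| ≤
      K * ((1 + splitS p) ^ k * Real.exp (-splitS p)) := by
  obtain ⟨K, k, hK, h⟩ := PolyBdd.exp_mul hx
    ((PolyBdd.splitU_rpow (show 0 ≤ e - 2 by linarith)).mul (PolyBdd.ibpPoly e x))
  exact ⟨K, k, hK, fun p hp => by rw [ibpFun, mul_left_comm]; exact h p hp⟩

theorem ibpFun'_bound {e x : ℝ} (he : 3 ≤ e) (hx : x ≤ 0) :
    ∃ (K : ℝ) (k : ℕ), 0 ≤ K ∧ ∀ p ∈ splitRegion, |ibpFun' e x p| ≤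
      K * ((1 + splitS p) ^ k * Real.exp (-splitS p)) := by
  obtain ⟨K, k, hK, h⟩ := PolyBdd.exp_mul hx
    ((PolyBdd.splitU_rpow (show 0 ≤ e - 3 by linarith)).mul (PolyBdd.ibpBracket e x))
  exact ⟨K, k, hK, fun p hp => by rw [ibpFun', mul_left_comm]; exact h p hp⟩

/-! #### Integration -/

theorem measurePreserving_split (i : Fin 4) : MeasurePreserving (split i) :=
  volume_preserving_piFinSuccAbove (fun _ => ℝ) i

theorem measurableEmbedding_split (i : Fin 4) : MeasurableEmbedding (split i) :=
  (MeasurableEquiv.piFinSuccAbove (fun _ => ℝ) i).measurableEmbedding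

theorem preimage_split (i : Fin 4) : split i ⁻¹' splitRegion = orthant 4 :=
  Set.ext fun _ => split_mem_iff

theorem integrableOn_comp_split_iff (i : Fin 4) {f : ℝ × (Fin 3 → ℝ) → ℝ} :
    IntegrableOn (fun a => f (split i a)) (orthant 4) ↔ IntegrableOn f splitRegion := by
  rw [← preimage_split i]
  exact (measurePreserving_split i).integrableOn_comp_preimage (measurableEmbedding_split i)

theorem setIntegral_comp_split (i : Fin 4) (f : ℝ × (Fin 3 → ℝ) → ℝ) :
    ∫ a in orthant 4, f (split i a) = ∫ p in splitRegion, f p := by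
  rw [← preimage_split i]
  exact (measurePreserving_split i).setIntegral_preimage_emb (measurableEmbedding_split i) f _

theorem measurableSet_splitRegion : MeasurableSet splitRegion :=
  measurableSet_Ioi.prod (measurableSet_orthant 3)

@[fun_prop]
theorem measurable_ibpPoly (e x : ℝ) : Measurable (ibpPoly e x) := by
  have := fun c => (continuous_cubic c).measurable
  unfold ibpPoly; fun_prop

@[fun_prop]
theorem measurable_ibpPoly' (e x : ℝ) : Measurable (ibpPoly' e x) := by
  have := fun c => (continuous_cubic c).measurable
  have := fun c => (continuous_cubic' c).measurable
  unfold ibpPoly'; fun_prop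

theorem measurable_ibpFun' (e x : ℝ) : Measurable (ibpFun' e x) := by
  unfold ibpFun' ibpExp ibpBracket; fun_prop

theorem integrableOn_ibpFun' {e x : ℝ} (he : 3 ≤ e) (hx : x ≤ 0) :
    IntegrableOn (ibpFun' e x) splitRegion := by
  obtain ⟨K, k, -, h⟩ := ibpFun'_bound he hx
  have h0 : IntegrableOn (fun p => (1 + splitS p) ^ k * Real.exp (-splitS p)) splitRegion := by
    rw [← integrableOn_comp_split_iff 0]
    simpa [splitS_split] using integrableOn_symU_rpow (p := 0) (by norm_num) k
  refine (h0.const_mul K).mono' (measurable_ibpFun' e x).aestronglyMeasurable ?_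
  exact (ae_restrict_mem measurableSet_splitRegion).mono fun p hp => h p hp

theorem tendsto_ibpFun {e x : ℝ} (he : 3 ≤ e) (hx : x ≤ 0) {b : Fin 3 → ℝ} (hb : b ∈ orthant 3) :
    Tendsto (fun t => ibpFun e x (t, b)) atTop (𝓝 0) := by
  obtain ⟨K, k, hK, h⟩ := ibpFun_bound he hx
  have hl : Tendsto (fun t : ℝ => K * (2 ^ k * k.factorial * Real.exp (1 / 2) *
      Real.exp (-(1 / 2 * splitS (t, b))))) atTop (𝓝 (K * (2 ^ k * k.factorial * Real.exp (1 / 2) *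
      0))) := by
    refine ((Real.tendsto_exp_neg_atTop_nhds_zero.comp ?_).const_mul _).const_mul _
    have h' : Tendsto (fun t => splitS (t, b)) atTop atTop :=
      tendsto_atTop_add_const_right _ (esym₁ b) tendsto_id
    exact h'.const_mul_atTop (by norm_num)
  rw [mul_zero, mul_zero] at hl
  refine squeeze_zero_norm' ((eventually_gt_atTop 0).mono fun t ht => ?_) hl
  have hp : (t, b) ∈ splitRegion := ⟨ht, hb⟩
  exact (h _ hp).trans (mul_le_mul_of_nonneg_left
    (one_add_pow_mul_exp_neg_le k (splitS_pos hp).le) hK)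

/-- On the face V = 0 and U = b₀b₁b₂, so only the constant term -6e³ of the first cubic survives and
the function factorises. -/
theorem ibpFun_zero (e x : ℝ) {b : Fin 3 → ℝ} (hb : b ∈ orthant 3) :
    ibpFun e x (0, b) = -(6 * e ^ 3) * ∏ i, (Real.exp (-b i) * b i ^ (e - 1)) := by
  have h := mem_orthant.1 hb
  have h0 := h 0
  have h1 := h 1
  have h2 := h 2
  have hC := (esym_pos hb).2.2
  have hp : esym₃ b ^ (e - 1) = esym₃ b ^ (e - 2) * esym₃ b := by
    rw [← Real.rpow_add_one hC.ne']; ring_nf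
  have hq : esym₃ b ^ (e - 1) = b 0 ^ (e - 1) * b 1 ^ (e - 1) * b 2 ^ (e - 1) := by
    rw [esym₃, Real.mul_rpow (by positivity) h2.le, Real.mul_rpow h0.le h1.le]
  have hE : Real.exp (-esym₁ b) = Real.exp (-b 0) * Real.exp (-b 1) * Real.exp (-b 2) := by
    rw [← Real.exp_add, ← Real.exp_add, esym₁]; ring_nf
  rw [Fin.prod_univ_three]
  simp only [ibpFun, ibpExp, ibpPoly, splitU, splitV, splitS, zero_mul, zero_add, zero_div,
    mul_zero, add_zero]
  have hc : cubic (ibpCoeff e x 0) 0 = -6 * e ^ 3 := by simp [cubic, ibpCoeff]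
  rw [hc, hE]
  linear_combination (-(Real.exp (-b 0) * Real.exp (-b 1) * Real.exp (-b 2)) * (6 * e ^ 3)) *
    (hq - hp)

/-- Integrating the singled-out parameter first leaves minus the value on its face, since the
function vanishes at infinity. The other three integrals are Gamma(e). -/
theorem setIntegral_ibpFun' {e x : ℝ} (he : 3 ≤ e) (hx : x ≤ 0) :
    ∫ p in splitRegion, ibpFun' e x p = 6 * e ^ 3 * Real.Gamma e ^ 3 := by
  have hint := integrableOn_ibpFun' he hx
  rw [IntegrableOn, splitRegion, Measure.volume_eq_prod, ← Measure.prod_restrict] at hint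
  rw [splitRegion, Measure.volume_eq_prod, ← Measure.prod_restrict, integral_prod_symm _ hint]
  have h1 : ∀ᵐ b ∂(volume.restrict (orthant 3)),
      ∫ t in Set.Ioi 0, ibpFun' e x (t, b) =
        6 * e ^ 3 * ∏ i, (Real.exp (-b i) * b i ^ (e - 1)) := by
    filter_upwards [hint.prod_left_ae, ae_restrict_mem (measurableSet_orthant 3)] with b hb hb'
    rw [integral_Ioi_of_hasDerivAt_of_tendsto' (fun t ht => hasDerivAt_ibpFun e x ht hb') hb
      (tendsto_ibpFun he hx hb'), ibpFun_zero e x hb']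
    ring
  rw [integral_congr_ae h1, integral_const_mul, orthant, volume_pi, Measure.restrict_pi_pi,
    integral_fintype_prod_eq_pow (ι := Fin 3) (fun t => Real.exp (-t) * t ^ (e - 1)),
    ← Real.Gamma_eq_integral (by linarith)]
  simp

theorem linear_combination_integral {α : Type*} [MeasurableSpace α] {μ : Measure α}
    {f₀ f₁ f₂ f₃ : α → ℂ} (h₀ : Integrable f₀ μ) (h₁ : Integrable f₁ μ) (h₂ : Integrable f₂ μ)
    (h₃ : Integrable f₃ μ) (c₀ c₁ c₂ c₃ : ℂ) :
    c₀ * ∫ a, f₀ a ∂μ + c₁ * ∫ a, f₁ a ∂μ + c₂ * ∫ a, f₂ a ∂μ - c₃ * ∫ a, f₃ a ∂μ =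
      ∫ a, c₀ * f₀ a + c₁ * f₁ a + c₂ * f₂ a - c₃ * f₃ a ∂μ := by
  have h₀ := h₀.const_mul c₀
  have h₁ := h₁.const_mul c₁
  have h₂ := h₂.const_mul c₂
  have h₃ := h₃.const_mul c₃
  rw [integral_sub (by fun_prop) h₃, integral_add (by fun_prop) h₂, integral_add h₀ h₁]
  simp only [integral_const_mul]

/-- For e ≥ 3 the powers U^{e-2} and U^{e-3} have nonnegative exponents, so each total derivative is
integrable separately. By symmetry the four faces contribute equally, whence 24 = 4·6. -/
theorem bananaOperator_schwinger_of_real {e x : ℝ} (he : 3 ≤ e) (hx : x ≤ 0) :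
    bananaOperator e x (schwinger 0 e x) (schwinger 1 e x) (schwinger 2 e x) (schwinger 3 e x) =
      24 * (e * Complex.Gamma e) ^ 3 := by
  have hre : -(1 / 3 : ℝ) < (e : ℂ).re := by simp; linarith
  have hi := fun n => integrableOn_schwinger hre n hx
  have h : ∫ a in orthant 4, ∑ i, ibpFun' e x (split i a) = 24 * (e * Real.Gamma e) ^ 3 := by
    rw [integral_finsetSum]
    · simp only [setIntegral_comp_split, setIntegral_ibpFun' he hx]
      simp; ring
    · intro i _
      exact (integrableOn_comp_split_iff i).2 (integrableOn_ibpFun' he hx)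
  have h' := congrArg (fun r : ℝ => (r : ℂ)) h
  simp only [← integral_complex_ofReal] at h'
  push_cast at h'
  rw [Complex.Gamma_ofReal, ← h']
  simp only [bananaOperator, schwinger]
  rw [linear_combination_integral (hi 0) (hi 1) (hi 2) (hi 3)]
  refine setIntegral_congr_fun (measurableSet_orthant 4) fun a ha => ?_
  have hs := congrArg (fun r : ℝ => (r : ℂ)) (sum_ibpFun' e x ha)
  simp only [Complex.ofReal_sum] at hs
  have hU : ((symU a : ℂ)) ^ ((e : ℂ) - 1) = ((symU a ^ (e - 1) : ℝ) : ℂ) := by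
    rw [Complex.ofReal_cpow (symU_pos ha).le]; simp
  simp only [hs, hU, weight]
  push_cast
  ring

/-- Both sides are analytic in ε on the half-plane and agree at 3 + 1/(n+1), which accumulate at 3.
Writing Γ(ε+1) for εΓ(ε) avoids the apparent singularity at ε = 0. -/
theorem bananaOperator_schwinger {ε : ℂ} (hε : -(1 / 3 : ℝ) < ε.re) {x : ℝ} (hx : x ≤ 0) :
    bananaOperator ε x (schwinger 0 ε x) (schwinger 1 ε x) (schwinger 2 ε x) (schwinger 3 ε x) =
      24 * Complex.Gamma (ε + 1) ^ 3 := by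
  set s : Set ℂ := {ε | -(1 / 3 : ℝ) < ε.re} with hs
  have hopen : IsOpen s := isOpen_lt continuous_const Complex.continuous_re
  have hconn : IsPreconnected s := (convex_halfSpace_re_gt _).isPreconnected
  have hS := fun n => analyticOnNhd_schwinger n hx
  have hΓ : AnalyticOnNhd ℂ (fun ε => Complex.Gamma (ε + 1)) s := by
    refine DifferentiableOn.analyticOnNhd (fun z hz => ?_) hopen
    refine DifferentiableAt.differentiableWithinAt (DifferentiableAt.comp z
      (g := Complex.Gamma) (f := fun ε => ε + 1)
      (Complex.differentiableAt_Gamma _ fun m h => ?_) (by fun_prop))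
    have := congrArg Complex.re h
    simp only [hs, Set.mem_ofPred_eq] at hz
    simp only [Complex.add_re, Complex.one_re, Complex.neg_re, Complex.natCast_re] at this
    have : (0 : ℝ) ≤ m := m.cast_nonneg
    linarith
  have hL : AnalyticOnNhd ℂ (fun ε => bananaOperator ε x (schwinger 0 ε x) (schwinger 1 ε x)
      (schwinger 2 ε x) (schwinger 3 ε x)) s := by
    unfold bananaOperator
    intro z hz
    have := hS 0 z hz
    have := hS 1 z hz
    have := hS 2 z hz
    have := hS 3 z hz
    fun_prop
  have hR : AnalyticOnNhd ℂ (fun ε => 24 * Complex.Gamma (ε + 1) ^ 3) s := by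
    intro z hz
    have := hΓ z hz
    fun_prop
  have h3 : (3 : ℂ) ∈ s := by simp [hs]; norm_num
  refine hL.eqOn_of_preconnected_of_frequently_eq hR hconn h3 ?_ hε
  have hseq : Tendsto (fun n : ℕ => (3 : ℂ) + ((1 / ((n : ℝ) + 1) : ℝ) : ℂ)) atTop (𝓝[≠] 3) := by
    refine tendsto_nhdsWithin_iff.2 ⟨?_, Eventually.of_forall fun n => ?_⟩
    · have := ((Complex.continuous_ofReal.tendsto 0).comp
        (tendsto_one_div_add_atTop_nhds_zero_nat (𝕜 := ℝ))).const_add (3 : ℂ)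
      simpa using this
    · have : ((1 / ((n : ℝ) + 1) : ℝ) : ℂ) ≠ 0 := by
        exact_mod_cast (by positivity : (1 / ((n : ℝ) + 1) : ℝ) ≠ 0)
      simpa using this
  refine hseq.frequently (Frequently.of_forall fun n => ?_)
  have hp : (0 : ℝ) ≤ 1 / ((n : ℝ) + 1) := by positivity
  have h := bananaOperator_schwinger_of_real (e := 3 + 1 / ((n : ℝ) + 1)) (by linarith) hx
  have hne : ((3 + 1 / ((n : ℝ) + 1) : ℝ) : ℂ) ≠ 0 := by
    exact_mod_cast (by positivity : (3 + 1 / ((n : ℝ) + 1) : ℝ) ≠ 0)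
  rw [← Complex.Gamma_add_one _ hne] at h
  simpa only [Complex.ofReal_add, Complex.ofReal_ofNat] using h

end
end Banana

namespace Banana

noncomputable section

/-! ### From Schwinger to Feynman parameters -/

/-- Fubini and b ↦ t b at fixed t > 0, with Jacobian t³. Integrability is obtained together with the
value, since the order of integration is exchanged afterwards. -/
theorem integral_scaling {f : ℝ × (Fin 3 → ℝ) → ℂ} (hfm : Measurable f)
    (hf : Integrable f ((volume.restrict (Set.Ioi 0)).prod volume)) :
    Integrable (fun p : ℝ × (Fin 3 → ℝ) => (p.1 : ℂ) ^ 3 * f (p.1, p.1 • p.2))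
      ((volume.restrict (Set.Ioi 0)).prod volume) ∧
    ∫ p : ℝ × (Fin 3 → ℝ), (p.1 : ℂ) ^ 3 * f (p.1, p.1 • p.2)
        ∂((volume.restrict (Set.Ioi 0)).prod volume) =
      ∫ p, f p ∂((volume.restrict (Set.Ioi 0)).prod volume) := by
  have hm : Measurable fun p : ℝ × (Fin 3 → ℝ) => (p.1 : ℂ) ^ 3 * f (p.1, p.1 • p.2) := by
    fun_prop
  have hpos : ∀ᵐ t : ℝ ∂(volume.restrict (Set.Ioi 0)), 0 < t := ae_restrict_mem measurableSet_Ioi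
  obtain ⟨h1, h2⟩ := (integrable_prod_iff hfm.aestronglyMeasurable).1 hf
  have hint : Integrable (fun p : ℝ × (Fin 3 → ℝ) => (p.1 : ℂ) ^ 3 * f (p.1, p.1 • p.2))
      ((volume.restrict (Set.Ioi 0)).prod volume) := by
    refine (integrable_prod_iff hm.aestronglyMeasurable).2 ⟨?_, h2.congr ?_⟩
    · filter_upwards [h1, hpos] with t ht h0
      exact ((integrable_comp_smul_iff volume (fun b => f (t, b)) h0.ne').2 ht).const_mul _
    · filter_upwards [hpos] with t h0
      have := Measure.integral_comp_smul_of_nonneg (volume : Measure (Fin 3 → ℝ))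
        (fun b => ‖f (t, b)‖) t (hR := h0.le)
      simp only [norm_mul, norm_pow, Complex.norm_real, Real.norm_of_nonneg h0.le]
      rw [integral_const_mul, this, Module.finrank_fin_fun, smul_eq_mul,
        mul_inv_cancel_left₀ (by positivity)]
  refine ⟨hint, ?_⟩
  rw [integral_prod _ hint, integral_prod _ hf]
  refine integral_congr_ae ?_
  filter_upwards [hpos] with t h0
  have := Measure.integral_comp_smul_of_nonneg (volume : Measure (Fin 3 → ℝ))
    (fun b => f (t, b)) t (hR := h0.le)
  rw [integral_const_mul, this, Module.finrank_fin_fun, Complex.real_smul]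
  push_cast
  rw [mul_inv_cancel_left₀ (by exact_mod_cast (pow_pos h0 3).ne')]

/-- The Feynman parameters as a function on `Fin 3`. -/
def simplex : Set (Fin 3 → ℝ) := {b | b ∈ orthant 3 ∧ 0 < 1 - esym₁ b}

theorem measurableSet_simplex : MeasurableSet simplex :=
  (measurableSet_orthant 3).inter (measurableSet_lt (f := fun _ => 0) (g := fun b => 1 - esym₁ b)
    measurable_const (by fun_prop))

/-- The first Symanzik polynomial on the simplex. -/
def simplexU (b : Fin 3 → ℝ) : ℝ := splitU (1 - esym₁ b, b)

/-- The quotient of the two Symanzik polynomials on the simplex. -/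
def simplexRatio (x : ℝ) (b : Fin 3 → ℝ) : ℝ := 1 - x * splitV (1 - esym₁ b, b)

theorem simplexU_pos {b : Fin 3 → ℝ} (hb : b ∈ simplex) : 0 < simplexU b :=
  splitU_pos hb.2.le hb.1

theorem simplexRatio_pos {x : ℝ} (hx : x ≤ 0) {b : Fin 3 → ℝ} (hb : b ∈ simplex) :
    0 < simplexRatio x b := by
  have hU := simplexU_pos hb
  have h3 := (esym_pos hb.1).2.2
  have : 0 ≤ splitV (1 - esym₁ b, b) := by
    have := hb.2
    unfold simplexU at hU
    unfold splitV
    positivity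
  unfold simplexRatio
  nlinarith

/-- The integrand of `schwinger 0`, with one parameter singled out. -/
def splitIntegrand (ε : ℂ) (x : ℝ) : ℝ × (Fin 3 → ℝ) → ℂ :=
  splitRegion.indicator fun p => (splitU p : ℂ) ^ (ε - 1) * (ibpExp x p : ℂ)

theorem measurable_splitIntegrand (ε : ℂ) (x : ℝ) : Measurable (splitIntegrand ε x) := by
  refine Measurable.indicator ?_ measurableSet_splitRegion
  unfold ibpExp
  fun_prop

theorem splitIntegrand_split (ε : ℂ) (x : ℝ) {a : Fin 4 → ℝ} (ha : a ∈ orthant 4) :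
    splitIntegrand ε x (split 3 a) = (symU a : ℂ) ^ (ε - 1) * (weight 0 x a : ℂ) := by
  have hm : split 3 a ∈ splitRegion := split_mem_iff.2 ha
  rw [splitIntegrand, Set.indicator_of_mem hm, splitU_split, ibpExp,
    splitS_split, splitV_split, weight, pow_zero, one_mul]

theorem integrable_splitIntegrand {ε : ℂ} (hε : -(1 / 3 : ℝ) < ε.re) {x : ℝ} (hx : x ≤ 0) :
    Integrable (splitIntegrand ε x) := by
  rw [splitIntegrand, integrable_indicator_iff measurableSet_splitRegion,
    ← (measurePreserving_split 3).integrableOn_comp_preimage (measurableEmbedding_split 3),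
    preimage_split]
  refine (integrableOn_schwinger hε 0 hx).congr_fun (fun a ha => ?_) (measurableSet_orthant 4)
  have hm : split 3 a ∈ splitRegion := split_mem_iff.2 ha
  refine (splitIntegrand_split ε x ha).symm.trans ?_
  exact Set.indicator_of_mem hm _

theorem integral_splitIntegrand (ε : ℂ) (x : ℝ) :
    ∫ p, splitIntegrand ε x p = schwinger 0 ε x := by
  rw [splitIntegrand, integral_indicator measurableSet_splitRegion,
    ← (measurePreserving_split 3).setIntegral_preimage_emb (measurableEmbedding_split 3),
    preimage_split, schwinger]
  refine setIntegral_congr_fun (measurableSet_orthant 4) fun a ha => ?_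
  have hm : split 3 a ∈ splitRegion := split_mem_iff.2 ha
  refine Eq.trans ?_ (splitIntegrand_split ε x ha)
  exact (Set.indicator_of_mem (f := fun p => (splitU p : ℂ) ^ (ε - 1) * (ibpExp x p : ℂ)) hm).symm

theorem measurePreserving_shear :
    MeasurePreserving (fun p : ℝ × (Fin 3 → ℝ) => (p.1 - esym₁ p.2, p.2)) := by
  have h : MeasurePreserving (fun p : (Fin 3 → ℝ) × ℝ => (p.1, p.2 - esym₁ p.1)) :=
    (MeasurePreserving.id volume).skew_product (g := fun b t => t - esym₁ b) (by fun_prop)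
      (Eventually.of_forall fun b => by simpa using map_sub_right_eq_self volume (esym₁ b))
  exact (Measure.measurePreserving_swap.comp h).comp Measure.measurePreserving_swap

/-- After the shear the first variable t is the sum S of all parameters, and rescaling makes the
others Feynman parameters. U and V are homogeneous of degrees 3 and 1, so t appears as t^{3ε}
e^{-t(1-xV)}. -/
theorem splitIntegrand_scaled (ε : ℂ) (x : ℝ) {t : ℝ} (ht : 0 < t) (b : Fin 3 → ℝ) :
    (t : ℂ) ^ 3 * splitIntegrand ε x (t - esym₁ (t • b), t • b) =
      simplex.indicator (fun b => (simplexU b : ℂ) ^ (ε - 1) *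
        ((t : ℂ) ^ (1 + 3 * ε - 1) * Complex.exp (-(simplexRatio x b * t)))) b := by
  have hU : splitU (t - esym₁ (t • b), t • b) = t ^ 3 * simplexU b := by
    simp [simplexU, splitU, esym₁, esym₂, esym₃]; ring
  have hS : splitS (t - esym₁ (t • b), t • b) = t := by simp [splitS]
  have hV : splitV (t - esym₁ (t • b), t • b) = t * splitV (1 - esym₁ b, b) := by
    rw [splitV, hU, splitV, ← simplexU]
    simp only [esym₁, esym₃, Pi.smul_apply, smul_eq_mul]
    rw [mul_div_assoc', show (t - (t * b 0 + t * b 1 + t * b 2)) * (t * b 0 * (t * b 1) * (t * b 2))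
      = t ^ 3 * (t * ((1 - (b 0 + b 1 + b 2)) * (b 0 * b 1 * b 2))) by ring,
      mul_div_mul_left _ _ (pow_pos ht 3).ne']
  have hmem : (t - esym₁ (t • b), t • b) ∈ splitRegion ↔ b ∈ simplex := by
    have he : t - esym₁ (t • b) = t * (1 - esym₁ b) := by simp [esym₁]; ring
    simp only [splitRegion, simplex, Set.mem_prod, Set.mem_Ioi, he, mul_pos_iff_of_pos_left ht,
      mem_orthant, Pi.smul_apply, smul_eq_mul, Set.mem_ofPred_eq]
    exact and_comm
  by_cases hb : b ∈ simplex
  · have hu := simplexU_pos hb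
    rw [splitIntegrand, Set.indicator_of_mem (hmem.2 hb), Set.indicator_of_mem hb, ibpExp, hU, hS,
      hV]
    have h1 : ((t ^ 3 * simplexU b : ℝ) : ℂ) ^ (ε - 1) =
        (t : ℂ) ^ (3 * (ε - 1)) * (simplexU b : ℂ) ^ (ε - 1) := by
      rw [Complex.ofReal_mul, Complex.mul_cpow_ofReal_nonneg (by positivity) hu.le]
      congr 1
      rw [Complex.cpow_ofNat_mul, show t ^ 3 = t * t * t by ring, Complex.ofReal_mul,
        Complex.mul_cpow_ofReal_nonneg (by positivity) ht.le, Complex.ofReal_mul,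
        Complex.mul_cpow_ofReal_nonneg ht.le ht.le]
      ring
    have h2 : (t : ℂ) ^ (1 + 3 * ε - 1) = (t : ℂ) ^ 3 * (t : ℂ) ^ (3 * (ε - 1)) := by
      rw [← Complex.cpow_ofNat, ← Complex.cpow_add _ _ (by exact_mod_cast ht.ne')]
      congr 1
      ring
    have h3 : ((Real.exp (-t + x * (t * splitV (1 - esym₁ b, b))) : ℝ) : ℂ) =
        Complex.exp (-(simplexRatio x b * t)) := by
      rw [Complex.ofReal_exp, simplexRatio]
      congr 1
      push_cast
      ring
    rw [h1, h2, h3]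
    ring
  · rw [splitIntegrand, Set.indicator_of_notMem (mt hmem.1 hb), Set.indicator_of_notMem hb,
      mul_zero]

/-- The integral over the overall scale t is a Gamma integral of argument 1 + 3ε; Re ε > -1/3 is its
condition of convergence at t = 0. -/
theorem schwinger_zero_eq {ε : ℂ} (hε : -(1 / 3 : ℝ) < ε.re) {x : ℝ} (hx : x ≤ 0) :
    schwinger 0 ε x = Complex.Gamma (1 + 3 * ε) * ∫ b in simplex,
      (simplexU b : ℂ) ^ (ε - 1) * (1 / (simplexRatio x b : ℂ)) ^ (1 + 3 * ε) := by
  set H : ℝ × (Fin 3 → ℝ) → ℂ := fun p => splitIntegrand ε x (p.1 - esym₁ p.2, p.2) with hH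
  have hHm : Measurable H := (measurable_splitIntegrand ε x).comp (by fun_prop)
  have hHi : Integrable H :=
    measurePreserving_shear.integrable_comp_of_integrable (integrable_splitIntegrand hε hx)
  have hprod : (volume.restrict (Set.Ioi (0 : ℝ))).prod (volume : Measure (Fin 3 → ℝ)) =
      volume.restrict (Set.Ioi 0 ×ˢ Set.univ) := by
    rw [Measure.volume_eq_prod, ← Measure.prod_restrict, Measure.restrict_univ]
  have h1 : schwinger 0 ε x = ∫ p, H p ∂((volume.restrict (Set.Ioi 0)).prod volume) := by
    rw [hprod, setIntegral_eq_integral_of_forall_compl_eq_zero, ← integral_splitIntegrand]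
    · conv_lhs => rw [← measurePreserving_shear.map_eq]
      rw [integral_map measurePreserving_shear.measurable.aemeasurable
        (measurable_splitIntegrand ε x).aestronglyMeasurable]
    -- Restricting to t > 0 loses nothing: the integrand vanishes unless all parameters, and hence
    -- their sum t, are positive.
    · intro p hp
      refine Set.indicator_of_notMem (fun h => hp ⟨?_, trivial⟩) _
      have h2 : 0 < p.1 - esym₁ p.2 := h.1
      have := (esym_pos h.2).1
      exact Set.mem_Ioi.2 (by linarith)
  have hHi' : Integrable H ((volume.restrict (Set.Ioi 0)).prod volume) := by
    rw [hprod]; exact hHi.integrableOn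
  obtain ⟨h2, h3⟩ := integral_scaling hHm hHi'
  rw [h1, ← h3, integral_prod_symm _ h2, ← integral_const_mul,
    ← integral_indicator measurableSet_simplex]
  congr 1
  funext b
  rw [setIntegral_congr_fun measurableSet_Ioi
    (fun t ht => splitIntegrand_scaled ε x (Set.mem_Ioi.1 ht) b)]
  by_cases hb : b ∈ simplex
  · simp only [Set.indicator_of_mem hb]
    rw [integral_const_mul, Complex.integral_cpow_mul_exp_neg_mul_Ioi _ (simplexRatio_pos hx hb)]
    · ring
    · simp; linarith
  · simp [Set.indicator_of_notMem hb]

/-- Functions on `Fin 3` as triples. -/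
def tripleEquiv : (Fin 3 → ℝ) ≃ᵐ ℝ × ℝ × ℝ :=
  (MeasurableEquiv.piFinSuccAbove (fun _ => ℝ) 0).trans
    (MeasurableEquiv.prodCongr (MeasurableEquiv.refl ℝ) MeasurableEquiv.finTwoArrow)

theorem tripleEquiv_apply (b : Fin 3 → ℝ) : tripleEquiv b = (b 0, b 1, b 2) := rfl

theorem measurePreserving_tripleEquiv : MeasurePreserving tripleEquiv :=
  ((MeasurePreserving.id volume).prod (volume_preserving_finTwoArrow ℝ)).comp
    (volume_preserving_piFinSuccAbove (fun _ => ℝ) 0)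

/-- On the simplex F = U(1 - xV), and U^{ε-1} (U/F)^{1+3ε} = U^{4ε}/F^{1+3ε}. The bases are
positive, so the complex powers split. -/
theorem bananaI1111_eq_schwinger {ε : ℂ} (hε : -(1 / 3 : ℝ) < ε.re) {x : ℝ} (hx : x ≤ 0) :
    bananaI1111 ε x =
      Complex.exp (3 * Real.eulerMascheroniConstant * ε) * schwinger 0 ε x := by
  rw [bananaI1111, schwinger_zero_eq hε hx, mul_assoc,
    ← measurePreserving_tripleEquiv.setIntegral_preimage_emb tripleEquiv.measurableEmbedding]
  have hpre : tripleEquiv ⁻¹' feynmanSimplex = simplex := by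
    ext b
    simp only [Set.mem_preimage, tripleEquiv_apply, feynmanSimplex, simplex, mem_orthant,
      Fin.forall_fin_succ, esym₁, Set.mem_ofPred_eq]
    constructor
    · rintro ⟨h1, h2, h3, h4⟩
      exact ⟨⟨h1, h2, h3, fun i => i.elim0⟩, by linarith⟩
    · rintro ⟨⟨h1, h2, h3, -⟩, h4⟩
      exact ⟨h1, h2, h3, by linarith⟩
  rw [hpre]
  congr 2
  refine setIntegral_congr_fun measurableSet_simplex fun b hb => ?_
  have hU := simplexU_pos hb
  have hr := simplexRatio_pos hx hb
  have hU' : symanzikU (b 0) (b 1) (b 2) (1 - b 0 - b 1 - b 2) = simplexU b := by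
    simp only [symanzikU, simplexU, splitU, esym₁, esym₂, esym₃]; ring
  have hF : symanzikF x (b 0) (b 1) (b 2) (1 - b 0 - b 1 - b 2) = simplexU b * simplexRatio x b := by
    rw [symanzikF, hU', simplexRatio, splitV, ← simplexU]
    field_simp
    simp only [esym₁, esym₃]
    ring
  simp only [tripleEquiv_apply]
  have hz : (simplexU b : ℂ) ≠ 0 := by exact_mod_cast hU.ne'
  have e1 : 4 * ε = (ε - 1) + (1 + 3 * ε) := by ring
  rw [hU', hF, Complex.ofReal_mul, Complex.mul_cpow_ofReal_nonneg hU.le hr.le, one_div,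
    Complex.inv_cpow _ _ (by rw [Complex.arg_ofReal_of_nonneg hr.le]; exact Real.pi_pos.ne), e1,
    Complex.cpow_add _ _ hz]
  have : (simplexU b : ℂ) ^ (1 + 3 * ε) ≠ 0 := by simp [Complex.cpow_eq_zero_iff, hz]
  generalize 1 + 3 * ε = z at this ⊢
  field_simp

theorem solvesBanana_bananaI1111 {ε : ℂ} (hε0 : ε ≠ 0) (hε : -(1 / 3 : ℝ) < ε.re) :
    Branch.SolvesBanana ε (bananaI1111 ε) (Set.Iio 0) := by
  set c := Complex.exp (3 * Real.eulerMascheroniConstant * ε) with hc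
  have hS : ∀ n, ∀ x ∈ Set.Iio (0 : ℝ), HasDerivAt (fun x => c * schwinger n ε x)
      (c * schwinger (n + 1) ε x) x := fun n x hx => (hasDerivAt_schwinger hε n hx).const_mul c
  have h0 : Set.EqOn (bananaI1111 ε) (fun x => c * schwinger 0 ε x) (Set.Iio 0) :=
    fun x hx => bananaI1111_eq_schwinger hε (le_of_lt hx)
  have hd : ∀ {f : ℝ → ℂ} {n : ℕ}, Set.EqOn f (fun x => c * schwinger n ε x) (Set.Iio 0) →
      DifferentiableOn ℝ f (Set.Iio 0) ∧
        Set.EqOn (deriv f) (fun x => c * schwinger (n + 1) ε x) (Set.Iio 0) := by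
    intro f n h
    have h' : ∀ x ∈ Set.Iio (0 : ℝ), HasDerivAt f (c * schwinger (n + 1) ε x) x := fun x hx =>
      (hS n x hx).congr_of_eventuallyEq (h.eventuallyEq_of_mem (Iio_mem_nhds hx))
    exact ⟨fun x hx => (h' x hx).differentiableAt.differentiableWithinAt,
      fun x hx => (h' x hx).deriv⟩
  have h1 := hd h0
  have h2 := hd h1.2
  have h3 := hd h2.2
  refine ⟨h1.1, h2.1, h3.1, fun x hx => ?_⟩
  rw [h0 hx, h1.2 hx, h2.2 hx, h3.2 hx]
  have key := bananaOperator_schwinger hε (le_of_lt hx)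
  rw [Complex.Gamma_add_one _ hε0] at key
  -- e^{3γε} is the cube of the tadpole prefactor, so 24 e^{3γε} Γ(1+ε)³ = 24 ε³ I₁₁₁₀ = 24 I₁.
  have hc3 : c = Complex.exp (Real.eulerMascheroniConstant * ε) ^ 3 := by
    rw [hc, ← Complex.exp_nat_mul]; congr 1; push_cast; ring
  simp only [Branch.I₁, bananaI1110, tadpole, mul_pow]
  rw [← hc3]
  simp only [bananaOperator, Complex.coe_algebraMap] at key ⊢
  linear_combination c * key

end
end Banana

theorem mainTheorem1 :
    -- on the Euclidean axis
    (∀ x : ℝ, x < 0 →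
      Banana.euclid.LetterIdentities Banana.euclidF₂ x ∧
      ∀ ε : ℂ, ε ≠ 0 → -(1 / 3 : ℝ) < ε.re →
        Banana.euclid.EpsFactorised Banana.euclidF₂ ε (Banana.bananaI1111 ε) x) ∧
    -- and everywhere under analytic continuation in `x`
    (∀ (U : Set ℂ) (x₀ : ℝ) (Q : Banana.Branch ℂ) (F₂ : ℂ → ℂ),
      IsOpen U → IsPreconnected U → (0 : ℂ) ∉ U → (4 : ℂ) ∉ U → (16 : ℂ) ∉ U →
      x₀ < 0 → (x₀ : ℂ) ∈ U →
      Banana.ContinuesBranch U x₀ Q → (∀ z ∈ U, Q.psiSun₁ z ≠ 0) →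
      Banana.Continues U x₀ Banana.euclidF₂ F₂ →
      ∀ z ∈ U,
        Q.LetterIdentities F₂ z ∧
        ∀ (ε : ℂ) (Φ : ℂ → ℂ), ε ≠ 0 → -(1 / 3 : ℝ) < ε.re →
          Banana.Continues U x₀ (Banana.bananaI1111 ε) Φ →
          Q.EpsFactorised F₂ ε Φ z) := by
  exact Banana.main_of_regularOn Banana.euclid_regularOn fun _ => Banana.solvesBanana_bananaI1111
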